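/- Let $B_r$ be the open ball of radius $r$ about $0$ in $\mathbb R^n$, and let $\overline{\mathbb R}^n=\mathbb R^n\cup\{\infty\}$. Let $\phi$ be a Möbius transformation of $\overline{\mathbb R}^n$, i.e. a finite composition of reflections in spheres or hyperplanes, such that $b:=\phi^{-1}(\infty)\in\mathbb R^n\setminus\{0\}$. Then there is a unique $R>0$ such that $\phi=\psi\sigma$, where $\sigma$ is the reflection in the sphere $S^{n-1}(b,R)$ (the isometric sphere of $\phi$) and $\psi$ is a Euclidean isometry. Let $a=\sigma(0)$. Fix $\bar r\in(0,|b|)$ and define $$f(x)=\frac{R^2|\phi^{-1}(x)|^2}{|b|^2-|\phi^{-1}(x)|^2}\qquad (x\in\phi(B_{\bar r})).$$ Let $k\ge 1$ and let $\Sigma\subset\phi(B_{\bar r})$ be a smooth embedded $k$-dimensional minimal submanifold (its mean curvature vanishes identically) with $\partial\Sigma:=\overline\Sigma\setminus\Sigma\subset\partial\phi(B_{\bar r})$. Write $|\cdot|$ also for the $k$-dimensional volume (Hausdorff measure), with respect to which all integrals over subsets of $\Sigma$ are taken, and $X^\top$, $X^\perp$ for the components of a vector $X$ tangential and normal to $T_x\Sigma$.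 For $r\in(0,\bar r)$ put $$J(r)=\Big(\frac{|b|^2-r^2}{r^2}\Big)^{k/2}|\Sigma\cap\phi(B_r)|,\qquad I(r)=\Big(\frac{|b|^2-r^2}{r^2}\Big)^{k/2}\int_{\Sigma\cap\phi(B_r)}\frac{|(x-\phi(0))^\top|^2}{|x-\phi(0)|^2}.$$ These quantities are finite, and for $0<r<q<\bar r$ all the following integrals converge and $$J(q)-J(r)=R^k\int_{\Sigma\cap\phi(B_q)\setminus\phi(B_r)}f^{-\frac k2}\,\frac{|b|^4|(x-\phi(0))^\perp|^2+f^2|(\phi(\infty)-\phi(a))^\top|^2}{|b|^4|x-\phi(0)|^2},$$ $$I(q)-I(r)=R^k\int_{\Sigma\cap\phi(B_q)\setminus\phi(B_r)}f^{-\frac{k-4}2}\,\frac{|(\phi(\infty)-\phi(a))^\top|^2}{|b|^4|x-\phi(0)|^2}+k|b|^2\int_r^q\frac{(|b|^2-\rho^2)^{\frac{k-2}2}}{\rho^{k+1}}\int_{\Sigma\cap\phi(B_\rho)}\frac{|(x-\phi(0))^\perp|^2}{|x-\phi(0)|^2}\,d\rho.$$ In particular, $I$ and $J$ are monotone increasing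 on $(0,\bar r)$. Moreover, if $\Sigma\neq\emptyset$ and $I$ or $J$ is constant on $(0,\bar r)$, then $\Sigma$ is a totally geodesic disk (a ball in a $k$-dimensional affine subspace) which contains $\phi(0)$ and is orthogonal to $\phi(\infty)-\phi(a)$. -/

import Mathlib

open Set MeasureTheory Topology
open scoped OnePoint RealInnerProductSpace

noncomputable section

namespace MobiusMonotonicity

/-- Euclidean `n`-space. -/
abbrev E (n : ℕ) : Type := EuclideanSpace ℝ (Fin n)

/-! ### Möbius transformations of the extended space -/

/-- The map underlying the reflection in the sphere of centre `c` and radius `R`: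
`c ↦ ∞`, `∞ ↦ c`, and `x ↦ c + (R² / |x - c|²) (x - c)` otherwise. -/
def sphereReflectionFun {n : ℕ} (c : E n) (R : ℝ) : OnePoint (E n) → OnePoint (E n) :=
  open Classical in
  fun z => z.elim (c : OnePoint (E n))
    (fun x => if x = c then ∞ else ((EuclideanGeometry.inversion c R x : E n) : OnePoint (E n)))

theorem sphereReflectionFun_involutive {n : ℕ} (c : E n) {R : ℝ} (hR : 0 < R) :
    Function.Involutive (sphereReflectionFun c R) := by
  intro z
  induction z using OnePoint.rec with
  | infty => simp [sphereReflectionFun]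
  | coe x =>
    by_cases hx : x = c
    · simp [sphereReflectionFun, hx]
    · simp [sphereReflectionFun, hx, EuclideanGeometry.inversion_eq_center hR.ne',
        EuclideanGeometry.inversion_inversion c hR.ne']

/-- The reflection of the extended space in the sphere of centre `c` and radius `R > 0`. -/
def sphereReflection {n : ℕ} (c : E n) (R : ℝ) (hR : 0 < R) : Equiv.Perm (OnePoint (E n)) :=
  (sphereReflectionFun_involutive c hR).toPerm

/-- The map underlying the reflection in the hyperplane `{x | ⟪v, x⟫ = t}`, fixing `∞`. -/
def planeReflectionFun {n : ℕ} (v : E n) (t : ℝ) : OnePoint (E n) → OnePoint (E n) :=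
  OnePoint.map (fun x => x - (2 * (⟪v, x⟫ - t) / ‖v‖ ^ 2) • v)

theorem planeReflectionFun_involutive {n : ℕ} {v : E n} (hv : v ≠ 0) (t : ℝ) :
    Function.Involutive (planeReflectionFun v t) := by
  intro z
  induction z using OnePoint.rec with
  | infty => rfl
  | coe x =>
    have hv' : ‖v‖ ^ 2 ≠ 0 := pow_ne_zero _ (norm_ne_zero_iff.mpr hv)
    simp only [planeReflectionFun, OnePoint.map_some, inner_sub_right, inner_smul_right,
      real_inner_self_eq_norm_sq, OnePoint.coe_eq_coe]
    rw [sub_sub, ← add_smul]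
    have h0 : 2 * (⟪v, x⟫ - t) / ‖v‖ ^ 2 +
        2 * (⟪v, x⟫ - 2 * (⟪v, x⟫ - t) / ‖v‖ ^ 2 * ‖v‖ ^ 2 - t) / ‖v‖ ^ 2 = 0 := by
      field_simp
      ring
    rw [h0, zero_smul, sub_zero]

/-- The reflection of the extended space in the hyperplane `{x | ⟪v, x⟫ = t}`, `v ≠ 0`. -/
def planeReflection {n : ℕ} (v : E n) (hv : v ≠ 0) (t : ℝ) : Equiv.Perm (OnePoint (E n)) :=
  (planeReflectionFun_involutive hv t).toPerm

/-- Reflections of the extended space in spheres or planes. -/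
def IsReflection {n : ℕ} (σ : Equiv.Perm (OnePoint (E n))) : Prop :=
  (∃ (c : E n) (R : ℝ) (hR : 0 < R), σ = sphereReflection c R hR) ∨
    ∃ (v : E n) (hv : v ≠ 0) (t : ℝ), σ = planeReflection v hv t

/-- A Möbius transformation: a finite composition of reflections in spheres or planes. -/
def IsMobius {n : ℕ} (φ : Equiv.Perm (OnePoint (E n))) : Prop :=
  ∃ l : List (Equiv.Perm (OnePoint (E n))), (∀ σ ∈ l, IsReflection σ) ∧ φ = l.prod

/-- `S(c, R)` is the isometric sphere of `φ`: one has `φ = ψ ∘ σ` with `σ` the reflection in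
`S(c, R)` and `ψ` a Euclidean isometry (extended by `∞ ↦ ∞`). -/
def IsIsometricSphere {n : ℕ} (φ : Equiv.Perm (OnePoint (E n))) (c : E n) (R : ℝ) : Prop :=
  ∃ hR : 0 < R, ∃ ψ : E n ≃ᵢ E n, ∀ z, φ z = OnePoint.map ψ (sphereReflection c R hR z)

/-- A point of the extended space other than `∞`, regarded as a point of Euclidean space
(with the value `0` at `∞`, which is never used). -/
def finitePart {n : ℕ} (z : OnePoint (E n)) : E n := z.elim 0 id

/-- The part of `φ(B_r)` in Euclidean space, `B_r` the open ball of radius `r` about `0`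
(this is all of `φ(B_r)` when `φ⁻¹(∞) ∉ B_r`). -/
def imageBall {n : ℕ} (φ : Equiv.Perm (OnePoint (E n))) (r : ℝ) : Set (E n) :=
  {x | ∃ y ∈ Metric.ball (0 : E n) r, φ (y : OnePoint (E n)) = (x : OnePoint (E n))}

/-! ### Minimal submanifolds of Euclidean space -/

/-- `F : Ω → M` is a smooth local parametrization of `M`: `Ω` is open in `ℝᵏ`, `F` is a smooth
immersion and a homeomorphism of `Ω` onto a relatively open subset of `M`. -/
structure IsLocalParam {n : ℕ} (k : ℕ) (M : Set (E n)) (Ω : Set (E k)) (F : E k → E n) :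
    Prop where
  isOpen : IsOpen Ω
  contDiffOn : ContDiffOn ℝ (⊤ : ℕ∞) F Ω
  injective_fderiv : ∀ u ∈ Ω, Function.Injective (fderiv ℝ F u)
  isEmbedding : IsEmbedding (Ω.domRestrict F)
  image_eq : ∃ W : Set (E n), IsOpen W ∧ F '' Ω = M ∩ W

/-- `M` is a smooth embedded `k`-dimensional submanifold (without boundary points). -/
def IsSubmanifold {n : ℕ} (k : ℕ) (M : Set (E n)) : Prop :=
  ∀ x ∈ M, ∃ (Ω : Set (E k)) (F : E k → E n), IsLocalParam k M Ω F ∧ x ∈ F '' Ω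

/-- The first fundamental form `g_ij = ⟪∂_i F, ∂_j F⟫` of a parametrization. -/
def firstFundamentalForm {n k : ℕ} (F : E k → E n) (u : E k) : Matrix (Fin k) (Fin k) ℝ :=
  Matrix.of fun i j =>
    ⟪fderiv ℝ F u (EuclideanSpace.single i 1), fderiv ℝ F u (EuclideanSpace.single j 1)⟫

/-- The second fundamental form `A_ij = (∂_i ∂_j F)^⊥` of a parametrization. -/
def secondFundamentalForm {n k : ℕ} (F : E k → E n) (u : E k) (i j : Fin k) : E n :=
  ((fderiv ℝ F u).range)ᗮ.starProjection
    (fderiv ℝ (fderiv ℝ F) u (EuclideanSpace.single i 1) (EuclideanSpace.single j 1))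

/-- The mean curvature vector `H = ∑ g^{ij} A_ij`, the trace of the second fundamental form with
respect to the first. -/
def meanCurvature {n k : ℕ} (F : E k → E n) (u : E k) : E n :=
  ∑ i, ∑ j, (firstFundamentalForm F u)⁻¹ i j • secondFundamentalForm F u i j

/-- `M` is a `k`-dimensional minimal submanifold: its mean curvature vanishes identically. -/
structure IsMinimalSubmanifold {n : ℕ} (k : ℕ) (M : Set (E n)) : Prop where
  isSubmanifold : IsSubmanifold k M
  meanCurvature_eq_zero : ∀ (Ω : Set (E k)) (F : E k → E n), IsLocalParam k M Ω F →
    ∀ u ∈ Ω, meanCurvature F u = 0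

/-- The tangent space `T_x M`, spanned by the velocities of the curves in `M` through `x`. -/
def tangentSpace {n : ℕ} (M : Set (E n)) (x : E n) : Submodule ℝ (E n) :=
  Submodule.span ℝ {v | ∃ γ : ℝ → E n, γ 0 = x ∧ (∀ᶠ t in 𝓝 0, γ t ∈ M) ∧ HasDerivAt γ v 0}

/-- `v^⊤`, the orthogonal projection of `v` to `T_x M`. -/
def tanPart {n : ℕ} (M : Set (E n)) (x v : E n) : E n := (tangentSpace M x).starProjection v

/-- `v^⊥ = v - v^⊤`, the component of `v` normal to `T_x M`. -/
def norPart {n : ℕ} (M : Set (E n)) (x v : E n) : E n := v - tanPart M x v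

/-- `D` is a (flat, open) `k`-dimensional disk parallel to the subspace `V`. -/
def IsFlatDisk {n : ℕ} (k : ℕ) (V : Submodule ℝ (E n)) (D : Set (E n)) : Prop :=
  Module.finrank ℝ V = k ∧
    ∃ (c : E n) (ρ : ℝ), 0 < ρ ∧ D = {x | x - c ∈ V ∧ ‖x - c‖ < ρ}

/-! ### The quantities in the monotonicity formulas -/

/-- `f(x) = R² |φ⁻¹(x)|² / (|b|² - |φ⁻¹(x)|²)`. -/
def levelFun {n : ℕ} (φ : Equiv.Perm (OnePoint (E n))) (b : E n) (R : ℝ) (x : E n) : ℝ :=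
  R ^ 2 * ‖finitePart (φ.symm x)‖ ^ 2 / (‖b‖ ^ 2 - ‖finitePart (φ.symm x)‖ ^ 2)

/-- `J(r) = ((|b|² - r²) / r²)^{k/2} |M ∩ φ(B_r)|`. -/
def volumeJ {n : ℕ} (k : ℕ) (φ : Equiv.Perm (OnePoint (E n))) (b : E n) (M : Set (E n))
    (r : ℝ) : ℝ :=
  ((‖b‖ ^ 2 - r ^ 2) / r ^ 2) ^ ((k : ℝ) / 2) *
    (μHE[k] : Measure (E n)).real (M ∩ imageBall φ r)

/-- `I(r) = ((|b|² - r²) / r²)^{k/2} ∫_{M ∩ φ(B_r)} |(x - p)^⊤|² / |x - p|²`, `p = φ(0)`. -/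
def weightedI {n : ℕ} (k : ℕ) (φ : Equiv.Perm (OnePoint (E n))) (b p : E n) (M : Set (E n))
    (r : ℝ) : ℝ :=
  ((‖b‖ ^ 2 - r ^ 2) / r ^ 2) ^ ((k : ℝ) / 2) *
    ∫ x in M ∩ imageBall φ r, ‖tanPart M x (x - p)‖ ^ 2 / ‖x - p‖ ^ 2 ∂μHE[k]

/-- The integrand of the volume identity, with `p = φ(0)` and `w = φ(∞) - φ(a)`. -/
def volumeIntegrand {n : ℕ} (k : ℕ) (φ : Equiv.Perm (OnePoint (E n))) (b : E n) (R : ℝ)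
    (p w : E n) (M : Set (E n)) (x : E n) : ℝ :=
  levelFun φ b R x ^ (-(k : ℝ) / 2) *
    ((‖b‖ ^ 4 * ‖norPart M x (x - p)‖ ^ 2 + levelFun φ b R x ^ 2 * ‖tanPart M x w‖ ^ 2) /
      (‖b‖ ^ 4 * ‖x - p‖ ^ 2))

/-- The first integrand of the weighted identity, with `p = φ(0)` and `w = φ(∞) - φ(a)`. -/
def weightedIntegrand {n : ℕ} (k : ℕ) (φ : Equiv.Perm (OnePoint (E n))) (b : E n) (R : ℝ)
    (p w : E n) (M : Set (E n)) (x : E n) : ℝ :=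
  levelFun φ b R x ^ (-((k : ℝ) - 4) / 2) * (‖tanPart M x w‖ ^ 2 / (‖b‖ ^ 4 * ‖x - p‖ ^ 2))

/-- The integrand in `ρ` of the second term of the weighted identity, with `p = φ(0)`. -/
def radialIntegrand {n : ℕ} (k : ℕ) (φ : Equiv.Perm (OnePoint (E n))) (b p : E n)
    (M : Set (E n)) (ρ : ℝ) : ℝ :=
  (‖b‖ ^ 2 - ρ ^ 2) ^ (((k : ℝ) - 2) / 2) / ρ ^ (k + 1) *
    ∫ x in M ∩ imageBall φ ρ, ‖norPart M x (x - p)‖ ^ 2 / ‖x - p‖ ^ 2 ∂μHE[k]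

end MobiusMonotonicity

end

open MobiusMonotonicity

noncomputable section

namespace MobiusMonotonicity

open Filter Metric
open scoped ENNReal NNReal

/-! ### The area formula for injective immersions -/

section AreaFormula

/-! Write `p = φ(0)`, `w = φ(∞) - φ(a)`, `e = w/|w|²` and `D(x) = R² - 2⟪x - p, w⟫`. Since `φ` is an
isometry after a reflection, `|w| = |b|`, the image balls of radius below `|b|` lie in the
half-space `D > 0`, and there `f = |w|²|x - p|²/D`. Hence `φ(B_r)` is a sublevel set of `f`, and the
factor in front of `I` and `J` is `R^k f^(-k/2)` on its boundary. Everything reduces to an identity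
for sublevel sets of an explicit function.

The gradient of `f` is `(2|w|²/D)((x - p) + f e)`. Take the field `Z = A(f)(x - p) - B(f)e` with `A'
= -g` and `B'(t) = -t g(t)`. The mixed terms in its tangential divergence cancel, leaving `k A(f) -
g(f)(2|w|²/D)(|(x - p)^⊤|² - f²|e^⊤|²)`. On a minimal submanifold this integrates to zero when `g`
vanishes beyond some level below that of `B_rbar` (`integral_first_variation`). Letting `g` tend to
`(1/2)t^(-k/2-1)` on `[a, c)` and zero elsewhere gives the volume identity, because `|w|²/D = f/|x -
p|²` and `|(x - p)^⊤|² = |x - p|² - |(x - p)^⊥|²`.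

The identity for `I` follows from the one for `J`: `I` is `J` minus the weight times the integral of
`|(x - p)^⊥|²/|x - p|²`, and the increment of that product is computed by Fubini
(`weight_mul_integral_sublevel`). All integrands are nonnegative, so `I` and `J` increase.

If either is constant, continuity gives `(x - p)^⊥ = 0` and `w^⊤ = 0` at every point of the
submanifold other than `p`. Being tangent to the radial field and relatively closed in the image
ball, it contains the segments from its points down to `p`, hence `p` itself. It therefore lies in
the affine tangent space at `p`, is open there by the inverse function theorem, and fills a ball by
connectedness.

The analytic input is the divergence theorem for compactly supported fields
(`integral_tangentialDiv_eq_zero`). It rests on the area formula for charts, the coordinate identity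
`∑ ∂_i(√g g^{ij} ∂_j F) = √g H`, and a partition of unity. -/

theorem euclideanHausdorffMeasure_image_le_of_dist_le {α : Type*} {n : ℕ} (d : ℕ) {f g : α → E n}
    {s : Set α} {K : ℝ≥0} (h : ∀ x ∈ s, ∀ y ∈ s, dist (f x) (f y) ≤ K * dist (g x) (g y)) :
    (μHE[d] : Measure (E n)) (f '' s) ≤ (K : ℝ≥0∞) ^ d * (μHE[d] : Measure (E n)) (g '' s) := by
  rcases isEmpty_or_nonempty α with hα | hα
  · simp [Set.eq_empty_of_isEmpty s]
  have hinv : ∀ x ∈ s, Function.invFunOn g s (g x) ∈ s ∧ g (Function.invFunOn g s (g x)) = g x :=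
    fun x hx => ⟨Function.invFunOn_mem ⟨x, hx, rfl⟩, Function.invFunOn_eq ⟨x, hx, rfl⟩⟩
  -- Although `g` need not be injective, the hypothesis makes `g x ↦ f x` well defined and
  -- `K`-Lipschitz on `g '' s`.
  have hlip : LipschitzOnWith K (f ∘ Function.invFunOn g s) (g '' s) := by
    refine LipschitzOnWith.of_dist_le_mul ?_
    rintro _ ⟨x, hx, rfl⟩ _ ⟨y, hy, rfl⟩
    have := h _ (hinv x hx).1 _ (hinv y hy).1
    rwa [(hinv x hx).2, (hinv y hy).2] at this
  have himg : f '' s = (f ∘ Function.invFunOn g s) '' (g '' s) := by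
    rw [Set.image_image]
    refine Set.image_congr fun x hx => ?_
    have := h x hx _ (hinv x hx).1
    rw [(hinv x hx).2, dist_self, mul_zero] at this
    exact dist_le_zero.1 this
  have := hlip.hausdorffMeasure_image_le (d := d) (by positivity)
  rw [himg, Measure.euclideanHausdorffMeasure_def, Measure.smul_apply, Measure.smul_apply]
  rw [ENNReal.rpow_natCast] at this
  calc _ ≤ _ • ((K : ℝ≥0∞) ^ d * μH[d] (g '' s)) := by gcongr
    _ = _ := by rw [ENNReal.smul_def, ENNReal.smul_def, smul_eq_mul, smul_eq_mul, mul_left_comm]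

/-- An injective linear map of a finite-dimensional space expands distances by a definite factor, so
the error in strict differentiability can be absorbed into `dist (L x) (L y)`. -/
theorem exists_dist_le_of_hasStrictFDerivAt {k n : ℕ} {F : E k → E n} {L : E k →L[ℝ] E n} {u : E k}
    (hF : HasStrictFDerivAt F L u) (hL : Function.Injective L) {ε : ℝ} (hε : 0 < ε) :
    ∀ᶠ r in 𝓝[>] (0 : ℝ), ∀ x ∈ closedBall u r, ∀ y ∈ closedBall u r,
      dist (F x) (F y) ≤ (1 + ε) * dist (L x) (L y) ∧
      dist (L x) (L y) ≤ (1 + ε) * dist (F x) (F y) := by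
  obtain ⟨K, hK, hanti⟩ := (LinearMap.injective_iff_antilipschitz (L : E k →ₗ[ℝ] E n)).1 hL
  have hε1 : 0 < ε / (1 + ε) := by positivity
  -- With this `c` the error is at most `ε/(1 + ε)` times `dist (L x) (L y)`; the lower bound then
  -- has factor `1 - ε/(1 + ε) = 1/(1 + ε)`.
  set c : ℝ≥0 := (ε / (1 + ε)).toNNReal / K with hc
  have hcpos : 0 < c := div_pos (Real.toNNReal_pos.2 hε1) hK
  obtain ⟨s, hs, happ⟩ := hF.approximates_deriv_on_nhds (c := c) (Or.inr hcpos)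
  obtain ⟨δ, hδ, hball⟩ := Metric.nhds_basis_closedBall.mem_iff.1 hs
  filter_upwards [Ioc_mem_nhdsGT hδ] with r hr x hx y hy
  have hxs := hball (closedBall_subset_closedBall hr.2 hx)
  have hys := hball (closedBall_subset_closedBall hr.2 hy)
  have h1 := happ x hxs y hys
  have h2 : dist x y ≤ K * dist (L x) (L y) := hanti.le_mul_dist x y
  have h3 : (c : ℝ) * ‖x - y‖ ≤ ε / (1 + ε) * dist (L x) (L y) := by
    rw [← dist_eq_norm]
    calc (c : ℝ) * dist x y ≤ c * (K * dist (L x) (L y)) := by gcongr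
      _ = _ := by
        rw [hc, NNReal.coe_div, Real.coe_toNNReal _ hε1.le]
        have : (K : ℝ) ≠ 0 := by exact_mod_cast hK.ne'
        field_simp
  rw [map_sub] at h1
  have h4 : ‖(F x - F y) - (L x - L y)‖ ≤ ε / (1 + ε) * dist (L x) (L y) := h1.trans h3
  have h5 : dist (F x) (F y) ≤ ‖(F x - F y) - (L x - L y)‖ + dist (L x) (L y) := by
    rw [dist_eq_norm, dist_eq_norm]
    simpa using norm_add_le ((F x - F y) - (L x - L y)) (L x - L y)
  have h6 : dist (L x) (L y) ≤ ‖(F x - F y) - (L x - L y)‖ + dist (F x) (F y) := by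
    rw [dist_eq_norm, dist_eq_norm, norm_sub_rev (F x - F y)]
    simpa using norm_add_le ((L x - L y) - (F x - F y)) (F x - F y)
  have hD : 0 ≤ dist (L x) (L y) := dist_nonneg
  have h7 : ε / (1 + ε) ≤ ε := div_le_self hε.le (by linarith)
  constructor
  · nlinarith
  · have h8 : (1 - ε / (1 + ε)) * dist (L x) (L y) ≤ dist (F x) (F y) := by linarith
    have h9 : 1 - ε / (1 + ε) = 1 / (1 + ε) := by field_simp; ring
    rw [h9] at h8
    calc dist (L x) (L y) = (1 + ε) * (1 / (1 + ε) * dist (L x) (L y)) := by field_simp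
      _ ≤ _ := by gcongr

/-- The Jacobian `√(det (∂F)ᵀ∂F)` of a map between Euclidean spaces. -/
def jacobian {k n : ℕ} (F : E k → E n) (u : E k) : ℝ := (fderiv ℝ F u).toLinearMap.normDet

theorem jacobian_nonneg {k n : ℕ} (F : E k → E n) (u : E k) : 0 ≤ jacobian F u :=
  LinearMap.normDet_nonneg _

theorem jacobian_sq {k n : ℕ} (F : E k → E n) (u : E k) :
    jacobian F u ^ 2 = (firstFundamentalForm F u).det := by
  have := (fderiv ℝ F u).toLinearMap.normDet_sq_eq_det_gram (EuclideanSpace.basisFun (Fin k) ℝ)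
  simp only [RCLike.ofReal_real_eq_id, id] at this
  rw [jacobian, this]
  congr 1
  ext i j
  simp [firstFundamentalForm, Matrix.gram]

theorem jacobian_eq_sqrt {k n : ℕ} (F : E k → E n) (u : E k) :
    jacobian F u = √(firstFundamentalForm F u).det := by
  rw [← jacobian_sq, Real.sqrt_sq (jacobian_nonneg F u)]

theorem jacobian_pos {k n : ℕ} {F : E k → E n} {u : E k}
    (h : Function.Injective (fderiv ℝ F u)) : 0 < jacobian F u := by
  refine lt_of_le_of_ne (jacobian_nonneg F u) (Ne.symm ?_)
  exact ((fderiv ℝ F u).toLinearMap.normDet_ne_zero_tfae.out 4 0).1 h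

theorem image_linear_measure {k n : ℕ} (L : E k →L[ℝ] E n) (s : Set (E k)) :
    (μHE[k] : Measure (E n)) (L '' s) = ENNReal.ofReal L.toLinearMap.normDet * volume s := by
  have := L.toLinearMap.euclideanHausdorffMeasure_image_eq_normDet_mul_volume s
  simpa using this

/-- On small balls `F` and its derivative distort distances equally up to `1 + ε`, so their
`k`-dimensional image measures agree up to `(1 + ε)^k`; then `ε → 0`. -/
theorem eq_jacobian_of_tendsto {k n : ℕ} {F : E k → E n} {u : E k}
    (hF : HasStrictFDerivAt F (fderiv ℝ F u) u) (hL : Function.Injective (fderiv ℝ F u))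
    {a : ℝ≥0∞} (h : Tendsto (fun r => (μHE[k] : Measure (E n)) (F '' closedBall u r) /
      volume (closedBall u r)) (𝓝[>] 0) (𝓝 a)) :
    a = ENNReal.ofReal (jacobian F u) := by
  set J := ENNReal.ofReal (jacobian F u)
  have key : ∀ ε : ℝ, 0 < ε → a ≤ ENNReal.ofReal ((1 + ε) ^ k) * J ∧
      J ≤ ENNReal.ofReal ((1 + ε) ^ k) * a := by
    intro ε hε
    have hev := exists_dist_le_of_hasStrictFDerivAt hF hL hε
    have hpow : ENNReal.ofReal ((1 + ε) ^ k) = ((1 + ε).toNNReal : ℝ≥0∞) ^ k := by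
      rw [ENNReal.ofReal_pow (by positivity)]; rfl
    have hcoe : (((1 + ε).toNNReal : ℝ≥0) : ℝ) = 1 + ε := Real.coe_toNNReal _ (by positivity)
    have hvol : ∀ r : ℝ, 0 < r → volume (closedBall u r) ≠ 0 ∧ volume (closedBall u r) ≠ (⊤ : ℝ≥0∞) :=
      fun r hr => ⟨(measure_closedBall_pos volume u hr).ne',
        (isCompact_closedBall u r).measure_lt_top.ne⟩
    constructor
    · refine le_of_tendsto h ?_
      filter_upwards [hev, self_mem_nhdsWithin] with r hr hr0
      refine ENNReal.div_le_of_le_mul ?_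
      have := euclideanHausdorffMeasure_image_le_of_dist_le k (f := F) (g := fderiv ℝ F u)
        (s := closedBall u r) (K := (1 + ε).toNNReal)
        (fun x hx y hy => by rw [hcoe]; exact (hr x hx y hy).1)
      rw [image_linear_measure, ← mul_assoc] at this
      rw [hpow]; exact this
    · refine ge_of_tendsto (ENNReal.Tendsto.const_mul h (Or.inr ENNReal.ofReal_ne_top)) ?_
      filter_upwards [hev, self_mem_nhdsWithin] with r hr hr0
      have := euclideanHausdorffMeasure_image_le_of_dist_le k (f := fderiv ℝ F u) (g := F)
        (s := closedBall u r) (K := (1 + ε).toNNReal)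
        (fun x hx y hy => by rw [hcoe]; exact (hr x hx y hy).2)
      rw [image_linear_measure] at this
      rw [hpow, ← mul_div_assoc]
      exact (ENNReal.le_div_iff_mul_le (Or.inl (hvol r hr0).1) (Or.inl (hvol r hr0).2)).2 this
  have hlim : ∀ b : ℝ≥0∞, Tendsto (fun ε : ℝ => ENNReal.ofReal ((1 + ε) ^ k) * b) (𝓝[>] 0) (𝓝 b) := by
    intro b
    have h1 : Tendsto (fun ε : ℝ => ENNReal.ofReal ((1 + ε) ^ k)) (𝓝[>] 0) (𝓝 1) := by
      have : Continuous fun ε : ℝ => ENNReal.ofReal ((1 + ε) ^ k) :=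
        ENNReal.continuous_ofReal.comp (by fun_prop)
      have := this.tendsto 0
      simp only [add_zero, one_pow, ENNReal.ofReal_one] at this
      exact this.mono_left nhdsWithin_le_nhds
    simpa using ENNReal.Tendsto.mul_const h1 (Or.inl one_ne_zero)
  apply le_antisymm
  · exact ge_of_tendsto (hlim J) (by filter_upwards [self_mem_nhdsWithin] with ε hε using (key ε hε).1)
  · exact ge_of_tendsto (hlim a) (by filter_upwards [self_mem_nhdsWithin] with ε hε using (key ε hε).2)

/-- An injective Lipschitz immersion of an open set. -/
structure IsLipschitzImmersion {k n : ℕ} (Ω : Set (E k)) (F : E k → E n) : Prop where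
  isOpen : IsOpen Ω
  contDiffOn : ContDiffOn ℝ 1 F Ω
  injective_fderiv : ∀ u ∈ Ω, Function.Injective (fderiv ℝ F u)
  injOn : InjOn F Ω
  lipschitz : ∃ C : ℝ≥0, LipschitzOnWith C F Ω

variable {k n : ℕ} {Ω : Set (E k)} {F : E k → E n}

theorem continuousOn_fderiv_of_contDiffOn (hΩ : IsOpen Ω) (hF : ContDiffOn ℝ 1 F Ω) :
    ContinuousOn (fderiv ℝ F) Ω :=
  hF.continuousOn_fderiv_of_isOpen hΩ le_rfl

theorem continuousOn_firstFundamentalForm (hΩ : IsOpen Ω) (hF : ContDiffOn ℝ 1 F Ω) (i j : Fin k) :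
    ContinuousOn (fun u => firstFundamentalForm F u i j) Ω := by
  have := continuousOn_fderiv_of_contDiffOn hΩ hF
  simp only [firstFundamentalForm, Matrix.of_apply]
  exact (this.clm_apply continuousOn_const).inner (𝕜 := ℝ) (this.clm_apply continuousOn_const)

theorem continuousOn_jacobian (hΩ : IsOpen Ω) (hF : ContDiffOn ℝ 1 F Ω) :
    ContinuousOn (jacobian F) Ω := by
  have h : ContinuousOn (fun u => firstFundamentalForm F u) Ω :=
    continuousOn_pi.2 fun i => continuousOn_pi.2 fun j => continuousOn_firstFundamentalForm hΩ hF i j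
  have h2 : jacobian F = fun u => √(firstFundamentalForm F u).det :=
    funext fun u => jacobian_eq_sqrt F u
  rw [h2]
  refine Real.continuous_sqrt.comp_continuousOn ?_
  exact (Continuous.matrix_det continuous_id).comp_continuousOn h

namespace IsLipschitzImmersion

theorem measurableEmbedding (h : IsLipschitzImmersion Ω F) :
    MeasurableEmbedding (Ω.domRestrict F) :=
  h.contDiffOn.continuousOn.measurableEmbedding h.isOpen.measurableSet h.injOn

/-- The pullback to the parameter domain of the `k`-dimensional measure. -/
def pullback {k n : ℕ} (Ω : Set (E k)) (F : E k → E n) : Measure (E k) :=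
  ((μHE[k] : Measure (E n)).comap (Ω.domRestrict F)).map Subtype.val

theorem pullback_apply (h : IsLipschitzImmersion Ω F) (s : Set (E k)) :
    pullback Ω F s = (μHE[k] : Measure (E n)) (F '' (s ∩ Ω)) := by
  rw [pullback, (MeasurableEmbedding.subtype_coe h.isOpen.measurableSet).map_apply,
    h.measurableEmbedding.comap_apply]
  congr 1
  ext y
  constructor
  · rintro ⟨⟨x, hx⟩, hxs, rfl⟩
    exact ⟨x, ⟨hxs, hx⟩, rfl⟩
  · rintro ⟨x, ⟨hxs, hx⟩, rfl⟩
    exact ⟨⟨x, hx⟩, hxs, rfl⟩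

theorem exists_measure_image_le (h : IsLipschitzImmersion Ω F) :
    ∃ C : ℝ≥0, ∀ s : Set (E k), s ⊆ Ω →
      (μHE[k] : Measure (E n)) (F '' s) ≤ C * volume s := by
  obtain ⟨C, hC⟩ := h.lipschitz
  refine ⟨C ^ k, fun s hs => ?_⟩
  have := (hC.mono hs).hausdorffMeasure_image_le (d := k) (by positivity)
  rw [ENNReal.rpow_natCast] at this
  rw [← EuclideanSpace.euclideanHausdorffMeasure_eq_volume]
  rw [Measure.euclideanHausdorffMeasure_def, Measure.euclideanHausdorffMeasure_def,
    Measure.smul_apply, Measure.smul_apply]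
  calc _ ≤ _ • ((C : ℝ≥0∞) ^ k * μH[k] s) := by gcongr
    _ = _ := by
      rw [ENNReal.smul_def, ENNReal.smul_def, smul_eq_mul, smul_eq_mul, mul_left_comm,
        ENNReal.coe_pow]

/-- The Lipschitz bound makes the pullback locally finite and absolutely continuous. By Besicovitch
differentiation its density is a limit of quotients over shrinking balls, and
`eq_jacobian_of_tendsto` identifies that limit. -/
theorem pullback_eq (h : IsLipschitzImmersion Ω F) :
    pullback Ω F = (volume.restrict Ω).withDensity fun u => ENNReal.ofReal (jacobian F u) := by
  obtain ⟨C, hC⟩ := h.exists_measure_image_le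
  have hle : ∀ s, pullback Ω F s ≤ C * volume s := fun s => by
    rw [h.pullback_apply]
    exact (hC _ inter_subset_right).trans (by gcongr; exact inter_subset_left)
  have hfin : IsLocallyFiniteMeasure (pullback Ω F) := by
    refine ⟨fun x => ?_⟩
    obtain ⟨s, hs, hfin⟩ := (volume : Measure (E k)).finiteAt_nhds x
    exact ⟨s, hs, (hle s).trans_lt (ENNReal.mul_lt_top ENNReal.coe_lt_top hfin)⟩
  have hac : pullback Ω F ≪ volume := fun s hs => by
    have := hle s
    rw [hs, mul_zero] at this
    exact le_zero_iff.1 this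
  have hΩm := h.isOpen.measurableSet
  have hJ : (pullback Ω F).rnDeriv volume =ᵐ[volume.restrict Ω]
      fun u => ENNReal.ofReal (jacobian F u) := by
    rw [Filter.EventuallyEq, ae_restrict_iff' hΩm]
    filter_upwards [Besicovitch.ae_tendsto_rnDeriv (pullback Ω F) volume] with u hu huΩ
    have hcd : ContDiffAt ℝ 1 F u := h.contDiffOn.contDiffAt (h.isOpen.mem_nhds huΩ)
    refine eq_jacobian_of_tendsto (hcd.hasStrictFDerivAt one_ne_zero) (h.injective_fderiv u huΩ) ?_
    refine hu.congr' ?_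
    obtain ⟨δ, hδ, hball⟩ := Metric.nhds_basis_closedBall.mem_iff.1 (h.isOpen.mem_nhds huΩ)
    filter_upwards [Ioc_mem_nhdsGT hδ] with r hr
    rw [h.pullback_apply, inter_eq_left.2 ((closedBall_subset_closedBall hr.2).trans hball)]
  have hres : pullback Ω F = (pullback Ω F).restrict Ω := by
    ext s hs
    rw [Measure.restrict_apply hs, h.pullback_apply, h.pullback_apply, inter_assoc, inter_self]
  rw [← withDensity_congr_ae hJ, hres, ← restrict_withDensity hΩm, ← hres,
    Measure.withDensity_rnDeriv_eq _ _ hac]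
  exact hres

theorem map_pullback (h : IsLipschitzImmersion Ω F) :
    ((μHE[k] : Measure (E n)).comap (Ω.domRestrict F)).map (Ω.domRestrict F) =
      (μHE[k] : Measure (E n)).restrict (F '' Ω) := by
  rw [h.measurableEmbedding.map_comap]
  congr 1
  ext y
  simp

/-- **Area formula**: integrals over the image of an injective immersion. -/
theorem integral_image (h : IsLipschitzImmersion Ω F) (g : E n → ℝ) :
    ∫ x in F '' Ω, g x ∂μHE[k] = ∫ u in Ω, jacobian F u * g (F u) := by
  rw [← h.map_pullback, h.measurableEmbedding.integral_map]
  have h1 : ∫ u : Ω, g (Ω.domRestrict F u) ∂((μHE[k] : Measure (E n)).comap (Ω.domRestrict F)) =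
      ∫ u, g (F u) ∂(pullback Ω F) := by
    rw [pullback, (MeasurableEmbedding.subtype_coe h.isOpen.measurableSet).integral_map]
    rfl
  rw [h1, h.pullback_eq]
  have hm : AEMeasurable (fun u => (jacobian F u).toNNReal) (volume.restrict Ω) :=
    ((continuousOn_jacobian h.isOpen h.contDiffOn).aemeasurable h.isOpen.measurableSet).real_toNNReal
  simp only [ENNReal.ofReal]
  rw [integral_withDensity_eq_integral_smul₀ hm]
  refine integral_congr_ae (Filter.Eventually.of_forall fun u => ?_)
  simp [NNReal.smul_def, jacobian_nonneg]

/-- The density of the pullback is positive, so its null sets are Lebesgue null. In the rigidity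
part this turns almost everywhere statements on the submanifold into statements in charts. -/
theorem ae_comp_of_ae (h : IsLipschitzImmersion Ω F) {P : E n → Prop}
    (hP : ∀ᵐ x ∂(μHE[k] : Measure (E n)).restrict (F '' Ω), P x) :
    ∀ᵐ u ∂(volume.restrict Ω), P (F u) := by
  rw [← h.map_pullback, h.measurableEmbedding.ae_map_iff] at hP
  have h1 : ∀ᵐ u ∂(pullback Ω F), P (F u) := by
    rw [pullback, (MeasurableEmbedding.subtype_coe h.isOpen.measurableSet).ae_map_iff]
    exact hP
  have hm : AEMeasurable (fun u => ENNReal.ofReal (jacobian F u)) (volume.restrict Ω) :=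
    ((continuousOn_jacobian h.isOpen h.contDiffOn).aemeasurable h.isOpen.measurableSet).ennreal_ofReal
  rw [h.pullback_eq, ae_withDensity_iff' hm] at h1
  filter_upwards [h1, ae_restrict_mem h.isOpen.measurableSet] with u hu huΩ
  exact hu (ENNReal.ofReal_pos.2 (jacobian_pos (h.injective_fderiv u huΩ))).ne'

end IsLipschitzImmersion

end AreaFormula

end MobiusMonotonicity

namespace MobiusMonotonicity

open Filter Metric

/-! ### Differential calculus in a local parametrization -/

section ChartCalculus

/-- Jacobi's formula: differentiating the Leibniz sum one column at a time gives determinants with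
one column replaced, which Cramer's rule expresses by the adjugate. -/
theorem hasFDerivAt_matrix_det {V : Type*} [NormedAddCommGroup V] [NormedSpace ℝ V] {k : ℕ}
    {A : V → Matrix (Fin k) (Fin k) ℝ} {A' : Fin k → Fin k → V →L[ℝ] ℝ} {u : V}
    (h : ∀ i j, HasFDerivAt (fun v => A v i j) (A' i j) u) :
    HasFDerivAt (fun v => (A v).det) (∑ i, ∑ j, (A u).adjugate i j • A' j i) u := by
  have h1 : HasFDerivAt (fun v => ∑ σ : Equiv.Perm (Fin k),
      ((Equiv.Perm.sign σ : ℤ) : ℝ) * ∏ i, A v (σ i) i)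
      (∑ σ : Equiv.Perm (Fin k), ((Equiv.Perm.sign σ : ℤ) : ℝ) •
        ∑ i, (∏ j ∈ Finset.univ.erase i, A u (σ j) j) • A' (σ i) i) u := by
    refine HasFDerivAt.fun_sum fun σ _ => ?_
    refine HasFDerivAt.const_mul ?_ _
    exact HasFDerivAt.finsetProd fun i _ => h (σ i) i
  have h2 : (fun v => (A v).det) = fun v => ∑ σ : Equiv.Perm (Fin k),
      ((Equiv.Perm.sign σ : ℤ) : ℝ) * ∏ i, A v (σ i) i := by
    funext v
    exact Matrix.det_apply' _
  rw [h2]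
  convert h1 using 1
  ext v
  simp only [_root_.sum_apply, _root_.smul_apply, smul_eq_mul]
  have h3 : ∀ i, ∑ j, (A u).adjugate i j * A' j i v =
      ((A u).updateCol i (fun j => A' j i v)).det := by
    intro i
    rw [← Matrix.cramer_apply, Matrix.cramer_eq_adjugate_mulVec]
    rfl
  simp_rw [h3, Finset.mul_sum]
  rw [Finset.sum_comm]
  refine Finset.sum_congr rfl fun i _ => ?_
  rw [Matrix.det_apply']
  refine Finset.sum_congr rfl fun σ _ => ?_
  congr 1
  rw [← Finset.mul_prod_erase _ _ (Finset.mem_univ i), Matrix.updateCol_self, mul_comm]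
  congr 1
  refine Finset.prod_congr rfl fun j hj => ?_
  rw [Matrix.updateCol_ne (Finset.ne_of_mem_erase hj)]

theorem contDiffOn_matrix_det {V : Type*} [NormedAddCommGroup V] [NormedSpace ℝ V] {k : ℕ}
    {A : V → Matrix (Fin k) (Fin k) ℝ} {s : Set V} {m : WithTop ℕ∞}
    (h : ∀ i j, ContDiffOn ℝ m (fun v => A v i j) s) :
    ContDiffOn ℝ m (fun v => (A v).det) s := by
  simp_rw [Matrix.det_apply']
  exact ContDiffOn.sum fun σ _ => contDiffOn_const.mul (contDiffOn_prod fun i _ => h _ _)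

theorem contDiffOn_matrix_inv {V : Type*} [NormedAddCommGroup V] [NormedSpace ℝ V] {k : ℕ}
    {A : V → Matrix (Fin k) (Fin k) ℝ} {s : Set V} {m : WithTop ℕ∞}
    (h : ∀ i j, ContDiffOn ℝ m (fun v => A v i j) s) (hdet : ∀ v ∈ s, (A v).det ≠ 0)
    (i j : Fin k) : ContDiffOn ℝ m (fun v => (A v)⁻¹ i j) s := by
  have h1 : ∀ v, (A v)⁻¹ i j = ((A v).det)⁻¹ * (A v).adjugate i j := by
    intro v
    rw [Matrix.inv_def, Ring.inverse_eq_inv', Matrix.smul_apply, smul_eq_mul]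
  simp_rw [h1]
  refine ((contDiffOn_matrix_det h).inv hdet).mul ?_
  simp_rw [Matrix.adjugate_apply]
  refine contDiffOn_matrix_det fun i' j' => ?_
  by_cases hi : i' = j
  · subst hi
    simp only [Matrix.updateRow_self]
    exact contDiffOn_const
  · simp only [Matrix.updateRow_ne hi]
    exact h _ _

variable {k n : ℕ}

/-- The coordinate velocity `∂_i F`. -/
def velocity (F : E k → E n) (i : Fin k) (u : E k) : E n :=
  fderiv ℝ F u (EuclideanSpace.single i 1)

/-- A smooth immersion of an open set. -/
structure IsSmoothImmersion (Ω : Set (E k)) (F : E k → E n) : Prop where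
  isOpen : IsOpen Ω
  contDiffOn : ContDiffOn ℝ (⊤ : ℕ∞) F Ω
  injective_fderiv : ∀ u ∈ Ω, Function.Injective (fderiv ℝ F u)

theorem IsLocalParam.isSmoothImmersion {M : Set (E n)} {Ω : Set (E k)} {F : E k → E n}
    (h : IsLocalParam k M Ω F) : IsSmoothImmersion Ω F :=
  ⟨h.isOpen, h.contDiffOn, h.injective_fderiv⟩

/-- The vector fields `∑ j, √g g^{ij} ∂_j F` whose coordinate divergence is `√g` times the
mean curvature. -/
def conormal (F : E k → E n) (i : Fin k) (u : E k) : E n :=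
  ∑ j, (jacobian F u * (firstFundamentalForm F u)⁻¹ i j) • velocity F j u

theorem firstFundamentalForm_apply (F : E k → E n) (u : E k) (i j : Fin k) :
    firstFundamentalForm F u i j = ⟪velocity F i u, velocity F j u⟫ := rfl

theorem firstFundamentalForm_comm (F : E k → E n) (u : E k) (i j : Fin k) :
    firstFundamentalForm F u i j = firstFundamentalForm F u j i := by
  rw [firstFundamentalForm_apply, firstFundamentalForm_apply, real_inner_comm]

theorem inv_firstFundamentalForm_comm (F : E k → E n) (u : E k) (i j : Fin k) :
    (firstFundamentalForm F u)⁻¹ i j = (firstFundamentalForm F u)⁻¹ j i := by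
  have h : (firstFundamentalForm F u).transpose = firstFundamentalForm F u := by
    ext i j
    exact firstFundamentalForm_comm F u j i
  conv_lhs => rw [← h, ← Matrix.transpose_nonsing_inv, Matrix.transpose_apply]

theorem fderiv_eq_sum_velocity (F : E k → E n) (u v : E k) :
    fderiv ℝ F u v = ∑ i, v i • velocity F i u := by
  have : v = ∑ i, v i • (EuclideanSpace.single i (1 : ℝ) : E k) := by
    simpa using ((EuclideanSpace.basisFun (Fin k) ℝ).sum_repr v).symm
  conv_lhs => rw [this, map_sum]
  simp [velocity]

theorem velocity_mem_range (F : E k → E n) (i : Fin k) (u : E k) :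
    velocity F i u ∈ (fderiv ℝ F u).range := ⟨_, rfl⟩

theorem mem_range_orthogonal_iff (F : E k → E n) (u : E k) (ν : E n) :
    ν ∈ ((fderiv ℝ F u).range)ᗮ ↔ ∀ i, ⟪velocity F i u, ν⟫ = 0 := by
  rw [Submodule.mem_orthogonal]
  constructor
  · exact fun h i => h _ (velocity_mem_range F i u)
  · rintro h _ ⟨v, rfl⟩
    change ⟪fderiv ℝ F u v, ν⟫ = 0
    rw [fderiv_eq_sum_velocity, sum_inner]
    exact Finset.sum_eq_zero fun i _ => by rw [real_inner_smul_left, h i, mul_zero]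

namespace IsSmoothImmersion

variable {Ω : Set (E k)} {F : E k → E n}

theorem det_pos (h : IsSmoothImmersion Ω F) {u : E k} (hu : u ∈ Ω) :
    0 < (firstFundamentalForm F u).det := by
  rw [← jacobian_sq]
  exact pow_pos (jacobian_pos (h.injective_fderiv u hu)) 2

theorem inv_mul (h : IsSmoothImmersion Ω F) {u : E k} (hu : u ∈ Ω) :
    (firstFundamentalForm F u)⁻¹ * firstFundamentalForm F u = 1 :=
  Matrix.nonsing_inv_mul _ (h.det_pos hu).ne'.isUnit

theorem sum_inv_mul (h : IsSmoothImmersion Ω F) {u : E k} (hu : u ∈ Ω) (i l : Fin k) :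
    ∑ j, (firstFundamentalForm F u)⁻¹ i j * ⟪velocity F j u, velocity F l u⟫ =
      if i = l then 1 else 0 := by
  have := congrFun (congrFun (h.inv_mul hu) i) l
  rwa [Matrix.mul_apply, Matrix.one_apply] at this

/-- The right side lies in the range, and pairing the remainder with each velocity gives zero
because `g⁻¹ g = 1`. The formula shows that tangential projection varies continuously along a
submanifold. -/
theorem starProjection_range (h : IsSmoothImmersion Ω F) {u : E k} (hu : u ∈ Ω) (v : E n) :
    ((fderiv ℝ F u).range).starProjection v =
      ∑ i, ∑ j, ((firstFundamentalForm F u)⁻¹ i j * ⟪velocity F j u, v⟫) • velocity F i u := by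
  refine Submodule.eq_starProjection_of_mem_of_inner_eq_zero ?_ ?_
  · exact Submodule.sum_mem _ fun i _ => Submodule.sum_mem _ fun j _ =>
      Submodule.smul_mem _ _ (velocity_mem_range F i u)
  · suffices hs : v - ∑ i, ∑ j, ((firstFundamentalForm F u)⁻¹ i j * ⟪velocity F j u, v⟫) •
        velocity F i u ∈ ((fderiv ℝ F u).range)ᗮ by
      intro w hw
      rw [real_inner_comm]
      exact (Submodule.mem_orthogonal _ _).1 hs w hw
    rw [mem_range_orthogonal_iff]
    intro l
    rw [inner_sub_right, inner_sum]
    simp_rw [inner_sum, real_inner_smul_right]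
    rw [Finset.sum_comm]
    have : ∀ j, ∑ i, (firstFundamentalForm F u)⁻¹ i j * ⟪velocity F j u, v⟫ *
        ⟪velocity F l u, velocity F i u⟫ = (if j = l then 1 else 0) * ⟪velocity F j u, v⟫ := by
      intro j
      rw [← h.sum_inv_mul hu j l, Finset.sum_mul]
      refine Finset.sum_congr rfl fun i _ => ?_
      rw [inv_firstFundamentalForm_comm, real_inner_comm (velocity F i u)]
      ring
    simp [this]

theorem contDiffOn_velocity (h : IsSmoothImmersion Ω F) (i : Fin k) :
    ContDiffOn ℝ (⊤ : ℕ∞) (velocity F i) Ω :=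
  (h.contDiffOn.fderiv_of_isOpen h.isOpen (by simp)).clm_apply contDiffOn_const

theorem contDiffOn_inv_firstFundamentalForm (h : IsSmoothImmersion Ω F) (i j : Fin k) :
    ContDiffOn ℝ (⊤ : ℕ∞) (fun u => (firstFundamentalForm F u)⁻¹ i j) Ω :=
  contDiffOn_matrix_inv (fun i j => (h.contDiffOn_velocity i).inner ℝ (h.contDiffOn_velocity j))
    (fun _ hu => (h.det_pos hu).ne') i j

theorem contDiffOn_jacobian (h : IsSmoothImmersion Ω F) :
    ContDiffOn ℝ (⊤ : ℕ∞) (jacobian F) Ω := by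
  have h2 : jacobian F = fun u => √(firstFundamentalForm F u).det :=
    funext fun u => jacobian_eq_sqrt F u
  rw [h2]
  exact (contDiffOn_matrix_det
    (fun i j => (h.contDiffOn_velocity i).inner ℝ (h.contDiffOn_velocity j))).sqrt
    (fun _ hu => (h.det_pos hu).ne')

theorem contDiffOn_conormal (h : IsSmoothImmersion Ω F) (i : Fin k) :
    ContDiffOn ℝ (⊤ : ℕ∞) (conormal F i) Ω := by
  unfold conormal
  exact ContDiffOn.sum fun j _ =>
    (h.contDiffOn_jacobian.mul (h.contDiffOn_inv_firstFundamentalForm i j)).smul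
      (h.contDiffOn_velocity j)

theorem hasFDerivAt_velocity (h : IsSmoothImmersion Ω F) {u : E k} (hu : u ∈ Ω) (i : Fin k) :
    HasFDerivAt (velocity F i) ((fderiv ℝ (fderiv ℝ F) u).flip (EuclideanSpace.single i 1)) u := by
  have h1 : DifferentiableAt ℝ (fderiv ℝ F) u := by
    have := (h.contDiffOn.fderiv_of_isOpen (m := 1) h.isOpen
      (show ((2 : ℕ∞) : WithTop ℕ∞) ≤ _ from WithTop.coe_le_coe.2 le_top)).contDiffAt
      (h.isOpen.mem_nhds hu)
    exact this.differentiableAt one_ne_zero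
  have := h1.hasFDerivAt.clm_apply (hasFDerivAt_const (EuclideanSpace.single i (1 : ℝ) : E k) u)
  refine HasFDerivAt.congr_fderiv this ?_
  ext v
  simp

theorem second_fderiv_symm (h : IsSmoothImmersion Ω F) {u : E k} (hu : u ∈ Ω) (v w : E k) :
    fderiv ℝ (fderiv ℝ F) u v w = fderiv ℝ (fderiv ℝ F) u w v := by
  have h1 : ContDiffAt ℝ (⊤ : ℕ∞) F u := h.contDiffOn.contDiffAt (h.isOpen.mem_nhds hu)
  have h2 : IsSymmSndFDerivAt ℝ F u := h1.isSymmSndFDerivAt (by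
    simp only [minSmoothness_of_isRCLikeNormedField]
    exact (show ((2 : ℕ∞) : WithTop ℕ∞) ≤ _ from WithTop.coe_le_coe.2 le_top))
  exact h2 v w

/-- Jacobi's formula applied to `√(det g)`. The product rule on `g_ij` yields two terms, equal after
summation by symmetry of `g⁻¹`; their factor `2` cancels that of the square root. -/
theorem fderiv_jacobian (h : IsSmoothImmersion Ω F) {u : E k} (hu : u ∈ Ω) (v : E k) :
    fderiv ℝ (jacobian F) u v = jacobian F u * ∑ i, ∑ j, (firstFundamentalForm F u)⁻¹ i j *
      ⟪fderiv ℝ (fderiv ℝ F) u v (EuclideanSpace.single i 1), velocity F j u⟫ := by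
  have hd := h.det_pos hu
  have hJ := jacobian_pos (h.injective_fderiv u hu)
  have h2 : jacobian F = fun u => √(firstFundamentalForm F u).det :=
    funext fun u => jacobian_eq_sqrt F u
  have h3 := (hasFDerivAt_matrix_det (A := firstFundamentalForm F) fun i j =>
    (h.hasFDerivAt_velocity hu i).inner ℝ (h.hasFDerivAt_velocity hu j)).sqrt hd.ne'
  rw [← h2, ← jacobian_eq_sqrt] at h3
  rw [h3.fderiv]
  have hadj : ∀ i j, (firstFundamentalForm F u).adjugate i j =
      jacobian F u ^ 2 * (firstFundamentalForm F u)⁻¹ i j := by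
    intro i j
    rw [jacobian_sq, Matrix.inv_def, Ring.inverse_eq_inv', Matrix.smul_apply, smul_eq_mul,
      mul_inv_cancel_left₀ hd.ne']
  simp only [_root_.smul_apply, _root_.sum_apply, smul_eq_mul, hadj]
  have key : ∑ i, ∑ j, (firstFundamentalForm F u)⁻¹ i j *
      (⟪velocity F j u, fderiv ℝ (fderiv ℝ F) u v (EuclideanSpace.single i 1)⟫ +
        ⟪fderiv ℝ (fderiv ℝ F) u v (EuclideanSpace.single j 1), velocity F i u⟫) =
      2 * ∑ i, ∑ j, (firstFundamentalForm F u)⁻¹ i j *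
        ⟪fderiv ℝ (fderiv ℝ F) u v (EuclideanSpace.single i 1), velocity F j u⟫ := by
    simp_rw [mul_add, Finset.sum_add_distrib]
    rw [two_mul]
    congr 1
    · simp_rw [real_inner_comm]
    · rw [Finset.sum_comm]
      exact Finset.sum_congr rfl fun i _ => Finset.sum_congr rfl fun j _ => by
        rw [inv_firstFundamentalForm_comm F u j i]
  have h4 : ∀ i j, jacobian F u ^ 2 * (firstFundamentalForm F u)⁻¹ i j *
      ((fderivInnerCLM ℝ (velocity F j u, velocity F i u)).comp
        (((fderiv ℝ (fderiv ℝ F) u).flip (EuclideanSpace.single j 1)).prod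
          ((fderiv ℝ (fderiv ℝ F) u).flip (EuclideanSpace.single i 1)))) v =
      jacobian F u ^ 2 * ((firstFundamentalForm F u)⁻¹ i j *
      (⟪velocity F j u, fderiv ℝ (fderiv ℝ F) u v (EuclideanSpace.single i 1)⟫ +
        ⟪fderiv ℝ (fderiv ℝ F) u v (EuclideanSpace.single j 1), velocity F i u⟫)) := by
    intro i j
    simp [fderivInnerCLM_apply, mul_assoc]
  refine (congrArg (fun z => 1 / (2 * jacobian F u) * z) (Finset.sum_congr rfl fun i _ =>
    Finset.sum_congr rfl fun j _ => h4 i j)).trans ?_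
  simp_rw [← Finset.mul_sum, key]
  field_simp

/-- The `conormal` fields are `√g` times the basis of the tangent space dual to the velocities. -/
theorem inner_conormal_velocity (h : IsSmoothImmersion Ω F) {u : E k} (hu : u ∈ Ω) (i l : Fin k) :
    ⟪conormal F i u, velocity F l u⟫ = if i = l then jacobian F u else 0 := by
  rw [conormal, sum_inner]
  simp_rw [real_inner_smul_left, mul_assoc]
  rw [← Finset.mul_sum, h.sum_inv_mul hu]
  simp

theorem hasFDerivAt_conormal (h : IsSmoothImmersion Ω F) {u : E k} (hu : u ∈ Ω) (i : Fin k) :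
    HasFDerivAt (conormal F i) (fderiv ℝ (conormal F i) u) u :=
  (((h.contDiffOn_conormal i).contDiffAt (h.isOpen.mem_nhds hu)).differentiableAt
    (by simp)).hasFDerivAt

/-- The coordinate expression of `Δ F = H`, in the minimal case. -/
theorem sum_fderiv_conormal_eq_zero (h : IsSmoothImmersion Ω F) {u : E k} (hu : u ∈ Ω)
    (hH : meanCurvature F u = 0) :
    ∑ i, fderiv ℝ (conormal F i) u (EuclideanSpace.single i 1) = 0 := by
  set W := ∑ i, fderiv ℝ (conormal F i) u (EuclideanSpace.single i 1) with hW
  -- Differentiating `inner_conormal_velocity` and summing gives `∂_l √g - ∑ ⟪conormal_i, ∂_i ∂_l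
  -- F⟫`, which is zero by `fderiv_jacobian` and the symmetry of second derivatives.
  have htan : ∀ l, ⟪W, velocity F l u⟫ = 0 := by
    intro l
    have h1 : ∀ i, ⟪fderiv ℝ (conormal F i) u (EuclideanSpace.single i 1), velocity F l u⟫ =
        (if i = l then fderiv ℝ (jacobian F) u (EuclideanSpace.single i 1) else 0) -
        ⟪conormal F i u, fderiv ℝ (fderiv ℝ F) u (EuclideanSpace.single i 1)
          (EuclideanSpace.single l 1)⟫ := by
      intro i
      have ha := (h.hasFDerivAt_conormal hu i).inner ℝ (h.hasFDerivAt_velocity hu l)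
      have hb : HasFDerivAt (fun v => if i = l then jacobian F v else 0)
          (if i = l then fderiv ℝ (jacobian F) u else 0) u := by
        split_ifs
        · exact ((h.contDiffOn_jacobian.contDiffAt (h.isOpen.mem_nhds hu)).differentiableAt
            (by simp)).hasFDerivAt
        · exact hasFDerivAt_const _ _
      have hc : (fun v => ⟪conormal F i v, velocity F l v⟫) =ᶠ[𝓝 u]
          fun v => if i = l then jacobian F v else 0 := by
        filter_upwards [h.isOpen.mem_nhds hu] with v hv using h.inner_conormal_velocity hv i l
      have hd := ha.unique (hb.congr_of_eventuallyEq hc)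
      have he := congrArg (fun L : E k →L[ℝ] ℝ => L (EuclideanSpace.single i 1)) hd
      simp only [ContinuousLinearMap.comp_apply, ContinuousLinearMap.prod_apply,
        fderivInnerCLM_apply, ContinuousLinearMap.flip_apply] at he
      have hf : (if i = l then fderiv ℝ (jacobian F) u else 0) (EuclideanSpace.single i 1) =
          if i = l then fderiv ℝ (jacobian F) u (EuclideanSpace.single i 1) else 0 := by
        split_ifs <;> simp
      rw [hf] at he
      linarith
    rw [hW, sum_inner]
    simp_rw [h1]
    rw [Finset.sum_sub_distrib, Finset.sum_ite_eq' Finset.univ l]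
    simp only [Finset.mem_univ, if_true]
    rw [h.fderiv_jacobian hu, sub_eq_zero]
    have h2 : ∀ i, ⟪conormal F i u, fderiv ℝ (fderiv ℝ F) u (EuclideanSpace.single i 1)
          (EuclideanSpace.single l 1)⟫ = jacobian F u * ∑ j, (firstFundamentalForm F u)⁻¹ i j *
        ⟪fderiv ℝ (fderiv ℝ F) u (EuclideanSpace.single l 1) (EuclideanSpace.single i 1),
          velocity F j u⟫ := by
      intro i
      rw [conormal, sum_inner, Finset.mul_sum]
      refine Finset.sum_congr rfl fun j _ => ?_
      rw [real_inner_smul_left, h.second_fderiv_symm hu, real_inner_comm, mul_assoc]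
    simp_rw [h2, ← Finset.mul_sum]
  have hWmem : W ∈ ((fderiv ℝ F u).range)ᗮ := by
    rw [mem_range_orthogonal_iff]
    intro i
    rw [real_inner_comm]
    exact htan i
  -- Against a normal vector the derivatives of the coefficients drop out, since they multiply
  -- tangential velocities; what remains is `√g ⟪H, ν⟫`.
  have hnor : ∀ ν ∈ ((fderiv ℝ F u).range)ᗮ, ⟪W, ν⟫ = 0 := by
    intro ν hν
    have hν' := (mem_range_orthogonal_iff F u ν).1 hν
    have h1 : ∀ i, ⟪fderiv ℝ (conormal F i) u (EuclideanSpace.single i 1), ν⟫ =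
        jacobian F u * ∑ j, (firstFundamentalForm F u)⁻¹ i j *
          ⟪fderiv ℝ (fderiv ℝ F) u (EuclideanSpace.single i 1) (EuclideanSpace.single j 1), ν⟫ := by
      intro i
      have hda : ∀ j, DifferentiableAt ℝ
          (fun v => jacobian F v * (firstFundamentalForm F v)⁻¹ i j) u := fun j =>
        ((h.contDiffOn_jacobian.mul (h.contDiffOn_inv_firstFundamentalForm i j)).contDiffAt
          (h.isOpen.mem_nhds hu)).differentiableAt (by simp)
      have hb : HasFDerivAt (conormal F i) _ u := HasFDerivAt.fun_sum fun j _ =>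
        (hda j).hasFDerivAt.smul (h.hasFDerivAt_velocity hu j)
      rw [hb.fderiv, _root_.sum_apply, sum_inner, Finset.mul_sum]
      refine Finset.sum_congr rfl fun j _ => ?_
      simp [inner_add_left, real_inner_smul_left, hν' j, mul_assoc]
    have h2 : ⟪meanCurvature F u, ν⟫ = ∑ i, ∑ j, (firstFundamentalForm F u)⁻¹ i j *
          ⟪fderiv ℝ (fderiv ℝ F) u (EuclideanSpace.single i 1) (EuclideanSpace.single j 1), ν⟫ := by
      rw [meanCurvature, sum_inner]
      refine Finset.sum_congr rfl fun i _ => ?_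
      rw [sum_inner]
      refine Finset.sum_congr rfl fun j _ => ?_
      rw [real_inner_smul_left, secondFundamentalForm,
        Submodule.inner_starProjection_left_eq_right, Submodule.starProjection_eq_self_iff.2 hν]
    rw [hW, sum_inner]
    simp_rw [h1]
    rw [← Finset.mul_sum, ← h2, hH, inner_zero_left, mul_zero]
  -- `W` is normal by `htan`, so it may be tested against itself.
  exact inner_self_eq_zero.1 (hnor W hWmem)

end IsSmoothImmersion

theorem integral_fderiv_eq_zero {q : E k → ℝ} (hq : ContDiff ℝ 1 q) (hs : HasCompactSupport q)
    (v : E k) : ∫ u, fderiv ℝ q u v = 0 := by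
  have hc : Continuous fun u => fderiv ℝ q u v := (hq.continuous_fderiv one_ne_zero).clm_apply
    continuous_const
  have hcs : HasCompactSupport fun u => fderiv ℝ q u v := hs.fderiv_apply ℝ v
  have := integral_mul_fderiv_eq_neg_fderiv_mul_of_integrable (μ := (volume : Measure (E k)))
    (f := fun _ : E k => (1 : ℝ)) (g := q) (v := v) (by simp)
    (by simpa using hc.integrable_of_hasCompactSupport hcs)
    (by simpa using hq.continuous.integrable_of_hasCompactSupport hs)
    (fun x _ => differentiableAt_const _) (fun x _ => hq.differentiable one_ne_zero x)
  simpa using this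

/-- The first variation formula of a minimal immersion, for a vector field along it. -/
theorem IsSmoothImmersion.integral_sum_inner_conormal {Ω : Set (E k)} {F : E k → E n}
    (h : IsSmoothImmersion Ω F) (hH : ∀ u ∈ Ω, meanCurvature F u = 0) {Y : E k → E n}
    (hY : ContDiffOn ℝ 1 Y Ω) (hc : HasCompactSupport Y) (hsub : tsupport Y ⊆ Ω) :
    ∫ u, ∑ i, ⟪fderiv ℝ Y u (EuclideanSpace.single i 1), conormal F i u⟫ = 0 := by
  set q : Fin k → E k → ℝ := fun i u => ⟪Y u, conormal F i u⟫ with hq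
  -- This makes the values of `conormal` off `Ω`, where nothing is known about them, irrelevant.
  have hzero : ∀ u, u ∉ Ω → Y =ᶠ[𝓝 u] 0 := fun u hu =>
    notMem_tsupport_iff_eventuallyEq.1 fun h' => hu (hsub h')
  have hqc : ∀ i, ContDiff ℝ 1 (q i) := by
    intro i
    rw [contDiff_iff_contDiffAt]
    intro u
    by_cases hu : u ∈ Ω
    · exact (hY.contDiffAt (h.isOpen.mem_nhds hu)).inner ℝ
        (((h.contDiffOn_conormal i).contDiffAt (h.isOpen.mem_nhds hu)).of_le
          (by exact_mod_cast le_top))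
    · refine (contDiffAt_const (c := (0 : ℝ))).congr_of_eventuallyEq ?_
      filter_upwards [hzero u hu] with v hv
      simp [hq, hv]
  have hqs : ∀ i, HasCompactSupport (q i) := fun i => hc.mono fun u hu hY0 => hu (by simp [hq, hY0])
  -- The other half of the product rule is `⟪Y, ∑ ∂_i conormal_i⟫`, zero by minimality. The sum is
  -- thus a coordinate divergence of compactly supported functions.
  have hpt : ∀ u, ∑ i, ⟪fderiv ℝ Y u (EuclideanSpace.single i 1), conormal F i u⟫ =
      ∑ i, fderiv ℝ (q i) u (EuclideanSpace.single i 1) := by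
    intro u
    by_cases hu : u ∈ Ω
    · have hYd := ((hY.contDiffAt (h.isOpen.mem_nhds hu)).differentiableAt one_ne_zero).hasFDerivAt
      have h1 : ∀ i, fderiv ℝ (q i) u (EuclideanSpace.single i 1) =
          ⟪Y u, fderiv ℝ (conormal F i) u (EuclideanSpace.single i 1)⟫ +
          ⟪fderiv ℝ Y u (EuclideanSpace.single i 1), conormal F i u⟫ := by
        intro i
        rw [(hYd.inner ℝ (h.hasFDerivAt_conormal hu i)).fderiv]
        simp [fderivInnerCLM_apply]
      simp_rw [h1]
      rw [Finset.sum_add_distrib, ← inner_sum, h.sum_fderiv_conormal_eq_zero hu (hH u hu)]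
      simp
    · have h0 := hzero u hu
      have h1 : ∀ i, q i =ᶠ[𝓝 u] 0 := fun i => by
        filter_upwards [h0] with v hv
        simp [hq, hv]
      refine Finset.sum_congr rfl fun i _ => ?_
      simp [h0.fderiv_eq, (h1 i).fderiv_eq]
  simp_rw [hpt]
  rw [integral_finsetSum]
  · exact Finset.sum_eq_zero fun i _ => integral_fderiv_eq_zero (hqc i) (hqs i) _
  · intro i _
    exact ((hqc i).continuous_fderiv one_ne_zero |>.clm_apply continuous_const)
      |>.integrable_of_hasCompactSupport ((hqs i).fderiv_apply ℝ _)

end ChartCalculus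

end MobiusMonotonicity

namespace MobiusMonotonicity

open Filter Metric
open scoped ENNReal NNReal Manifold ContDiff

/-! ### Tangent spaces and the divergence theorem on minimal submanifolds -/

section Submanifold

variable {k n : ℕ} {M : Set (E n)}

namespace IsLocalParam

variable {Ω : Set (E k)} {F : E k → E n}

theorem injOn (h : IsLocalParam k M Ω F) : InjOn F Ω :=
  injOn_iff_injective.2 h.isEmbedding.injective

theorem image_subset (h : IsLocalParam k M Ω F) : F '' Ω ⊆ M := by
  obtain ⟨W, -, hW⟩ := h.image_eq
  exact hW ▸ inter_subset_left

theorem mem (h : IsLocalParam k M Ω F) {u : E k} (hu : u ∈ Ω) : F u ∈ M :=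
  h.image_subset ⟨u, hu, rfl⟩

theorem image_mem_nhdsWithin (h : IsLocalParam k M Ω F) {u : E k} (hu : u ∈ Ω) :
    F '' Ω ∈ 𝓝[M] (F u) := by
  obtain ⟨W, hWo, hW⟩ := h.image_eq
  have hmem : F u ∈ M ∩ W := hW ▸ ⟨u, hu, rfl⟩
  rw [hW]
  exact inter_mem self_mem_nhdsWithin (mem_nhdsWithin_of_mem_nhds (hWo.mem_nhds hmem.2))

theorem mono (h : IsLocalParam k M Ω F) {Ω' : Set (E k)} (ho : IsOpen Ω') (hsub : Ω' ⊆ Ω) :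
    IsLocalParam k M Ω' F where
  isOpen := ho
  contDiffOn := h.contDiffOn.mono hsub
  injective_fderiv u hu := h.injective_fderiv u (hsub hu)
  isEmbedding := h.isEmbedding.comp (IsEmbedding.inclusion hsub)
  image_eq := by
    obtain ⟨W, hWo, hW⟩ := h.image_eq
    obtain ⟨W', hW'o, hW'⟩ := h.isEmbedding.isInducing.isOpen_iff.1
      (ho.preimage (continuous_subtype_val (p := (· ∈ Ω))))
    refine ⟨W ∩ W', hWo.inter hW'o, ?_⟩
    rw [← inter_assoc, ← hW]
    ext y
    constructor
    · rintro ⟨u, hu, rfl⟩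
      have : (⟨u, hsub hu⟩ : Ω) ∈ Ω.domRestrict F ⁻¹' W' := by rw [hW']; exact hu
      exact ⟨⟨u, hsub hu, rfl⟩, this⟩
    · rintro ⟨⟨u, hu, rfl⟩, hy⟩
      have : (⟨u, hu⟩ : Ω) ∈ Ω.domRestrict F ⁻¹' W' := hy
      rw [hW'] at this
      exact ⟨u, this, rfl⟩

theorem tendsto_of_comp (h : IsLocalParam k M Ω F) {α : Type*} {l : Filter α} {c : α → E k}
    {u : E k} (hu : u ∈ Ω) (hc : ∀ᶠ t in l, c t ∈ Ω) (ht : Tendsto (fun t => F (c t)) l (𝓝 (F u))) :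
    Tendsto c l (𝓝 u) := by
  classical
  -- The embedding property concerns the restriction to the subtype `Ω`, so `c` is replaced by a map
  -- into it; the default `u` is only used where `c t ∉ Ω`.
  let c' : α → Ω := fun t => if ht : c t ∈ Ω then ⟨c t, ht⟩ else ⟨u, hu⟩
  have hcc : ∀ᶠ t in l, (c' t : E k) = c t := by
    filter_upwards [hc] with t ht
    simp [c', ht]
  have h1 : Tendsto c' l (𝓝 ⟨u, hu⟩) := by
    rw [h.isEmbedding.isInducing.tendsto_nhds_iff]
    refine ht.congr' ?_
    filter_upwards [hcc] with t ht
    simp [Set.domRestrict, ht]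
  exact ((continuous_subtype_val.tendsto _).comp h1).congr' hcc

theorem tendsto_invFunOn (h : IsLocalParam k M Ω F) {u : E k} (hu : u ∈ Ω) :
    Tendsto (Function.invFunOn F Ω) (𝓝[M] (F u)) (𝓝 u) := by
  have hev : ∀ᶠ x in 𝓝[M] (F u), x ∈ F '' Ω := h.image_mem_nhdsWithin hu
  refine h.tendsto_of_comp hu (hev.mono fun x hx => Function.invFunOn_mem hx) ?_
  refine (tendsto_id.mono_left nhdsWithin_le_nhds).congr' ?_
  filter_upwards [hev] with x hx using (Function.invFunOn_eq hx).symm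

theorem continuousWithinAt_of_comp (h : IsLocalParam k M Ω F) {X : Type*} [TopologicalSpace X]
    {g : E n → X} {u : E k} (hu : u ∈ Ω) (hg : ContinuousWithinAt (fun v => g (F v)) Ω u) :
    ContinuousWithinAt g M (F u) := by
  have hev : ∀ᶠ x in 𝓝[M] (F u), x ∈ F '' Ω := h.image_mem_nhdsWithin hu
  have h1 : Tendsto (Function.invFunOn F Ω) (𝓝[M] (F u)) (𝓝[Ω] u) :=
    tendsto_nhdsWithin_iff.2 ⟨h.tendsto_invFunOn hu, hev.mono fun x hx => Function.invFunOn_mem hx⟩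
  refine (Tendsto.comp hg h1).congr' ?_
  filter_upwards [hev] with x hx
  simp [Function.invFunOn_eq hx]

theorem hasFDerivAt (h : IsLocalParam k M Ω F) {u : E k} (hu : u ∈ Ω) :
    HasFDerivAt F (fderiv ℝ F u) u :=
  ((h.contDiffOn.contDiffAt (h.isOpen.mem_nhds hu)).differentiableAt (by simp)).hasFDerivAt

theorem hasStrictFDerivAt (h : IsLocalParam k M Ω F) {u : E k} (hu : u ∈ Ω) :
    HasStrictFDerivAt F (fderiv ℝ F u) u :=
  (h.contDiffOn.contDiffAt (h.isOpen.mem_nhds hu)).hasStrictFDerivAt (by simp)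

/-- Bounds the displacement of a parameter by that of its image, so that curves in `M` can be lifted
to a chart with linear control although the lift is not known to be differentiable. -/
theorem isBigO_sub (h : IsLocalParam k M Ω F) {u : E k} (hu : u ∈ Ω) :
    (fun v => v - u) =O[𝓝 u] fun v => F v - F u := by
  obtain ⟨K, hK, hanti⟩ := (LinearMap.injective_iff_antilipschitz
    (fderiv ℝ F u : E k →ₗ[ℝ] E n)).1 (h.injective_fderiv u hu)
  have hev := exists_dist_le_of_hasStrictFDerivAt (h.hasStrictFDerivAt hu)
    (h.injective_fderiv u hu) one_pos
  obtain ⟨r, hr, hr0⟩ := (hev.and self_mem_nhdsWithin).exists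
  refine Asymptotics.IsBigO.of_bound (K * (1 + 1)) ?_
  filter_upwards [closedBall_mem_nhds u hr0] with v hv
  rw [← dist_eq_norm, ← dist_eq_norm, mul_assoc]
  refine (hanti.le_mul_dist v u).trans ?_
  gcongr
  exact (hr v hv u (mem_closedBall_self hr0.le)).2

/-- The lifted curve satisfies `c t - u = O(t)`, hence `γ t - γ 0` is within `o(t)` of the range of
`fderiv ℝ F u`, and projecting to the normal space shows that `v` has no normal part. The one-sided
form serves radial segments issuing from `p`, which lie in `M` only for `t > 0`. -/
theorem mem_range_of_hasDerivWithinAt (h : IsLocalParam k M Ω F) {u : E k} (hu : u ∈ Ω)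
    {γ : ℝ → E n} {v : E n} (h0 : γ 0 = F u) (hγ : ∀ᶠ t in 𝓝[>] (0 : ℝ), γ t ∈ M)
    (hd : HasDerivWithinAt γ v (Ioi 0) 0) : v ∈ (fderiv ℝ F u).range := by
  set Q := ((fderiv ℝ F u).range)ᗮ.starProjection
  have hQL : ∀ w, Q (fderiv ℝ F u w) = 0 := fun w =>
    (Submodule.starProjection_apply_eq_zero_iff _).2
      (Submodule.le_orthogonal_orthogonal _ ⟨w, rfl⟩)
  have htend : Tendsto γ (𝓝[>] 0) (𝓝[M] (F u)) :=
    tendsto_nhdsWithin_iff.2 ⟨h0 ▸ hd.continuousWithinAt, hγ⟩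
  set c := fun t => Function.invFunOn F Ω (γ t) with hcdef
  have hc : Tendsto c (𝓝[>] 0) (𝓝 u) := (h.tendsto_invFunOn hu).comp htend
  have hFc : ∀ᶠ t in 𝓝[>] (0 : ℝ), F (c t) = γ t := by
    filter_upwards [htend (h.image_mem_nhdsWithin hu)] with t ht using Function.invFunOn_eq ht
  have h1 : (fun t => γ t - γ 0 - fderiv ℝ F u (c t - u)) =o[𝓝[>] 0] fun t => t - 0 := by
    have ha := ((h.hasFDerivAt hu).isLittleO.comp_tendsto hc)
    have hb := ((h.isBigO_sub hu).comp_tendsto hc)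
    have hcO : (fun t => γ t - γ 0) =O[𝓝[>] 0] fun t => t - (0 : ℝ) :=
      hd.hasFDerivWithinAt.isBigO_sub
    have hb' : ((fun v => v - u) ∘ c) =O[𝓝[>] 0] fun t => t - (0 : ℝ) := by
      refine hb.trans (hcO.congr' ?_ EventuallyEq.rfl)
      filter_upwards [hFc] with t ht
      simp [ht, h0]
    refine (ha.trans_isBigO hb').congr' ?_ EventuallyEq.rfl
    filter_upwards [hFc] with t ht
    simp [ht, h0]
  have h2 : HasDerivWithinAt (fun t => Q (γ t)) 0 (Ioi 0) 0 := by
    rw [hasDerivWithinAt_iff_isLittleO]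
    have := (Q.isBigO_comp (fun t => γ t - γ 0 - fderiv ℝ F u (c t - u)) (𝓝[>] 0)).trans_isLittleO h1
    refine this.congr_left fun t => ?_
    rw [map_sub, hQL, sub_zero, map_sub, smul_zero, sub_zero]
  have h3 : HasDerivWithinAt (fun t => Q (γ t)) (Q v) (Ioi 0) 0 :=
    Q.hasFDerivAt.comp_hasDerivWithinAt 0 hd
  have h4 : Q v = 0 := (uniqueDiffWithinAt_Ioi 0).eq_deriv _ h3 h2
  have := (Submodule.starProjection_apply_eq_zero_iff _).1 h4
  rwa [Submodule.orthogonal_orthogonal] at this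

theorem tangentSpace_eq (h : IsLocalParam k M Ω F) {u : E k} (hu : u ∈ Ω) :
    tangentSpace M (F u) = (fderiv ℝ F u).range := by
  apply le_antisymm
  · refine Submodule.span_le.2 ?_
    rintro v ⟨γ, h0, hγ, hd⟩
    exact h.mem_range_of_hasDerivWithinAt hu h0 (hγ.filter_mono nhdsWithin_le_nhds)
      hd.hasDerivWithinAt
  · rintro _ ⟨v, rfl⟩
    refine Submodule.subset_span ⟨fun t => F (u + t • v), by simp, ?_, ?_⟩
    · have : Tendsto (fun t : ℝ => u + t • v) (𝓝 0) (𝓝 u) := by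
        have : Continuous fun t : ℝ => u + t • v := by fun_prop
        simpa using this.tendsto 0
      filter_upwards [this (h.isOpen.mem_nhds hu)] with t ht using h.mem ht
    · have h1 : HasDerivAt (fun t : ℝ => u + t • v) v 0 := by
        simpa using ((hasDerivAt_id (0 : ℝ)).smul_const v).const_add u
      have h2 : HasFDerivAt F (fderiv ℝ F u) (u + (0 : ℝ) • v) := by simpa using h.hasFDerivAt hu
      exact h2.comp_hasDerivAt 0 h1

theorem tanPart_eq (h : IsLocalParam k M Ω F) {u : E k} (hu : u ∈ Ω) (v : E n) :
    tanPart M (F u) v =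
      ∑ i, ∑ j, ((firstFundamentalForm F u)⁻¹ i j * ⟪velocity F j u, v⟫) • velocity F i u := by
  rw [← h.isSmoothImmersion.starProjection_range hu, tanPart]
  congr 2
  exact h.tangentSpace_eq hu

theorem isLipschitzImmersion (h : IsLocalParam k M Ω F) (hL : ∃ C : ℝ≥0, LipschitzOnWith C F Ω) :
    IsLipschitzImmersion Ω F :=
  ⟨h.isOpen, h.contDiffOn.of_le (by exact_mod_cast le_top), h.injective_fderiv, h.injOn, hL⟩

end IsLocalParam

theorem IsSubmanifold.exists_lipschitz_param (hM : IsSubmanifold k M) {x : E n} (hx : x ∈ M) :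
    ∃ (Ω : Set (E k)) (F : E k → E n), IsLocalParam k M Ω F ∧ IsLipschitzImmersion Ω F ∧
      x ∈ F '' Ω := by
  obtain ⟨Ω, F, h, u, hu, rfl⟩ := hM x hx
  have h1 : ContDiffAt ℝ 1 F u :=
    (h.contDiffOn.contDiffAt (h.isOpen.mem_nhds hu)).of_le (by exact_mod_cast le_top)
  obtain ⟨C, t, ht, hC⟩ := h1.exists_lipschitzOnWith
  obtain ⟨s, hs, hso, hus⟩ := _root_.mem_nhds_iff.1 (inter_mem ht (h.isOpen.mem_nhds hu))
  have h' := h.mono hso fun x hx => (hs hx).2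
  exact ⟨s, F, h', h'.isLipschitzImmersion ⟨C, hC.mono fun x hx => (hs hx).1⟩, u, hus, rfl⟩

theorem IsSubmanifold.continuousOn_tanPart (hM : IsSubmanifold k M) {V : E n → E n}
    (hV : ContinuousOn V M) : ContinuousOn (fun x => tanPart M x (V x)) M := by
  intro x hx
  obtain ⟨Ω, F, h, u, hu, rfl⟩ := hM x hx
  refine h.continuousWithinAt_of_comp hu ?_
  have hs := h.isSmoothImmersion
  have hVF : ContinuousOn (fun v => V (F v)) Ω :=
    hV.comp h.contDiffOn.continuousOn fun v hv => h.mem hv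
  have h1 : ContinuousOn (fun v => ∑ i, ∑ j, ((firstFundamentalForm F v)⁻¹ i j *
      ⟪velocity F j v, V (F v)⟫) • velocity F i v) Ω := by
    refine continuousOn_finsetSum _ fun i _ => continuousOn_finsetSum _ fun j _ => ?_
    exact ((hs.contDiffOn_inv_firstFundamentalForm i j).continuousOn.mul
      ((hs.contDiffOn_velocity j).continuousOn.inner (𝕜 := ℝ) hVF)).smul
      (hs.contDiffOn_velocity i).continuousOn
  exact (h1.congr fun v hv => h.tanPart_eq hv _) u hu

theorem IsSubmanifold.measure_lt_top (hM : IsSubmanifold k M) {K : Set (E n)} (hK : IsCompact K)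
    (hKM : K ⊆ M) : (μHE[k] : Measure (E n)) K < ⊤ := by
  refine hK.measure_lt_top_of_nhdsWithin fun x hx => ?_
  obtain ⟨Ω, F, h, hL, u, hu, rfl⟩ := hM.exists_lipschitz_param (hKM hx)
  obtain ⟨C, hC⟩ := hL.exists_measure_image_le
  obtain ⟨s, hs, hfin⟩ := (volume : Measure (E k)).finiteAt_nhds u
  obtain ⟨t, ht, hto, hut⟩ := _root_.mem_nhds_iff.1 (inter_mem hs (h.isOpen.mem_nhds hu))
  have h' := h.mono hto fun x hx => (ht hx).2
  refine ⟨F '' t, nhdsWithin_mono _ hKM (h'.image_mem_nhdsWithin hut), ?_⟩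
  refine (hC t fun x hx => (ht hx).2).trans_lt (ENNReal.mul_lt_top ENNReal.coe_lt_top ?_)
  exact (measure_mono fun x hx => (ht hx).1).trans_lt hfin

theorem IsSubmanifold.integrableOn_compact (hM : IsSubmanifold k M) {K : Set (E n)}
    (hK : IsCompact K) (hKM : K ⊆ M) {g : E n → ℝ} (hg : ContinuousOn g K) :
    IntegrableOn g K μHE[k] := by
  obtain ⟨C, hC⟩ := hK.exists_bound_of_continuousOn hg
  have : IsFiniteMeasure ((μHE[k] : Measure (E n)).restrict K) :=
    ⟨by simpa using hM.measure_lt_top hK hKM⟩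
  exact Integrable.of_bound (hg.aestronglyMeasurable hK.measurableSet) C
    ((ae_restrict_iff' hK.measurableSet).2 (Eventually.of_forall hC))

/-- The divergence along the subspace `T` of a vector field with derivative `D`. -/
def tangentialDiv (T : Submodule ℝ (E n)) (D : E n →L[ℝ] E n) : ℝ :=
  ∑ a, ⟪D (T.starProjection (EuclideanSpace.single a 1)), (EuclideanSpace.single a 1 : E n)⟫

theorem sum_inner_single (x y : E n) :
    ∑ a, ⟪x, (EuclideanSpace.single a (1 : ℝ) : E n)⟫ * ⟪(EuclideanSpace.single a (1 : ℝ) : E n), y⟫ =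
      ⟪x, y⟫ := by
  simpa using (EuclideanSpace.basisFun (Fin n) ℝ).sum_inner_mul_inner x y

theorem IsLocalParam.tangentialDiv_eq {Ω : Set (E k)} {F : E k → E n} (h : IsLocalParam k M Ω F)
    {u : E k} (hu : u ∈ Ω) (D : E n →L[ℝ] E n) :
    tangentialDiv (tangentSpace M (F u)) D =
      ∑ i, ∑ j, (firstFundamentalForm F u)⁻¹ i j * ⟪D (velocity F i u), velocity F j u⟫ := by
  have h1 : ∀ a, ⟪D ((tangentSpace M (F u)).starProjection (EuclideanSpace.single a 1)),
      (EuclideanSpace.single a 1 : E n)⟫ = ∑ i, ∑ j, (firstFundamentalForm F u)⁻¹ i j *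
        (⟪D (velocity F i u), (EuclideanSpace.single a (1 : ℝ) : E n)⟫ *
          ⟪(EuclideanSpace.single a (1 : ℝ) : E n), velocity F j u⟫) := by
    intro a
    have := h.tanPart_eq hu (EuclideanSpace.single a 1)
    rw [tanPart] at this
    rw [this]
    simp_rw [map_sum, sum_inner, map_smul, real_inner_smul_left]
    refine Finset.sum_congr rfl fun i _ => Finset.sum_congr rfl fun j _ => ?_
    rw [real_inner_comm (velocity F j u)]
    ring
  simp_rw [tangentialDiv, h1]
  rw [Finset.sum_comm]
  refine Finset.sum_congr rfl fun i _ => ?_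
  rw [Finset.sum_comm]
  refine Finset.sum_congr rfl fun j _ => ?_
  rw [← Finset.mul_sum, sum_inner_single]

theorem IsLocalParam.jacobian_mul_tangentialDiv {Ω : Set (E k)} {F : E k → E n}
    (h : IsLocalParam k M Ω F) {u : E k} (hu : u ∈ Ω) (D : E n →L[ℝ] E n) :
    jacobian F u * tangentialDiv (tangentSpace M (F u)) D =
      ∑ i, ⟪D (velocity F i u), conormal F i u⟫ := by
  rw [h.tangentialDiv_eq hu, Finset.mul_sum]
  refine Finset.sum_congr rfl fun i _ => ?_
  rw [conormal, inner_sum, Finset.mul_sum]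
  refine Finset.sum_congr rfl fun j _ => ?_
  rw [real_inner_smul_right, mul_assoc]

theorem IsSubmanifold.tangentialDiv_id (hM : IsSubmanifold k M) {x : E n} (hx : x ∈ M) :
    tangentialDiv (tangentSpace M x) (ContinuousLinearMap.id ℝ (E n)) = k := by
  obtain ⟨Ω, F, h, u, hu, rfl⟩ := hM x hx
  rw [h.tangentialDiv_eq hu]
  have : ∀ i, ∑ j, (firstFundamentalForm F u)⁻¹ i j *
      ⟪ContinuousLinearMap.id ℝ (E n) (velocity F i u), velocity F j u⟫ = 1 := by
    intro i
    have := h.isSmoothImmersion.sum_inv_mul hu i i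
    rw [if_pos rfl] at this
    rw [← this]
    refine Finset.sum_congr rfl fun j _ => ?_
    rw [ContinuousLinearMap.id_apply, real_inner_comm]
  rw [Finset.sum_congr rfl fun i _ => this i]
  simp

theorem tangentialDiv_add (T : Submodule ℝ (E n)) (D D' : E n →L[ℝ] E n) :
    tangentialDiv T (D + D') = tangentialDiv T D + tangentialDiv T D' := by
  simp [tangentialDiv, inner_add_left, Finset.sum_add_distrib]

theorem tangentialDiv_smul (T : Submodule ℝ (E n)) (c : ℝ) (D : E n →L[ℝ] E n) :
    tangentialDiv T (c • D) = c * tangentialDiv T D := by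
  simp [tangentialDiv, real_inner_smul_left, Finset.mul_sum]

theorem tangentialDiv_sum {ι : Type*} (s : Finset ι) (T : Submodule ℝ (E n))
    (D : ι → E n →L[ℝ] E n) : tangentialDiv T (∑ i ∈ s, D i) = ∑ i ∈ s, tangentialDiv T (D i) := by
  classical
  induction s using Finset.induction_on with
  | empty => simp [tangentialDiv]
  | insert i s hi ih => rw [Finset.sum_insert hi, Finset.sum_insert hi, tangentialDiv_add, ih]

/-- The trace of a rank-one map. It produces the term `⟪∇h, v^⊤⟫` in the tangential divergence of a
product `h v`. -/
theorem tangentialDiv_smulRight (T : Submodule ℝ (E n)) (f : E n →L[ℝ] ℝ) (v : E n) :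
    tangentialDiv T (f.smulRight v) = f (T.starProjection v) := by
  have h1 : T.starProjection v = ∑ a, v a • T.starProjection (EuclideanSpace.single a (1 : ℝ)) := by
    conv_lhs => rw [show v = ∑ i, v i • (EuclideanSpace.single i (1 : ℝ) : E n) by
      simpa using ((EuclideanSpace.basisFun (Fin n) ℝ).sum_repr v).symm]
    simp
  have h2 : ∀ a, ⟪v, (EuclideanSpace.single a (1 : ℝ) : E n)⟫ = v a := fun a => by
    simpa using EuclideanSpace.inner_single_right a (1 : ℝ) v
  rw [h1]
  simp [tangentialDiv, real_inner_smul_left, mul_comm, h2]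

/-- The tangential divergence only depends on the restriction of the field to `M`. -/
theorem IsSubmanifold.tangentialDiv_congr (hM : IsSubmanifold k M) {x : E n} (hx : x ∈ M)
    {Z Z' : E n → E n} (hZ : DifferentiableAt ℝ Z x) (hZ' : DifferentiableAt ℝ Z' x)
    (h0 : ∀ᶠ y in 𝓝[M] x, Z y = Z' y) :
    tangentialDiv (tangentSpace M x) (fderiv ℝ Z x) =
      tangentialDiv (tangentSpace M x) (fderiv ℝ Z' x) := by
  obtain ⟨Ω, F, h, u, hu, rfl⟩ := hM x hx
  have hF := h.hasFDerivAt hu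
  have htend : Tendsto F (𝓝 u) (𝓝[M] (F u)) := tendsto_nhdsWithin_iff.2
    ⟨hF.continuousAt, (eventually_mem_set.2 (h.isOpen.mem_nhds hu)).mono fun v hv => h.mem hv⟩
  have h1 := (hZ.hasFDerivAt.comp u hF).unique
    ((hZ'.hasFDerivAt.comp u hF).congr_of_eventuallyEq (htend.eventually h0))
  rw [h.tangentialDiv_eq hu, h.tangentialDiv_eq hu]
  refine Finset.sum_congr rfl fun i _ => Finset.sum_congr rfl fun j _ => ?_
  have h2 := congrArg (fun L : E k →L[ℝ] E n => L (EuclideanSpace.single i 1)) h1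
  simp only [ContinuousLinearMap.comp_apply] at h2
  rw [velocity, h2]

theorem IsSubmanifold.tangentialDiv_eq_zero (hM : IsSubmanifold k M) {x : E n} (hx : x ∈ M)
    {Z : E n → E n} (hZ : DifferentiableAt ℝ Z x) {K : Set (E n)} (hK : IsClosed K) (hxK : x ∉ K)
    (h0 : ∀ y ∈ M, y ∉ K → Z y = 0) :
    tangentialDiv (tangentSpace M x) (fderiv ℝ Z x) = 0 := by
  rw [hM.tangentialDiv_congr hx hZ (differentiableAt_const (0 : E n))]
  · simp [tangentialDiv]
  · filter_upwards [self_mem_nhdsWithin, mem_nhdsWithin_of_mem_nhds (hK.isOpen_compl.mem_nhds hxK)]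
      with y hy hyK using h0 y hy hyK

/-- The area formula moves the integral to `Ω`, where `√g` times the tangential divergence equals `∑
⟪∂_i Y, conormal_i⟫` for the pulled-back field `Y`; the first variation formula in the chart
applies. -/
theorem IsMinimalSubmanifold.integral_tangentialDiv_eq_zero_of_chart
    (hM : IsMinimalSubmanifold k M) (hMm : MeasurableSet M) {U : Set (E n)} (hU : IsOpen U)
    (hMU : M ⊆ U) {Z : E n → E n} (hZ : ContDiffOn ℝ 1 Z U) {Ω : Set (E k)} {F : E k → E n}
    (h : IsLocalParam k M Ω F) (hL : IsLipschitzImmersion Ω F)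
    {K : Set (E n)} (hK : IsCompact K) (hKF : K ⊆ F '' Ω) (h0 : ∀ x ∈ M, x ∉ K → Z x = 0) :
    ∫ x in M, tangentialDiv (tangentSpace M x) (fderiv ℝ Z x) ∂μHE[k] = 0 := by
  classical
  have hZd : ∀ x ∈ M, DifferentiableAt ℝ Z x := fun x hx =>
    (hZ.contDiffAt (hU.mem_nhds (hMU hx))).differentiableAt one_ne_zero
  rw [setIntegral_eq_of_subset_of_forall_sdiff_eq_zero hMm h.image_subset, hL.integral_image]
  swap
  · rintro x ⟨hxM, hx⟩
    exact hM.isSubmanifold.tangentialDiv_eq_zero hxM (hZd x hxM) hK.isClosed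
      (fun hxK => hx (hKF hxK)) h0
  set Y : E k → E n := Ω.indicator fun u => Z (F u) with hY
  set K' : Set (E k) := Subtype.val '' ((Ω.domRestrict F) ⁻¹' K) with hK'
  -- Needs both the embedding property and `K ⊆ F '' Ω`: the preimage of a compact subset of the
  -- image is compact.
  have hK'c : IsCompact K' := by
    refine (h.isEmbedding.isInducing.isCompact_preimage' hK ?_).image continuous_subtype_val
    rwa [Set.range_domRestrict]
  have hYs : ∀ u, u ∉ K' → Y u = 0 := by
    intro u hu
    by_cases huΩ : u ∈ Ω
    · rw [hY, indicator_of_mem huΩ]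
      refine h0 _ (h.mem huΩ) fun hFK => hu ⟨⟨u, huΩ⟩, hFK, rfl⟩
    · rw [hY, indicator_of_notMem huΩ]
  have hts : tsupport Y ⊆ K' :=
    closure_minimal (fun u hu => by_contra fun hn => hu (hYs u hn)) hK'c.isClosed
  have hK'Ω : K' ⊆ Ω := by
    rintro _ ⟨u, -, rfl⟩
    exact u.2
  have hYC : ContDiffOn ℝ 1 Y Ω := by
    refine ContDiffOn.congr (f := fun u => Z (F u)) ?_ fun u hu => indicator_of_mem hu _
    have hFC : ContDiffOn ℝ 1 F Ω := h.contDiffOn.of_le (by exact_mod_cast le_top)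
    exact hZ.comp hFC fun u hu => hMU (h.mem hu)
  have hmain := h.isSmoothImmersion.integral_sum_inner_conormal (hM.meanCurvature_eq_zero Ω F h)
    hYC (HasCompactSupport.of_support_subset_isCompact hK'c (subset_closure.trans hts))
    (hts.trans hK'Ω)
  refine Eq.trans ?_ hmain
  rw [← setIntegral_eq_integral_of_forall_compl_eq_zero (s := Ω) (f := fun u =>
    ∑ i, ⟪fderiv ℝ Y u (EuclideanSpace.single i 1), conormal F i u⟫)]
  · refine setIntegral_congr_fun h.isOpen.measurableSet fun u hu => ?_
    beta_reduce
    rw [h.jacobian_mul_tangentialDiv hu]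
    refine Finset.sum_congr rfl fun i _ => ?_
    have h1 : Y =ᶠ[𝓝 u] fun u => Z (F u) := by
      filter_upwards [h.isOpen.mem_nhds hu] with v hv using indicator_of_mem hv _
    have h2 : fderiv ℝ (fun u => Z (F u)) u = _ :=
      ((hZd _ (h.mem hu)).hasFDerivAt.comp u (h.hasFDerivAt hu)).fderiv
    rw [h1.fderiv_eq, h2]
    rfl
  · intro u hu
    have h1 : Y =ᶠ[𝓝 u] 0 := notMem_tsupport_iff_eventuallyEq.1 fun hn => hu (hK'Ω (hts hn))
    simp [h1.fderiv_eq]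

theorem IsSubmanifold.integrableOn_tangentialDiv (hM : IsSubmanifold k M) (hMm : MeasurableSet M)
    {U : Set (E n)} (hU : IsOpen U) (hMU : M ⊆ U) {Z : E n → E n} (hZ : ContDiffOn ℝ 1 Z U)
    {K : Set (E n)} (hK : IsCompact K) (hKM : K ⊆ M) (h0 : ∀ x ∈ M, x ∉ K → Z x = 0) :
    IntegrableOn (fun x => tangentialDiv (tangentSpace M x) (fderiv ℝ Z x)) M μHE[k] := by
  have hc : ContinuousOn (fun x => tangentialDiv (tangentSpace M x) (fderiv ℝ Z x)) M := by
    refine continuousOn_finsetSum _ fun a _ => ContinuousOn.inner (𝕜 := ℝ) ?_ continuousOn_const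
    exact ((hZ.continuousOn_fderiv_of_isOpen hU le_rfl).mono hMU).clm_apply
      (hM.continuousOn_tanPart continuousOn_const)
  refine (hM.integrableOn_compact hK hKM (hc.mono hKM)).of_forall_sdiff_eq_zero hMm ?_
  rintro x ⟨hxM, hxK⟩
  exact hM.tangentialDiv_eq_zero hxM
    ((hZ.contDiffAt (hU.mem_nhds (hMU hxM))).differentiableAt one_ne_zero) hK.isClosed hxK h0

/-- **Divergence theorem** on a minimal submanifold, for compactly supported vector fields of the
ambient space. -/
theorem IsMinimalSubmanifold.integral_tangentialDiv_eq_zero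
    (hM : IsMinimalSubmanifold k M) (hMm : MeasurableSet M) {U : Set (E n)} (hU : IsOpen U)
    (hMU : M ⊆ U) {Z : E n → E n} (hZ : ContDiffOn ℝ 1 Z U) {K : Set (E n)} (hK : IsCompact K)
    (hKM : K ⊆ M) (h0 : ∀ x ∈ M, x ∉ K → Z x = 0) :
    ∫ x in M, tangentialDiv (tangentSpace M x) (fderiv ℝ Z x) ∂μHE[k] = 0 := by
  classical
  have hch : ∀ x : E n, ∃ (Ω : Set (E k)) (F : E k → E n) (W : Set (E n)), IsOpen W ∧ (x ∈ M →
      IsLocalParam k M Ω F ∧ IsLipschitzImmersion Ω F ∧ F '' Ω = M ∩ W ∧ x ∈ W) := by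
    intro x
    by_cases hx : x ∈ M
    · obtain ⟨Ω, F, h, hL, hxF⟩ := hM.isSubmanifold.exists_lipschitz_param hx
      obtain ⟨W, hWo, hW⟩ := h.image_eq
      exact ⟨Ω, F, W, hWo, fun _ => ⟨h, hL, hW, (hW ▸ hxF).2⟩⟩
    · exact ⟨∅, 0, ∅, isOpen_empty, fun h => absurd h hx⟩
  choose Ω F W hWo hch using hch
  obtain ⟨t, htK, hcov⟩ := hK.elim_nhds_subcover W fun x hx =>
    (hWo x).mem_nhds (hch x (hKM hx)).2.2.2
  obtain ⟨χ, hχ⟩ := SmoothPartitionOfUnity.exists_isSubordinate 𝓘(ℝ, E n) hK.isClosed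
    (fun i : t => W i) (fun i => hWo i) (fun x hx => by
      obtain ⟨i, hi, hxi⟩ := mem_iUnion₂.1 (hcov hx)
      exact mem_iUnion.2 ⟨⟨i, hi⟩, hxi⟩)
  have hχC : ∀ i, ContDiff ℝ 1 (χ i) := fun i =>
    ((χ i).contMDiff.contDiff).of_le (by exact_mod_cast le_top)
  set Zi : t → E n → E n := fun i x => χ i x • Z x with hZi
  have hZiC : ∀ i, ContDiffOn ℝ 1 (Zi i) U := fun i => (hχC i).contDiffOn.smul hZ
  set Ki : t → Set (E n) := fun i => K ∩ tsupport (χ i) with hKi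
  have hKic : ∀ i, IsCompact (Ki i) := fun i => hK.inter_right (isClosed_tsupport _)
  have hZi0 : ∀ i, ∀ x ∈ M, x ∉ Ki i → Zi i x = 0 := by
    intro i x hx hxK
    by_cases hxK' : x ∈ K
    · have : χ i x = 0 := image_eq_zero_of_notMem_tsupport fun h => hxK ⟨hxK', h⟩
      simp [hZi, this]
    · simp [hZi, h0 x hx hxK']
  -- The functions `χ i` sum to `1` only on `K`, but `Z` vanishes on `M` off `K`. So `Z = ∑ χ_i Z`
  -- holds along `M`, which is enough for the tangential divergence.
  have hsum : ∀ x ∈ M, tangentialDiv (tangentSpace M x) (fderiv ℝ Z x) =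
      ∑ i, tangentialDiv (tangentSpace M x) (fderiv ℝ (Zi i) x) := by
    intro x hx
    have hd : ∀ i, DifferentiableAt ℝ (Zi i) x := fun i =>
      ((hZiC i).contDiffAt (hU.mem_nhds (hMU hx))).differentiableAt one_ne_zero
    rw [← tangentialDiv_sum, ← fderiv_fun_sum fun i _ => hd i]
    refine hM.isSubmanifold.tangentialDiv_congr hx
      ((hZ.contDiffAt (hU.mem_nhds (hMU hx))).differentiableAt one_ne_zero)
      (DifferentiableAt.fun_sum fun i _ => hd i) ?_
    filter_upwards [self_mem_nhdsWithin] with y hy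
    by_cases hyK : y ∈ K
    · have := χ.sum_eq_one hyK
      rw [finsum_eq_sum_of_fintype] at this
      simp only [hZi]
      rw [← Finset.sum_smul, this, one_smul]
    · simp [hZi, h0 y hy hyK]
  rw [setIntegral_congr_fun hMm hsum, integral_finsetSum]
  · refine Finset.sum_eq_zero fun i _ => ?_
    obtain ⟨h, hL, hW, -⟩ := hch i (hKM (htK i i.2))
    refine hM.integral_tangentialDiv_eq_zero_of_chart hMm hU hMU (hZiC i) h hL (hKic i) ?_ (hZi0 i)
    rw [hW]
    exact fun x hx => ⟨hKM hx.1, hχ i hx.2⟩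
  · exact fun i _ => hM.isSubmanifold.integrableOn_tangentialDiv hMm hU hMU (hZiC i) (hKic i)
      (fun x hx => hKM hx.1) (hZi0 i)

end Submanifold

end MobiusMonotonicity

namespace MobiusMonotonicity

/-! ### Möbius transformations and isometric spheres -/

section Mobius

variable {n : ℕ}

/-- The distance of two points of the extended space, in homogeneous form: the Euclidean distance
of finite points, and `1` for a finite point and `∞`. -/
def homDist (z w : OnePoint (E n)) : ℝ :=
  z.elim (w.elim 0 fun _ => 1) fun x => w.elim 1 fun y => dist x y

@[simp] theorem homDist_coe_coe (x y : E n) : homDist (x : OnePoint (E n)) y = dist x y := rfl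
@[simp] theorem homDist_coe_infty (x : E n) : homDist (x : OnePoint (E n)) ∞ = 1 := rfl
@[simp] theorem homDist_infty_coe (x : E n) : homDist ∞ (x : OnePoint (E n)) = 1 := rfl
@[simp] theorem homDist_infty_infty : homDist (∞ : OnePoint (E n)) ∞ = 0 := rfl

/-- `φ` changes the homogeneous distance by a product of factors at the two points; this says that
`φ` preserves absolute cross ratios. -/
def HasDistortion (φ : OnePoint (E n) → OnePoint (E n)) (lam : OnePoint (E n) → ℝ) : Prop :=
  (∀ z, 0 < lam z) ∧ ∀ z w, homDist (φ z) (φ w) = lam z * lam w * homDist z w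

theorem HasDistortion.comp {φ ψ : OnePoint (E n) → OnePoint (E n)} {lam mu : OnePoint (E n) → ℝ}
    (hφ : HasDistortion φ lam) (hψ : HasDistortion ψ mu) :
    HasDistortion (fun z => φ (ψ z)) fun z => lam (ψ z) * mu z := by
  refine ⟨fun z => mul_pos (hφ.1 _) (hψ.1 _), fun z w => ?_⟩
  rw [hφ.2, hψ.2]
  ring

@[simp] theorem sphereReflectionFun_infty (c : E n) (R : ℝ) :
    sphereReflectionFun c R ∞ = (c : OnePoint (E n)) := rfl

@[simp] theorem sphereReflectionFun_center (c : E n) (R : ℝ) :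
    sphereReflectionFun c R (c : OnePoint (E n)) = ∞ := by
  simp [sphereReflectionFun]

theorem sphereReflectionFun_coe {c x : E n} (R : ℝ) (h : x ≠ c) :
    sphereReflectionFun c R (x : OnePoint (E n)) =
      ((EuclideanGeometry.inversion c R x : E n) : OnePoint (E n)) := by
  simp [sphereReflectionFun, h]

theorem sphereReflection_apply (c : E n) {R : ℝ} (hR : 0 < R) (z : OnePoint (E n)) :
    sphereReflection c R hR z = sphereReflectionFun c R z := rfl

/-- The distortion factor of the reflection in a sphere. -/
def sphereDistortion (c : E n) (R : ℝ) (z : OnePoint (E n)) : ℝ :=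
  open Classical in
  z.elim R fun x => if x = c then 1 / R else R / dist x c

/-- For finite points this is `|σx - σy| = R²|x - y|/(|x - c||y - c|)`. The factors `1/R` at `c` and
`R` at `∞` are forced by the cases in which one of the points is `c` or `∞`. -/
theorem hasDistortion_sphereReflectionFun (c : E n) {R : ℝ} (hR : 0 < R) :
    HasDistortion (sphereReflectionFun c R) (sphereDistortion c R) := by
  have hpos : ∀ x : E n, x ≠ c → 0 < dist x c := fun x hx => dist_pos.2 hx
  constructor
  · intro z
    induction z using OnePoint.rec with
    | infty => simpa [sphereDistortion]
    | coe x =>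
      by_cases hx : x = c
      · simpa [sphereDistortion, hx]
      · have := hpos x hx
        simp only [sphereDistortion, OnePoint.elim_some, hx, if_false]
        positivity
  · intro z w
    induction z using OnePoint.rec with
    | infty =>
      induction w using OnePoint.rec with
      | infty => simp
      | coe y =>
        by_cases hy : y = c
        · subst hy
          simp [sphereDistortion, hR.ne']
        · rw [sphereReflectionFun_coe R hy, sphereReflectionFun_infty, homDist_coe_coe, dist_comm c,
            EuclideanGeometry.dist_inversion_center]
          simp [sphereDistortion, hy]
          ring
    | coe x =>
      by_cases hx : x = c
      · subst hx
        induction w using OnePoint.rec with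
        | infty => simp [sphereDistortion, hR.ne']
        | coe y =>
          by_cases hy : y = x
          · subst hy
            simp
          · have := hpos y hy
            rw [sphereReflectionFun_coe R hy]
            simp [sphereDistortion, hy, dist_comm x]
            field_simp
      · have hx' := hpos x hx
        rw [sphereReflectionFun_coe R hx]
        induction w using OnePoint.rec with
        | infty =>
          simp [sphereDistortion, hx, EuclideanGeometry.dist_inversion_center]
          ring
        | coe y =>
          by_cases hy : y = c
          · subst hy
            simp [sphereDistortion, hx]
            field_simp
          · have hy' := hpos y hy
            rw [sphereReflectionFun_coe R hy]
            rw [homDist_coe_coe, homDist_coe_coe, EuclideanGeometry.dist_inversion_inversion hx hy]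
            simp only [sphereDistortion, OnePoint.elim_some, hx, hy, if_false]
            field_simp

theorem hasDistortion_planeReflectionFun {v : E n} (hv : v ≠ 0) (t : ℝ) :
    HasDistortion (planeReflectionFun v t) fun _ => 1 := by
  refine ⟨fun _ => one_pos, fun z w => ?_⟩
  induction z using OnePoint.rec with
  | infty =>
    induction w using OnePoint.rec with
    | infty => simp [planeReflectionFun]
    | coe y => simp [planeReflectionFun]
  | coe x =>
    induction w using OnePoint.rec with
    | infty => simp [planeReflectionFun]
    | coe y =>
      have hv' : ‖v‖ ^ 2 ≠ 0 := pow_ne_zero _ (norm_ne_zero_iff.mpr hv)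
      simp only [planeReflectionFun, OnePoint.map_some, homDist_coe_coe, one_mul, dist_eq_norm]
      have h1 : x - (2 * (⟪v, x⟫ - t) / ‖v‖ ^ 2) • v - (y - (2 * (⟪v, y⟫ - t) / ‖v‖ ^ 2) • v) =
          (x - y) - (2 * ⟪v, x - y⟫ / ‖v‖ ^ 2) • v := by
        rw [inner_sub_right]
        module
      rw [h1, ← sq_eq_sq₀ (norm_nonneg _) (norm_nonneg _), norm_sub_sq_real, real_inner_smul_right,
        norm_smul, mul_pow, Real.norm_eq_abs, sq_abs, real_inner_comm v (x - y)]
      field_simp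
      ring

theorem IsMobius.exists_hasDistortion {φ : Equiv.Perm (OnePoint (E n))} (hφ : IsMobius φ) :
    ∃ lam, HasDistortion φ lam := by
  obtain ⟨l, hl, rfl⟩ := hφ
  induction l with
  | nil => exact ⟨fun _ => 1, fun _ => one_pos, fun z w => by simp⟩
  | cons σ l ih =>
    obtain ⟨lam, hlam⟩ := ih fun τ hτ => hl τ (List.mem_cons_of_mem _ hτ)
    have hσ : ∃ mu, HasDistortion σ mu := by
      rcases hl σ List.mem_cons_self with ⟨c, R, hR, rfl⟩ | ⟨v, hv, t, rfl⟩
      · exact ⟨_, hasDistortion_sphereReflectionFun c hR⟩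
      · exact ⟨_, hasDistortion_planeReflectionFun hv t⟩
    obtain ⟨mu, hmu⟩ := hσ
    exact ⟨_, by rw [List.prod_cons]; exact hmu.comp hlam⟩

@[simp] theorem finitePart_coe (x : E n) : finitePart (x : OnePoint (E n)) = x := rfl

theorem coe_finitePart {z : OnePoint (E n)} (hz : z ≠ ∞) : (finitePart z : OnePoint (E n)) = z := by
  induction z using OnePoint.rec with
  | infty => exact absurd rfl hz
  | coe x => rfl

/-- The composite `φσ` fixes `∞`. Comparing any finite point with `∞` shows that its distortion
factor is constant on Euclidean space, and the right `R` makes the constant `1`. -/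
theorem exists_isIsometricSphere {φ : Equiv.Perm (OnePoint (E n))} (hφ : IsMobius φ) {b : E n}
    (hb : φ.symm ∞ = (b : OnePoint (E n))) : ∃ R, IsIsometricSphere φ b R := by
  obtain ⟨lam, hlam⟩ := hφ.exists_hasDistortion
  have hφb : φ b = ∞ := by rw [← hb, Equiv.apply_symm_apply]
  -- The factor of `φσ` at `∞` is `lam b * R`; this value makes it `1`.
  set R := 1 / lam b
  have hR : 0 < R := one_div_pos.2 (hlam.1 _)
  set σ := sphereReflection b R hR with hσ
  have hσσ : ∀ z, σ (σ z) = z := sphereReflectionFun_involutive b hR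
  have hσinf : σ ∞ = b := rfl
  have hσb : σ b = ∞ := sphereReflectionFun_center b R
  have hcomp := hlam.comp (hasDistortion_sphereReflectionFun b hR)
  set mu : OnePoint (E n) → ℝ := fun z => lam (sphereReflectionFun b R z) * sphereDistortion b R z
  have hmuinf : mu ∞ = 1 := by
    have : lam b ≠ 0 := (hlam.1 _).ne'
    simp [mu, sphereDistortion, R, this]
  have hne : ∀ x : E n, φ (σ x) ≠ ∞ := by
    intro x hx
    have h1 : σ x = b := by rw [← hb, ← hx, Equiv.symm_apply_apply]
    rw [← hσinf] at h1
    exact OnePoint.coe_ne_infty x (σ.injective h1)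
  have hne' : ∀ y : E n, σ (φ.symm y) ≠ ∞ := by
    intro y hy
    have h1 : φ.symm y = b := by rw [← hσinf, ← hy, hσσ]
    rw [← hb] at h1
    exact OnePoint.coe_ne_infty y (φ.symm.injective h1)
  have hmu1 : ∀ x : E n, mu x = 1 := by
    intro x
    have h1 : homDist (φ (σ x)) (φ (σ ∞)) = mu x * mu ∞ * homDist (x : OnePoint (E n)) ∞ :=
      hcomp.2 x ∞
    rw [hσinf, hφb, ← coe_finitePart (hne x), homDist_coe_infty, homDist_coe_infty, hmuinf, mul_one,
      mul_one] at h1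
    exact h1.symm
  have hiso : Isometry fun x : E n => finitePart (φ (σ x)) := by
    refine Isometry.of_dist_eq fun x y => ?_
    have h1 := hcomp.2 x y
    change homDist (φ (σ x)) (φ (σ y)) = mu x * mu y * dist x y at h1
    rw [hmu1, hmu1, ← coe_finitePart (hne x), ← coe_finitePart (hne y)] at h1
    simpa using h1
  let ψ : E n ≃ᵢ E n := IsometryEquiv.mk' (fun x : E n => finitePart (φ (σ x)))
    (fun y => finitePart (σ (φ.symm y)))
    (fun y => by rw [coe_finitePart (hne' y), hσσ, Equiv.apply_symm_apply, finitePart_coe]) hiso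
  refine ⟨R, hR, ψ, fun z => ?_⟩
  have hψ : ∀ x : E n, OnePoint.map ψ (x : OnePoint (E n)) = φ (σ x) := fun x => by
    rw [OnePoint.map_some]
    exact coe_finitePart (hne x)
  by_cases hz : σ z = ∞
  · rw [← hσ, hz, OnePoint.map_infty, ← hφb, ← hσinf, ← hz, hσσ]
  · rw [← hσ, ← coe_finitePart hz, hψ, coe_finitePart hz, hσσ]

/-- The radius is read off from the distance of the images of `0` and `2b`, two points at distance
`|b|` from `b`. They are distinct from `b` because `b ≠ 0`. -/
theorem IsIsometricSphere.radius_unique {φ : Equiv.Perm (OnePoint (E n))} {b : E n} (hb0 : b ≠ 0)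
    {R R' : ℝ} (h : IsIsometricSphere φ b R) (h' : IsIsometricSphere φ b R') : R = R' := by
  obtain ⟨hR, ψ, hψ⟩ := h
  obtain ⟨hR', ψ', hψ'⟩ := h'
  have key : ∀ (R : ℝ) (hR : 0 < R) (ψ : E n ≃ᵢ E n),
      (∀ z, φ z = OnePoint.map ψ (sphereReflection b R hR z)) →
      homDist (φ (0 : E n)) (φ ((2 : ℝ) • b : E n)) = R ^ 2 * (2 / ‖b‖) := by
    intro R hR ψ hψ
    have h0 : (0 : E n) ≠ b := fun h => hb0 h.symm
    have h2 : (2 : ℝ) • b ≠ b := fun h => hb0 (by simpa [two_smul] using h)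
    rw [hψ, hψ, sphereReflection_apply, sphereReflection_apply, sphereReflectionFun_coe R h0,
      sphereReflectionFun_coe R h2, OnePoint.map_some, OnePoint.map_some, homDist_coe_coe,
      ψ.dist_eq, EuclideanGeometry.dist_inversion_inversion h0 h2]
    have hb' : ‖b‖ ≠ 0 := norm_ne_zero_iff.2 hb0
    have : dist ((2 : ℝ) • b) b = ‖b‖ := by
      rw [dist_eq_norm, two_smul, add_sub_cancel_right]
    rw [this, dist_zero_left, dist_zero_left, norm_smul]
    simp only [Real.norm_ofNat]
    field_simp
  have h1 := (key R hR ψ hψ).symm.trans (key R' hR' ψ' hψ')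
  have hb' : (2 / ‖b‖) ≠ 0 := div_ne_zero two_ne_zero (norm_ne_zero_iff.2 hb0)
  exact (pow_left_inj₀ hR.le hR'.le two_ne_zero).1 (mul_right_cancel₀ hb' h1)

/-- The radial level `|φ⁻¹(x)|`. -/
def radialLevel (φ : Equiv.Perm (OnePoint (E n))) (x : E n) : ℝ := ‖finitePart (φ.symm x)‖

/-- The geometry of `φ` in terms of `p = φ(0)`, `w = φ(∞) - φ(a)` and its isometric sphere. -/
theorem IsIsometricSphere.geometry {φ : Equiv.Perm (OnePoint (E n))} {b : E n} (hb0 : b ≠ 0)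
    {R : ℝ} (hR : 0 < R) (h : IsIsometricSphere φ b R) {a : OnePoint (E n)} {p w : E n}
    (ha : a = sphereReflection b R hR ((0 : E n) : OnePoint (E n)))
    (hp : p = finitePart (φ ((0 : E n) : OnePoint (E n))))
    (hw : w = finitePart (φ ∞) - finitePart (φ a)) :
    ‖w‖ = ‖b‖ ∧ ∃ c : E n, c = p + (R ^ 2 / ‖b‖ ^ 2) • w ∧
      (∀ x, x ≠ c → radialLevel φ x * dist x c = ‖b‖ * dist x p) ∧
      ∀ r, imageBall φ r = {x | x ≠ c ∧ radialLevel φ x < r} := by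
  obtain ⟨_, ψ, hψ⟩ := h
  have h0b : (0 : E n) ≠ b := fun h => hb0 h.symm
  have hbn : ‖b‖ ≠ 0 := norm_ne_zero_iff.2 hb0
  set a' : E n := EuclideanGeometry.inversion b R 0 with ha'
  have haa : a = (a' : OnePoint (E n)) := by
    rw [ha, sphereReflection_apply, sphereReflectionFun_coe R h0b]
  have ha'b : a' ≠ b := by
    rw [ha', Ne, EuclideanGeometry.inversion_eq_center hR.ne']
    exact h0b
  have hinv : EuclideanGeometry.inversion b R a' = 0 :=
    EuclideanGeometry.inversion_inversion b hR.ne' 0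
  have hp' : p = ψ a' := by
    rw [hp, hψ, sphereReflection_apply, sphereReflectionFun_coe R h0b, OnePoint.map_some,
      finitePart_coe]
  have hw' : w = ψ b - ψ 0 := by
    rw [hw, hψ, hψ, haa, sphereReflection_apply, sphereReflection_apply, sphereReflectionFun_infty,
      sphereReflectionFun_coe R ha'b, OnePoint.map_some, OnePoint.map_some, hinv, finitePart_coe,
      finitePart_coe]
  have hφx : ∀ x : E n, φ.symm x = sphereReflectionFun b R (ψ.symm x : E n) := by
    intro x
    rw [Equiv.symm_apply_eq, hψ, sphereReflection_apply, sphereReflectionFun_involutive b hR,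
      OnePoint.map_some, IsometryEquiv.apply_symm_apply]
  -- The point `c` is `φ(∞) = ψ(b)`, while `φ(a) = ψ(0)`. It has to be excluded by hand:
  -- `finitePart` sends `φ⁻¹(c) = ∞` to `0`, so `radialLevel φ c` would be `0`.
  refine ⟨?_, ψ b, ?_, ?_, ?_⟩
  · rw [hw', ← dist_eq_norm, ψ.dist_eq, dist_zero_right]
  · set L := ψ.toRealAffineIsometryEquiv.linearIsometryEquiv
    have hL : ∀ x y : E n, ψ x - ψ y = L (x - y) := fun x y => by
      have := ψ.toRealAffineIsometryEquiv.map_vsub x y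
      simpa [L] using this.symm
    rw [hw', hp', hL, ← sub_eq_iff_eq_add', hL, sub_zero, ← map_smul]
    congr 1
    rw [ha', EuclideanGeometry.inversion]
    simp only [dist_zero_left, vsub_eq_sub, zero_sub, vadd_eq_add, smul_neg]
    rw [div_pow]
    abel
  · intro x hx
    have hx' : ψ.symm x ≠ b := fun h => hx (by rw [← h, IsometryEquiv.apply_symm_apply])
    have h1 : dist (EuclideanGeometry.inversion b R (ψ.symm x))
        (EuclideanGeometry.inversion b R a') = radialLevel φ x := by
      rw [hinv, dist_zero_right, radialLevel, hφx, sphereReflectionFun_coe R hx', finitePart_coe]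
    rw [EuclideanGeometry.dist_inversion_inversion hx' ha'b, ha',
      EuclideanGeometry.dist_inversion_center, ← ha', dist_zero_left] at h1
    have h2 : dist (ψ.symm x) b = dist x (ψ b) := by
      rw [← ψ.dist_eq, IsometryEquiv.apply_symm_apply]
    have h3 : dist (ψ.symm x) a' = dist x p := by
      rw [← ψ.dist_eq, IsometryEquiv.apply_symm_apply, hp']
    have h4 : dist x (ψ b) ≠ 0 := dist_ne_zero.2 hx
    rw [← h1, h2, h3]
    field_simp
  · intro r
    ext x
    constructor
    · rintro ⟨y, hy, hyx⟩
      have h1 : φ.symm x = y := by rw [← hyx, Equiv.symm_apply_apply]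
      refine ⟨?_, ?_⟩
      · rintro rfl
        rw [hφx, IsometryEquiv.symm_apply_apply, sphereReflectionFun_center] at h1
        exact OnePoint.infty_ne_coe y h1
      · rw [radialLevel, h1, finitePart_coe]
        simpa using hy
    · rintro ⟨hx, hr⟩
      have hx' : ψ.symm x ≠ b := fun h => hx (by rw [← h, IsometryEquiv.apply_symm_apply])
      have h1 : φ.symm x ≠ ∞ := by
        rw [hφx, sphereReflectionFun_coe R hx']
        exact OnePoint.coe_ne_infty _
      refine ⟨finitePart (φ.symm x), by simpa [radialLevel] using hr, ?_⟩
      rw [coe_finitePart h1, Equiv.apply_symm_apply]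

end Mobius

end MobiusMonotonicity

namespace MobiusMonotonicity

open Filter

/-! ### The first variation against functions of the level -/

section Level

variable {k n : ℕ} {M : Set (E n)} {p w : E n} {R tbar : ℝ}

/-- The level function in terms of `p = φ(0)` and `w = φ(∞) - φ(a)`. -/
def affineLevel (p w : E n) (R : ℝ) (x : E n) : ℝ :=
  ‖w‖ ^ 2 * ‖x - p‖ ^ 2 / (R ^ 2 - 2 * ⟪x - p, w⟫)

/-- A minimal submanifold of the half-space where the level function is defined, with compact
sublevel sets below `tbar`. -/
structure IsProperMinimal (k : ℕ) (M : Set (E n)) (p w : E n) (R tbar : ℝ) : Prop where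
  minimal : IsMinimalSubmanifold k M
  measurableSet : MeasurableSet M
  ne_zero : w ≠ 0
  denom_pos : ∀ x ∈ M, 0 < R ^ 2 - 2 * ⟪x - p, w⟫
  isCompact_le : ∀ t < tbar, IsCompact (M ∩ {x | affineLevel p w R x ≤ t})

theorem measurable_affineLevel : Measurable (affineLevel p w R) := by
  unfold affineLevel
  fun_prop

theorem contDiffOn_affineLevel :
    ContDiffOn ℝ 1 (affineLevel p w R) {x | 0 < R ^ 2 - 2 * ⟪x - p, w⟫} := by
  unfold affineLevel
  have h1 : ContDiff ℝ 1 fun x : E n => x - p := contDiff_id.sub contDiff_const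
  refine ContDiffOn.div ?_ ?_ fun x hx => (ne_of_gt hx)
  · exact (contDiff_const.mul (h1.norm_sq ℝ)).contDiffOn
  · exact (contDiff_const.sub (contDiff_const.mul (h1.inner ℝ contDiff_const))).contDiffOn

theorem isOpen_denom_pos : IsOpen {x : E n | 0 < R ^ 2 - 2 * ⟪x - p, w⟫} :=
  isOpen_lt continuous_const (by fun_prop)

theorem affineLevel_nonneg {x : E n} (hx : 0 < R ^ 2 - 2 * ⟪x - p, w⟫) :
    0 ≤ affineLevel p w R x := by
  unfold affineLevel
  positivity

theorem affineLevel_pos {x : E n} (hw : w ≠ 0) (hx : 0 < R ^ 2 - 2 * ⟪x - p, w⟫) (hxp : x ≠ p) :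
    0 < affineLevel p w R x := by
  have h1 : 0 < ‖w‖ := norm_pos_iff.2 hw
  have h2 : 0 < ‖x - p‖ := norm_pos_iff.2 (sub_ne_zero.2 hxp)
  unfold affineLevel
  positivity

/-- The gradient points along `(x - p) + f w/|w|²`; this shape dictates the choice of vector field
in the first variation. -/
theorem hasFDerivAt_affineLevel (hw : w ≠ 0) {x : E n} (hx : 0 < R ^ 2 - 2 * ⟪x - p, w⟫) :
    HasFDerivAt (affineLevel p w R) ((2 * ‖w‖ ^ 2 / (R ^ 2 - 2 * ⟪x - p, w⟫)) •
      innerSL ℝ ((x - p) + affineLevel p w R x • ((1 / ‖w‖ ^ 2) • w))) x := by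
  have h0 : HasFDerivAt (fun y : E n => y - p) (ContinuousLinearMap.id ℝ (E n)) x :=
    (hasFDerivAt_id x).sub_const p
  have h1 := (h0.norm_sq.const_mul (‖w‖ ^ 2)).mul
    ((hasDerivAt_inv hx.ne').comp_hasFDerivAt x
      (((h0.inner ℝ (hasFDerivAt_const w x)).const_mul 2).const_sub (R ^ 2)))
  refine (h1.congr_fderiv ?_).congr_of_eventuallyEq ?_
  · ext v
    have hw' : ‖w‖ ^ 2 ≠ 0 := pow_ne_zero _ (norm_ne_zero_iff.2 hw)
    simp only [_root_.add_apply, _root_.smul_apply, _root_.neg_apply, smul_eq_mul,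
      innerSL_apply_apply, inner_add_left, real_inner_smul_left, ContinuousLinearMap.comp_apply,
      ContinuousLinearMap.prod_apply, fderivInnerCLM_apply, ContinuousLinearMap.id_apply,
      _root_.zero_apply, inner_zero_right, affineLevel, nsmul_eq_mul, real_inner_comm w v,
      Function.comp_apply]
    have hx' := hx.ne'
    push_cast
    field_simp
    ring
  · exact Filter.Eventually.of_forall fun y => by simp [affineLevel, div_eq_mul_inv]

theorem inner_starProjection_self (T : Submodule ℝ (E n)) (v : E n) :
    ⟪v, T.starProjection v⟫ = ‖T.starProjection v‖ ^ 2 := by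
  rw [← real_inner_self_eq_norm_sq, Submodule.inner_starProjection_left_eq_right,
    Submodule.starProjection_eq_self_iff.2 (Submodule.starProjection_apply_mem T v)]

theorem norm_sq_eq_tanPart_add_norPart (M : Set (E n)) (x v : E n) :
    ‖v‖ ^ 2 = ‖tanPart M x v‖ ^ 2 + ‖norPart M x v‖ ^ 2 := by
  rw [norPart, norm_sub_sq_real, tanPart, inner_starProjection_self]
  ring

theorem hasDerivAt_integral_left {g : ℝ → ℝ} (hg : Continuous g) (c t : ℝ) :
    HasDerivAt (fun s => ∫ y in s..c, g y) (-g t) t :=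
  intervalIntegral.integral_hasDerivAt_left (hg.intervalIntegrable _ _)
    (hg.stronglyMeasurableAtFilter _ _) hg.continuousAt

theorem contDiff_integral_left {g : ℝ → ℝ} (hg : Continuous g) (c : ℝ) :
    ContDiff ℝ 1 fun s => ∫ y in s..c, g y := by
  rw [contDiff_one_iff_deriv]
  refine ⟨fun t => (hasDerivAt_integral_left hg c t).differentiableAt, ?_⟩
  have : deriv (fun s => ∫ y in s..c, g y) = fun t => -g t :=
    funext fun t => (hasDerivAt_integral_left hg c t).deriv
  rw [this]
  exact hg.neg

theorem integral_left_eq_zero {g : ℝ → ℝ} {c t : ℝ} (hg : ∀ s, c ≤ s → g s = 0) (ht : c ≤ t) :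
    ∫ y in t..c, g y = 0 := by
  rw [intervalIntegral.integral_symm, neg_eq_zero]
  refine intervalIntegral.integral_zero_ae (Filter.Eventually.of_forall fun y hy => ?_)
  rw [uIoc_of_le ht] at hy
  exact hg y hy.1.le

namespace IsProperMinimal

theorem continuousOn_level (h : IsProperMinimal k M p w R tbar) :
    ContinuousOn (affineLevel p w R) M :=
  contDiffOn_affineLevel.continuousOn.mono h.denom_pos

/-- The first variation formula for the field `A(f)(x - p) - B(f) w/|w|²`, where `A' = -g` and
`B'(t) = -t g(t)`. -/
theorem integral_first_variation (h : IsProperMinimal k M p w R tbar) {g : ℝ → ℝ}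
    (hg : Continuous g) {c : ℝ} (hc : c < tbar) (hgc : ∀ t, c ≤ t → g t = 0) :
    ∫ x in M, (k * (∫ t in affineLevel p w R x..c, g t) - g (affineLevel p w R x) *
      (2 * ‖w‖ ^ 2 / (R ^ 2 - 2 * ⟪x - p, w⟫)) * (‖tanPart M x (x - p)‖ ^ 2 -
        affineLevel p w R x ^ 2 * ‖tanPart M x ((1 / ‖w‖ ^ 2) • w)‖ ^ 2)) ∂μHE[k] = 0 := by
  set f := affineLevel p w R with hf
  set e := (1 / ‖w‖ ^ 2) • w with he
  set A : ℝ → ℝ := fun s => ∫ y in s..c, g y with hA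
  have hg' : Continuous fun t => t * g t := continuous_id.mul hg
  set B : ℝ → ℝ := fun s => ∫ y in s..c, y * g y with hB
  -- Since `B' = t A'`, the gradient terms combine to a multiple of `⟪(x - p) + f e, (x - p)^⊤ - f
  -- e^⊤⟫`, a difference of squares without mixed terms.
  set Z : E n → E n := fun x => A (f x) • (x - p) + -(B (f x)) • e with hZ
  have hZC : ContDiffOn ℝ 1 Z {x | 0 < R ^ 2 - 2 * ⟪x - p, w⟫} := by
    refine ContDiffOn.add ?_ ?_
    · exact ((contDiff_integral_left hg c).comp_contDiffOn contDiffOn_affineLevel).smul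
        (contDiff_id.sub contDiff_const).contDiffOn
    · exact ((contDiff_integral_left hg' c).comp_contDiffOn contDiffOn_affineLevel).neg.smul
        contDiffOn_const
  have hmain := h.minimal.integral_tangentialDiv_eq_zero h.measurableSet isOpen_denom_pos
    h.denom_pos hZC (h.isCompact_le c hc) inter_subset_left (fun x hx hxK => by
      have hcx : c ≤ f x := by
        by_contra hlt
        exact hxK ⟨hx, (not_le.1 hlt).le⟩
      simp only [hZ, hA, hB]
      rw [integral_left_eq_zero hgc hcx, integral_left_eq_zero (fun s hs => by
        rw [hgc s hs, mul_zero]) hcx]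
      simp)
  rw [← hmain]
  refine setIntegral_congr_fun h.measurableSet fun x hx => ?_
  beta_reduce
  have hd := h.denom_pos x hx
  have hdf := hasFDerivAt_affineLevel h.ne_zero hd
  set df := (2 * ‖w‖ ^ 2 / (R ^ 2 - 2 * ⟪x - p, w⟫)) • innerSL ℝ ((x - p) + f x • e) with hdfd
  have h0 : HasFDerivAt (fun y : E n => y - p) (ContinuousLinearMap.id ℝ (E n)) x :=
    (hasFDerivAt_id x).sub_const p
  have hAf : HasFDerivAt (fun x => A (f x)) ((-g (f x)) • df) x :=
    (hasDerivAt_integral_left hg c (f x)).comp_hasFDerivAt x hdf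
  have hBf : HasFDerivAt (fun x => -(B (f x))) (-((-(f x * g (f x))) • df)) x :=
    ((hasDerivAt_integral_left hg' c (f x)).comp_hasFDerivAt x hdf).neg
  have hZd : HasFDerivAt Z _ x := (hAf.smul h0).add (hBf.smul (hasFDerivAt_const e x))
  rw [hZd.fderiv, smul_zero, zero_add, tangentialDiv_add, tangentialDiv_add, tangentialDiv_smul,
    h.minimal.isSubmanifold.tangentialDiv_id hx, tangentialDiv_smulRight, tangentialDiv_smulRight]
  simp only [hdfd, _root_.smul_apply, _root_.neg_apply, innerSL_apply_apply, smul_eq_mul,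
    inner_add_left, real_inner_smul_left]
  have e1 : ∀ u v : E n, ⟪u, (tangentSpace M x).starProjection v⟫ =
      ⟪(tangentSpace M x).starProjection u, v⟫ := fun u v =>
    (Submodule.inner_starProjection_left_eq_right _ _ _).symm
  rw [inner_starProjection_self, inner_starProjection_self, e1 (x - p) e,
    real_inner_comm ((tangentSpace M x).starProjection (x - p)) e]
  simp only [tanPart]
  rw [real_inner_comm]
  ring

end IsProperMinimal

end Level

end MobiusMonotonicity

namespace MobiusMonotonicity

open Filter

/-! ### The volume identity -/

section VolumeIdentity

variable {k n : ℕ} {M : Set (E n)} {p w : E n} {R tbar : ℝ}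

/-- A continuous approximation of the indicator function of `(-∞, c)`. -/
def ramp (m : ℕ) (c t : ℝ) : ℝ := max 0 (min 1 (m * (c - t)))

theorem continuous_ramp (m : ℕ) (c : ℝ) : Continuous (ramp m c) := by
  unfold ramp
  fun_prop

theorem ramp_nonneg (m : ℕ) (c t : ℝ) : 0 ≤ ramp m c t := le_max_left _ _

theorem ramp_le_one (m : ℕ) (c t : ℝ) : ramp m c t ≤ 1 := max_le zero_le_one (min_le_left _ _)

theorem ramp_eq_zero {c t : ℝ} (m : ℕ) (h : c ≤ t) : ramp m c t = 0 := by
  refine max_eq_left ((min_le_right _ _).trans ?_)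
  exact mul_nonpos_of_nonneg_of_nonpos m.cast_nonneg (by linarith)

theorem tendsto_ramp (c t : ℝ) :
    Tendsto (fun m => ramp m c t) atTop (𝓝 (if t < c then 1 else 0)) := by
  split_ifs with h
  · refine tendsto_const_nhds.congr' ?_
    obtain ⟨N, hN⟩ := exists_nat_ge (1 / (c - t))
    filter_upwards [eventually_ge_atTop N] with m hm
    have hct : 0 < c - t := by linarith
    have h1 : (1 : ℝ) ≤ m * (c - t) := by
      rw [div_le_iff₀ hct] at hN
      refine hN.trans ?_
      gcongr
    rw [ramp, min_eq_left h1, max_eq_right zero_le_one]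
  · simp only [ramp_eq_zero _ (not_lt.1 h), tendsto_const_nhds]

/-- The difference of two ramps approximates the indicator function of `[a, c)`. -/
def plateau (m : ℕ) (a c t : ℝ) : ℝ := ramp m c t - ramp m a t

theorem abs_plateau_le (m : ℕ) (a c t : ℝ) : |plateau m a c t| ≤ 1 := by
  rw [plateau, abs_le]
  constructor <;> linarith [ramp_nonneg m c t, ramp_le_one m c t, ramp_nonneg m a t,
    ramp_le_one m a t]

theorem tendsto_plateau {a c : ℝ} (hac : a < c) (t : ℝ) :
    Tendsto (fun m => plateau m a c t) atTop (𝓝 ((Ico a c).indicator 1 t)) := by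
  have h : (Ico a c).indicator 1 t = (if t < c then (1 : ℝ) else 0) - if t < a then 1 else 0 := by
    by_cases h1 : t < a
    · simp [h1, h1.trans hac]
    · by_cases h2 : t < c
      · simp [h1, h2, not_lt.1 h1]
      · simp [h1, h2]
  rw [h]
  exact (tendsto_ramp c t).sub (tendsto_ramp a t)

theorem tendsto_integral_plateau_mul {a c t : ℝ} (hac : a < c) (htc : t ≤ c) {γ : ℝ → ℝ}
    (hγ : Continuous γ) :
    Tendsto (fun m => ∫ s in t..c, plateau m a c s * γ s) atTop (𝓝 (∫ s in (max t a)..c, γ s)) := by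
  have h1 : ∫ s in (max t a)..c, γ s = ∫ s in t..c, (Ico a c).indicator 1 s * γ s := by
    rw [intervalIntegral.integral_of_le htc, intervalIntegral.integral_of_le (max_le htc hac.le),
      ← integral_Ico_eq_integral_Ioc, ← integral_Ico_eq_integral_Ioc]
    have h2 : Ico (max t a) c = Ico t c ∩ Ico a c := by
      rw [Ico_inter_Ico, min_self]
    rw [h2, ← setIntegral_indicator measurableSet_Ico]
    congr 1
    ext s
    by_cases hs : s ∈ Ico a c <;> simp [hs]
  rw [h1]
  refine intervalIntegral.tendsto_integral_filter_of_dominated_convergence (fun s => |γ s|) ?_ ?_ ?_ ?_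
  · refine Eventually.of_forall fun m => Continuous.aestronglyMeasurable ?_
    exact ((continuous_ramp m c).sub (continuous_ramp m a)).mul hγ
  · refine Eventually.of_forall fun m => Eventually.of_forall fun s _ => ?_
    rw [norm_mul, Real.norm_eq_abs, Real.norm_eq_abs]
    exact mul_le_of_le_one_left (abs_nonneg _) (abs_plateau_le m a c s)
  · exact hγ.abs.intervalIntegrable _ _
  · exact Eventually.of_forall fun s _ => (tendsto_plateau hac s).mul_const _

/-- Explains the factor `1/2` in the weight: `(k/2) s^(-k/2-1)` has antiderivative `-s^(-k/2)`. -/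
theorem integral_half_rpow {a c : ℝ} (ha : 0 < a) (hac : a ≤ c) (hk : 1 ≤ k) :
    k * ∫ s in a..c, 1 / 2 * s ^ (-(k : ℝ) / 2 - 1) = a ^ (-(k : ℝ) / 2) - c ^ (-(k : ℝ) / 2) := by
  have hk' : (0 : ℝ) < k := by exact_mod_cast hk
  rw [intervalIntegral.integral_const_mul, integral_rpow]
  · have h1 : -(k : ℝ) / 2 - 1 + 1 = -(k : ℝ) / 2 := by ring
    rw [h1]
    field_simp
    ring
  · right
    refine ⟨by linarith, ?_⟩
    rw [uIcc_of_le hac]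
    exact fun h => absurd h.1 (not_le.2 ha)

namespace IsProperMinimal

theorem isCompact_between (h : IsProperMinimal k M p w R tbar) {s t : ℝ} (ht : t < tbar) :
    IsCompact (M ∩ {x | s ≤ affineLevel p w R x ∧ affineLevel p w R x ≤ t}) := by
  have hK := h.isCompact_le t ht
  have := (h.continuousOn_level.mono inter_subset_left).preimage_isClosed_of_isClosed
    hK.isClosed (isClosed_Ici (a := s))
  have heq : M ∩ {x | s ≤ affineLevel p w R x ∧ affineLevel p w R x ≤ t} =
      (M ∩ {x | affineLevel p w R x ≤ t}) ∩ affineLevel p w R ⁻¹' Ici s := by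
    ext x
    exact ⟨fun h => ⟨⟨h.1, h.2.2⟩, h.2.1⟩, fun h => ⟨h.1.1, h.2, h.1.2⟩⟩
  rw [heq]
  exact hK.of_isClosed_subset this inter_subset_left

theorem measurableSet_lt (h : IsProperMinimal k M p w R tbar) (t : ℝ) :
    MeasurableSet (M ∩ {x | affineLevel p w R x < t}) :=
  h.measurableSet.inter (_root_.measurableSet_lt measurable_affineLevel measurable_const)

theorem measurableSet_between (h : IsProperMinimal k M p w R tbar) (s t : ℝ) :
    MeasurableSet (M ∩ {x | s ≤ affineLevel p w R x ∧ affineLevel p w R x < t}) :=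
  h.measurableSet.inter ((_root_.measurableSet_le measurable_const measurable_affineLevel).inter
    (_root_.measurableSet_lt measurable_affineLevel measurable_const))

theorem measure_lt_top (h : IsProperMinimal k M p w R tbar) {t : ℝ} (ht : t < tbar) :
    (μHE[k] : Measure (E n)) (M ∩ {x | affineLevel p w R x < t}) < ⊤ :=
  (measure_mono (show M ∩ {x | affineLevel p w R x < t} ⊆ M ∩ {x | affineLevel p w R x ≤ t} from
    fun x hx => ⟨hx.1, (show affineLevel p w R x < t from hx.2).le⟩)).trans_lt
      (h.minimal.isSubmanifold.measure_lt_top (h.isCompact_le t ht) inter_subset_left)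

theorem ne_of_level_pos {x : E n} (hx : 0 < affineLevel p w R x) : x ≠ p := by
  rintro rfl
  simp [affineLevel] at hx

/-- The limit of the first variation formulas as `g` tends to a multiple of an indicator. -/
theorem integral_sharp_variation (h : IsProperMinimal k M p w R tbar) (hk : 1 ≤ k) {a c : ℝ}
    (ha : 0 < a) (hac : a < c) (hc : c < tbar) :
    ∫ x in M ∩ {x | affineLevel p w R x < c}, ((max (affineLevel p w R x) a ^ (-(k : ℝ) / 2) -
      c ^ (-(k : ℝ) / 2)) - {x | a ≤ affineLevel p w R x}.indicator (fun x =>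
        affineLevel p w R x ^ (-(k : ℝ) / 2) * ((‖tanPart M x (x - p)‖ ^ 2 -
        affineLevel p w R x ^ 2 * ‖tanPart M x ((1 / ‖w‖ ^ 2) • w)‖ ^ 2) / ‖x - p‖ ^ 2)) x)
        ∂μHE[k] = 0 := by
  set f := affineLevel p w R with hf
  set Q : E n → ℝ := fun x => (2 * ‖w‖ ^ 2 / (R ^ 2 - 2 * ⟪x - p, w⟫)) *
    (‖tanPart M x (x - p)‖ ^ 2 - f x ^ 2 * ‖tanPart M x ((1 / ‖w‖ ^ 2) • w)‖ ^ 2) with hQ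
  -- Freezing the power below `a` keeps `γ` continuous and bounded by `γ a`; in the limit the
  -- plateau removes that region.
  set γ : ℝ → ℝ := fun s => 1 / 2 * (max s a) ^ (-(k : ℝ) / 2 - 1) with hγdef
  have hγ : Continuous γ := by
    refine continuous_const.mul ?_
    rw [continuous_iff_continuousAt]
    intro s
    exact (continuousAt_id.max continuousAt_const).rpow_const
      (Or.inl (lt_of_lt_of_le ha (le_max_right _ _)).ne')
  have hγ0 : ∀ s, 0 ≤ γ s := fun s =>
    mul_nonneg (by norm_num) (Real.rpow_nonneg (ha.le.trans (le_max_right _ _)) _)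
  have hγb : ∀ s, γ s ≤ γ a := by
    intro s
    simp only [hγdef, max_self]
    have := Real.rpow_le_rpow_of_nonpos ha (le_max_right s a)
      (show -(k : ℝ) / 2 - 1 ≤ 0 by
        have : (0 : ℝ) ≤ k := k.cast_nonneg
        linarith)
    linarith
  set K := M ∩ {x | f x ≤ c} with hK
  have hKc : IsCompact K := h.isCompact_le c hc
  have hf0 : ∀ x ∈ M, 0 ≤ f x := fun x hx => affineLevel_nonneg (h.denom_pos x hx)
  have hfc : ContinuousOn f M := h.continuousOn_level
  have htc : ContinuousOn (fun x => tanPart M x (x - p)) M :=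
    h.minimal.isSubmanifold.continuousOn_tanPart (by fun_prop)
  have htw : ContinuousOn (fun x => tanPart M x ((1 / ‖w‖ ^ 2) • w)) M :=
    h.minimal.isSubmanifold.continuousOn_tanPart continuousOn_const
  have hQc : ContinuousOn Q M := by
    refine ContinuousOn.mul ?_ ((htc.norm.pow 2).sub ((hfc.pow 2).mul (htw.norm.pow 2)))
    exact continuousOn_const.div (by fun_prop) fun x hx => (h.denom_pos x hx).ne'
  obtain ⟨C, hC⟩ := hKc.exists_bound_of_continuousOn (hQc.mono inter_subset_left)
  set Φ : ℕ → E n → ℝ := fun m x => k * (∫ t in f x..c, plateau m a c t * γ t) -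
    plateau m a c (f x) * γ (f x) * Q x with hΦ
  have hgc : ∀ m t, c ≤ t → plateau m a c t * γ t = 0 := fun m t ht => by
    rw [plateau, ramp_eq_zero m ht, ramp_eq_zero m (hac.le.trans ht), sub_zero, zero_mul]
  have hgcont : ∀ m, Continuous fun t => plateau m a c t * γ t := fun m =>
    ((continuous_ramp m c).sub (continuous_ramp m a)).mul hγ
  have hΦ0 : ∀ m, ∫ x in M, Φ m x ∂μHE[k] = 0 := by
    intro m
    rw [← h.integral_first_variation (hgcont m) hc (hgc m)]
    refine integral_congr_ae (Eventually.of_forall fun x => ?_)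
    simp only [hΦ, hQ]
    ring
  have hΦc : ∀ m, ContinuousOn (Φ m) M := by
    intro m
    refine ContinuousOn.sub (continuousOn_const.mul ?_) (ContinuousOn.mul ?_ hQc)
    · exact (contDiff_integral_left (hgcont m) c).continuous.comp_continuousOn hfc
    · exact (hgcont m).comp_continuousOn hfc
  have hΦz : ∀ m, ∀ x, c ≤ f x → Φ m x = 0 := fun m x hx => by
    simp only [hΦ]
    rw [integral_left_eq_zero (hgc m) hx, hgc m _ hx]
    simp
  set S := M ∩ {x | f x < c} with hS
  have hSm : MeasurableSet S := h.measurableSet_lt c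
  have hΦS : ∀ m, ∫ x in S, Φ m x ∂μHE[k] = 0 := by
    intro m
    rw [← hΦ0 m]
    refine (setIntegral_eq_of_subset_of_forall_sdiff_eq_zero h.measurableSet inter_subset_left ?_).symm
    rintro x ⟨hxM, hx⟩
    exact hΦz m x (not_lt.1 fun hlt => hx ⟨hxM, hlt⟩)
  have hfin : IsFiniteMeasure ((μHE[k] : Measure (E n)).restrict S) :=
    ⟨by simpa using h.measure_lt_top hc⟩
  -- Each approximating integral is zero, so the limit given by dominated convergence on the
  -- finite-measure set `S` is zero too.
  refine tendsto_nhds_unique (f := fun m => ∫ x in S, Φ m x ∂μHE[k]) (l := atTop) ?_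
    (tendsto_const_nhds.congr fun m => (hΦS m).symm)
  refine tendsto_integral_of_dominated_convergence (fun _ => k * (c * γ a) + γ a * C)
    (fun m => ((hΦc m).mono inter_subset_left).aestronglyMeasurable hSm)
    (integrable_const _) (fun m => ?_) ?_
  · refine (ae_restrict_iff' hSm).2 (Eventually.of_forall fun x hx => ?_)
    have hb : ∀ t, ‖plateau m a c t * γ t‖ ≤ γ a := fun t => by
      rw [norm_mul, Real.norm_eq_abs, Real.norm_eq_abs, abs_of_nonneg (hγ0 t)]
      exact (mul_le_of_le_one_left (hγ0 t) (abs_plateau_le m a c t)).trans (hγb t)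
    have h1 : ‖∫ t in f x..c, plateau m a c t * γ t‖ ≤ c * γ a := by
      refine (intervalIntegral.norm_integral_le_of_norm_le_const fun t _ => hb t).trans ?_
      have h2 : 0 ≤ f x := hf0 x hx.1
      have h3 : f x < c := hx.2
      rw [abs_of_pos (by linarith), mul_comm]
      exact mul_le_mul_of_nonneg_right (by linarith) (hγ0 a)
    have h4 : ‖Q x‖ ≤ C := hC x ⟨hx.1, (show f x < c from hx.2).le⟩
    calc ‖Φ m x‖ ≤ ‖(k : ℝ) * (∫ t in f x..c, plateau m a c t * γ t)‖ +
          ‖plateau m a c (f x) * γ (f x) * Q x‖ := norm_sub_le _ _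
      _ ≤ _ := by
        rw [norm_mul, norm_mul, Real.norm_natCast]
        gcongr
        exact hb _
  · refine (ae_restrict_iff' hSm).2 (Eventually.of_forall fun x hx => ?_)
    have hxc : f x < c := hx.2
    have h1 := (tendsto_integral_plateau_mul hac hxc.le hγ).const_mul (k : ℝ)
    have h2 := ((tendsto_plateau hac (f x)).mul_const (γ (f x))).mul_const (Q x)
    have h3 : k * ∫ s in (max (f x) a)..c, γ s =
        max (f x) a ^ (-(k : ℝ) / 2) - c ^ (-(k : ℝ) / 2) := by
      rw [← integral_half_rpow (lt_of_lt_of_le ha (le_max_right _ _)) (max_le hxc.le hac.le) hk]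
      congr 1
      refine intervalIntegral.integral_congr fun s hs => ?_
      rw [uIcc_of_le (max_le hxc.le hac.le)] at hs
      simp only [hγdef]
      rw [max_eq_left ((le_max_right _ _).trans hs.1)]
    rw [h3] at h1
    have h4 : (Ico a c).indicator 1 (f x) * γ (f x) * Q x = {x | a ≤ f x}.indicator (fun x =>
        f x ^ (-(k : ℝ) / 2) * ((‖tanPart M x (x - p)‖ ^ 2 -
        f x ^ 2 * ‖tanPart M x ((1 / ‖w‖ ^ 2) • w)‖ ^ 2) / ‖x - p‖ ^ 2)) x := by
      by_cases hax : a ≤ f x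
      · rw [indicator_of_mem (show f x ∈ Ico a c from ⟨hax, hxc⟩),
          indicator_of_mem (show x ∈ {x | a ≤ f x} from hax)]
        have hfx : 0 < f x := ha.trans_le hax
        have hX : ‖x - p‖ ≠ 0 := norm_ne_zero_iff.2 (sub_ne_zero.2 (ne_of_level_pos hfx))
        have hD := (h.denom_pos x hx.1).ne'
        -- The extra power of `f` gained here turns `f^(-k/2-1)` into `f^(-k/2)`.
        have h5 : ‖w‖ ^ 2 / (R ^ 2 - 2 * ⟪x - p, w⟫) = f x / ‖x - p‖ ^ 2 := by
          rw [hf, affineLevel]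
          field_simp
        simp only [hγdef, hQ, Pi.one_apply, max_eq_left hax]
        rw [Real.rpow_sub_one hfx.ne', mul_div_assoc, h5]
        field_simp
      · rw [indicator_of_notMem (fun hmem => hax (mem_Ico.1 hmem).1),
          indicator_of_notMem (show x ∉ {x | a ≤ f x} from hax)]
        simp
    rw [h4] at h2
    exact h1.sub h2

end IsProperMinimal

end VolumeIdentity

end MobiusMonotonicity

namespace MobiusMonotonicity

open Filter

/-! ### Integrability, the volume identity for sublevel sets, and integration by parts over
sublevels -/

section VolumeIdentity

variable {k n : ℕ} {M : Set (E n)} {p w : E n} {R tbar : ℝ}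

/-- The integrand of the volume identity in terms of the affine level function. -/
def affineVolumeIntegrand (k : ℕ) (M : Set (E n)) (p w : E n) (R : ℝ) (x : E n) : ℝ :=
  affineLevel p w R x ^ (-(k : ℝ) / 2) *
    ((‖w‖ ^ 4 * ‖norPart M x (x - p)‖ ^ 2 + affineLevel p w R x ^ 2 * ‖tanPart M x w‖ ^ 2) /
      (‖w‖ ^ 4 * ‖x - p‖ ^ 2))

/-- The first integrand of the weighted identity in terms of the affine level function. -/
def affineWeightedIntegrand (k : ℕ) (M : Set (E n)) (p w : E n) (R : ℝ) (x : E n) : ℝ :=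
  affineLevel p w R x ^ (-((k : ℝ) - 4) / 2) * (‖tanPart M x w‖ ^ 2 / (‖w‖ ^ 4 * ‖x - p‖ ^ 2))

namespace IsProperMinimal

theorem continuousOn_tanPart_sub (h : IsProperMinimal k M p w R tbar) :
    ContinuousOn (fun x => tanPart M x (x - p)) M :=
  h.minimal.isSubmanifold.continuousOn_tanPart (by fun_prop)

theorem continuousOn_norPart_sub (h : IsProperMinimal k M p w R tbar) :
    ContinuousOn (fun x => norPart M x (x - p)) M :=
  ContinuousOn.sub (by fun_prop) h.continuousOn_tanPart_sub

theorem continuousOn_affineVolumeIntegrand (h : IsProperMinimal k M p w R tbar) :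
    ContinuousOn (affineVolumeIntegrand k M p w R) (M \ {p}) := by
  have hsub : M \ {p} ⊆ M := sdiff_subset
  have hf := h.continuousOn_level.mono hsub
  have hw := norm_ne_zero_iff.2 h.ne_zero
  refine ContinuousOn.mul (hf.rpow_const fun x hx => Or.inl
    (affineLevel_pos h.ne_zero (h.denom_pos x hx.1) hx.2).ne') (ContinuousOn.div ?_ ?_ ?_)
  · exact (continuousOn_const.mul ((h.continuousOn_norPart_sub.mono hsub).norm.pow 2)).add
      ((hf.pow 2).mul (((h.minimal.isSubmanifold.continuousOn_tanPart continuousOn_const).mono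
        hsub).norm.pow 2))
  · fun_prop
  · intro x hx
    have : ‖x - p‖ ≠ 0 := norm_ne_zero_iff.2 (sub_ne_zero.2 hx.2)
    positivity

theorem continuousOn_affineWeightedIntegrand (h : IsProperMinimal k M p w R tbar) :
    ContinuousOn (affineWeightedIntegrand k M p w R) (M \ {p}) := by
  have hsub : M \ {p} ⊆ M := sdiff_subset
  have hf := h.continuousOn_level.mono hsub
  have hw := norm_ne_zero_iff.2 h.ne_zero
  refine ContinuousOn.mul (hf.rpow_const fun x hx => Or.inl
    (affineLevel_pos h.ne_zero (h.denom_pos x hx.1) hx.2).ne') (ContinuousOn.div ?_ ?_ ?_)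
  · exact ((h.minimal.isSubmanifold.continuousOn_tanPart continuousOn_const).mono hsub).norm.pow 2
  · fun_prop
  · intro x hx
    have : ‖x - p‖ ≠ 0 := norm_ne_zero_iff.2 (sub_ne_zero.2 hx.2)
    positivity

/-- The closed band is compact, and `a > 0` keeps it away from `p`, where continuity of `g` is not
assumed. -/
theorem integrableOn_between (h : IsProperMinimal k M p w R tbar) {a c : ℝ} (ha : 0 < a)
    (hc : c < tbar) {g : E n → ℝ} (hg : ContinuousOn g (M \ {p})) :
    IntegrableOn g (M ∩ {x | a ≤ affineLevel p w R x ∧ affineLevel p w R x < c}) μHE[k] := by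
  have h1 : IntegrableOn g (M ∩ {x | a ≤ affineLevel p w R x ∧ affineLevel p w R x ≤ c}) μHE[k] := by
    refine h.minimal.isSubmanifold.integrableOn_compact (h.isCompact_between hc) inter_subset_left
      (hg.mono ?_)
    rintro x ⟨hxM, hx⟩
    exact ⟨hxM, ne_of_level_pos (ha.trans_le hx.1)⟩
  exact h1.mono_set fun x hx => ⟨hx.1, hx.2.1, (show affineLevel p w R x < c from hx.2.2).le⟩

theorem integrableOn_tan (h : IsProperMinimal k M p w R tbar) {c : ℝ} (hc : c < tbar) :
    IntegrableOn (fun x => ‖tanPart M x (x - p)‖ ^ 2 / ‖x - p‖ ^ 2)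
      (M ∩ {x | affineLevel p w R x < c}) μHE[k] := by
  have hfin : IsFiniteMeasure ((μHE[k] : Measure (E n)).restrict
      (M ∩ {x | affineLevel p w R x < c})) := ⟨by simpa using h.measure_lt_top hc⟩
  refine Integrable.of_bound (C := 1) ?_ (Eventually.of_forall fun x => ?_)
  · have h1 := ((h.continuousOn_tanPart_sub.norm.pow 2).mono
      (inter_subset_left (t := {x | affineLevel p w R x < c}))).aemeasurable (μ := μHE[k])
      (h.measurableSet_lt c)
    have h2 : Measurable fun x : E n => ‖x - p‖ ^ 2 := by fun_prop
    exact (h1.div h2.aemeasurable).aestronglyMeasurable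
  · rw [Real.norm_eq_abs, abs_of_nonneg (by positivity)]
    refine div_le_one_of_le₀ ?_ (by positivity)
    rw [norm_sq_eq_tanPart_add_norPart M x (x - p)]
    linarith [sq_nonneg ‖norPart M x (x - p)‖]

theorem integrableOn_nor (h : IsProperMinimal k M p w R tbar) {c : ℝ} (hc : c < tbar) :
    IntegrableOn (fun x => ‖norPart M x (x - p)‖ ^ 2 / ‖x - p‖ ^ 2)
      (M ∩ {x | affineLevel p w R x < c}) μHE[k] := by
  have hfin : IsFiniteMeasure ((μHE[k] : Measure (E n)).restrict
      (M ∩ {x | affineLevel p w R x < c})) := ⟨by simpa using h.measure_lt_top hc⟩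
  refine Integrable.of_bound (C := 1) ?_ (Eventually.of_forall fun x => ?_)
  · have h1 := ((h.continuousOn_norPart_sub.norm.pow 2).mono
      (inter_subset_left (t := {x | affineLevel p w R x < c}))).aemeasurable (μ := μHE[k])
      (h.measurableSet_lt c)
    have h2 : Measurable fun x : E n => ‖x - p‖ ^ 2 := by fun_prop
    exact (h1.div h2.aemeasurable).aestronglyMeasurable
  · rw [Real.norm_eq_abs, abs_of_nonneg (by positivity)]
    refine div_le_one_of_le₀ ?_ (by positivity)
    rw [norm_sq_eq_tanPart_add_norPart M x (x - p)]
    linarith [sq_nonneg ‖tanPart M x (x - p)‖]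

/-- On the band, `|(x - p)^⊤|² = |x - p|² - |(x - p)^⊥|²` produces a term `f^(-k/2)` that cancels
the first summand of `integral_sharp_variation`; below `a` that summand is the constant `a^(-k/2)`.
-/
theorem volume_identity (h : IsProperMinimal k M p w R tbar) (hk : 1 ≤ k) {a c : ℝ}
    (ha : 0 < a) (hac : a < c) (hc : c < tbar) :
    c ^ (-(k : ℝ) / 2) * (μHE[k] : Measure (E n)).real (M ∩ {x | affineLevel p w R x < c}) -
      a ^ (-(k : ℝ) / 2) * (μHE[k] : Measure (E n)).real (M ∩ {x | affineLevel p w R x < a}) =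
    ∫ x in M ∩ {x | a ≤ affineLevel p w R x ∧ affineLevel p w R x < c},
      affineVolumeIntegrand k M p w R x ∂μHE[k] := by
  have h0 := h.integral_sharp_variation hk ha hac hc
  set f := affineLevel p w R with hf
  set S := M ∩ {x | f x < c} with hS
  have hSm : MeasurableSet S := h.measurableSet_lt c
  have hfin : IsFiniteMeasure ((μHE[k] : Measure (E n)).restrict S) :=
    ⟨by simpa using h.measure_lt_top hc⟩
  have hlm : MeasurableSet {x : E n | f x < a} :=
    _root_.measurableSet_lt measurable_affineLevel measurable_const
  have hgm : MeasurableSet {x : E n | a ≤ f x} :=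
    _root_.measurableSet_le measurable_const measurable_affineLevel
  have hband : {x | a ≤ f x} ∩ S = M ∩ {x | a ≤ f x ∧ f x < c} := by
    ext x
    exact ⟨fun hx => ⟨hx.2.1, hx.1, hx.2.2⟩, fun hx => ⟨hx.2.1, hx.1, hx.2.2⟩⟩
  have hlow : {x | f x < a} ∩ S = M ∩ {x | f x < a} := by
    ext x
    exact ⟨fun hx => ⟨hx.2.1, hx.1⟩, fun hx => ⟨hx.2, hx.1,
      lt_trans (show f x < a from hx.2) hac⟩⟩
  have hpt : ∀ x ∈ S, ((max (f x) a ^ (-(k : ℝ) / 2) -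
      c ^ (-(k : ℝ) / 2)) - {x | a ≤ f x}.indicator (fun x =>
        f x ^ (-(k : ℝ) / 2) * ((‖tanPart M x (x - p)‖ ^ 2 -
        f x ^ 2 * ‖tanPart M x ((1 / ‖w‖ ^ 2) • w)‖ ^ 2) / ‖x - p‖ ^ 2)) x) =
      ({x | f x < a}.indicator (fun _ => a ^ (-(k : ℝ) / 2)) x - c ^ (-(k : ℝ) / 2)) +
      {x | a ≤ f x}.indicator (affineVolumeIntegrand k M p w R) x := by
    rintro x ⟨hxM, hxc⟩
    by_cases hax : a ≤ f x
    · have hx1 : x ∉ {x | f x < a} := fun hlt => not_lt.2 hax hlt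
      have hx2 : x ∈ {x | a ≤ f x} := hax
      have hfx : 0 < f x := ha.trans_le hax
      have hX : ‖x - p‖ ≠ 0 := norm_ne_zero_iff.2 (sub_ne_zero.2 (ne_of_level_pos hfx))
      have hw := norm_ne_zero_iff.2 h.ne_zero
      rw [indicator_of_mem hx2, indicator_of_mem hx2, indicator_of_notMem hx1, max_eq_left hax]
      have htw : ‖tanPart M x ((1 / ‖w‖ ^ 2) • w)‖ ^ 2 = ‖tanPart M x w‖ ^ 2 / ‖w‖ ^ 4 := by
        rw [tanPart, map_smul, norm_smul, mul_pow, ← tanPart, Real.norm_eq_abs, sq_abs]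
        field_simp
      have hsq := norm_sq_eq_tanPart_add_norPart M x (x - p)
      have hsq' : ‖tanPart M x (x - p)‖ ^ 2 = ‖x - p‖ ^ 2 - ‖norPart M x (x - p)‖ ^ 2 := by
        linarith
      rw [htw, hsq', affineVolumeIntegrand]
      field_simp
      ring
    · have hx1 : x ∈ {x | f x < a} := not_le.1 hax
      have hx2 : x ∉ {x | a ≤ f x} := hax
      rw [indicator_of_notMem hx2, indicator_of_notMem hx2, indicator_of_mem hx1,
        max_eq_right (not_le.1 hax).le]
      ring
  rw [setIntegral_congr_fun hSm hpt, integral_add, integral_sub, integral_indicator hlm,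
    integral_indicator hgm, Measure.restrict_restrict hlm, Measure.restrict_restrict hgm, hband,
    hlow] at h0
  · rw [setIntegral_const, setIntegral_const, smul_eq_mul, smul_eq_mul] at h0
    linarith
  · exact (integrable_const _).indicator hlm
  · exact integrable_const _
  · exact ((integrable_const _).indicator hlm).sub (integrable_const _)
  · rw [integrable_indicator_iff hgm, IntegrableOn, Measure.restrict_restrict hgm, hband]
    exact h.integrableOn_between ha hc h.continuousOn_affineVolumeIntegrand

end IsProperMinimal

/-- Integration by parts for the integrals of `u` over the sublevel sets of `ℓ`. -/
theorem weight_mul_integral_sublevel {α : Type*} [MeasurableSpace α] {μ : Measure α} [SFinite μ]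
    {ℓ u : α → ℝ} (hℓ : Measurable ℓ) (hu : Integrable u μ) {r q : ℝ} (hrq : r ≤ q)
    (hq : ∀ᵐ x ∂μ, ℓ x < q) {G G' : ℝ → ℝ} (hG : ∀ ρ ∈ Icc r q, HasDerivAt G (G' ρ) ρ)
    (hG' : ContinuousOn G' (Icc r q)) :
    IntervalIntegrable (fun ρ => G' ρ * ∫ x in {x | ℓ x < ρ}, u x ∂μ) volume r q ∧
    IntegrableOn (fun x => G (ℓ x) * u x) {x | r ≤ ℓ x} μ ∧
    G q * ∫ x, u x ∂μ - G r * ∫ x in {x | ℓ x < r}, u x ∂μ =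
      (∫ x in {x | r ≤ ℓ x}, G (ℓ x) * u x ∂μ) +
        ∫ ρ in r..q, G' ρ * ∫ x in {x | ℓ x < ρ}, u x ∂μ := by
  have hlm : ∀ ρ, MeasurableSet {x : α | ℓ x < ρ} := fun ρ =>
    measurableSet_lt hℓ measurable_const
  have hgm : MeasurableSet {x : α | r ≤ ℓ x} := measurableSet_le measurable_const hℓ
  have hG'i : IntegrableOn G' (Ioc r q) volume :=
    (hG'.integrableOn_Icc).mono_set Ioc_subset_Icc_self
  -- Fubini for `H`: integrating in `x` first gives `G'(ρ)` times the sublevel integral, integrating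
  -- in `ρ` first gives `(G(q) - G(max r (ℓ x))) u(x)`.
  set H : ℝ × α → ℝ := {z : ℝ × α | ℓ z.2 < z.1}.indicator fun z => G' z.1 * u z.2 with hH
  have hHi : Integrable H ((volume.restrict (Ioc r q)).prod μ) :=
    (Integrable.mul_prod hG'i hu).indicator
      (measurableSet_lt (hℓ.comp measurable_snd) measurable_fst)
  have hinner : ∀ ρ, ∫ x, H (ρ, x) ∂μ = G' ρ * ∫ x in {x | ℓ x < ρ}, u x ∂μ := by
    intro ρ
    rw [← integral_const_mul, ← integral_indicator (hlm ρ)]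
    rfl
  have houter : ∀ᵐ x ∂μ, (∫ ρ in Ioc r q, H (ρ, x)) = G q * u x -
      {x | ℓ x < r}.indicator (fun x => G r * u x) x -
      {x | r ≤ ℓ x}.indicator (fun x => G (ℓ x) * u x) x := by
    filter_upwards [hq] with x hlq
    have hHx : ∀ ρ, H (ρ, x) = (Ioi (ℓ x)).indicator (fun ρ => G' ρ * u x) ρ := fun ρ => rfl
    simp_rw [hHx]
    rw [setIntegral_indicator measurableSet_Ioi, Ioc_inter_Ioi]
    rw [← intervalIntegral.integral_of_le (sup_le hrq hlq.le), intervalIntegral.integral_mul_const,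
      intervalIntegral.integral_eq_sub_of_hasDerivAt (f := G)]
    · by_cases hlr : ℓ x < r
      · rw [indicator_of_mem (show x ∈ {x | ℓ x < r} from hlr),
          indicator_of_notMem (show x ∉ {x | r ≤ ℓ x} from not_le.2 hlr), sup_eq_left.2 hlr.le]
        ring
      · rw [indicator_of_notMem (show x ∉ {x | ℓ x < r} from hlr),
          indicator_of_mem (show x ∈ {x | r ≤ ℓ x} from not_lt.1 hlr), sup_eq_right.2 (not_lt.1 hlr)]
        ring
    · intro ρ hρ
      rw [uIcc_of_le (sup_le hrq hlq.le)] at hρ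
      exact hG ρ ⟨le_sup_left.trans hρ.1, hρ.2⟩
    · refine (hG'.mono ?_).intervalIntegrable
      rw [uIcc_of_le (sup_le hrq hlq.le)]
      exact Icc_subset_Icc_left le_sup_left
  have hlow : Integrable ({x | ℓ x < r}.indicator fun x => G r * u x) μ :=
    (hu.const_mul _).indicator (hlm r)
  have hright : Integrable (fun x => ∫ ρ in Ioc r q, H (ρ, x)) μ := hHi.integral_prod_right
  -- Integrability is read off from `houter`, where this is the only term not yet known to be
  -- integrable.
  have hband : Integrable ({x | r ≤ ℓ x}.indicator fun x => G (ℓ x) * u x) μ := by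
    have := ((hu.const_mul (G q)).sub hlow).sub hright
    refine this.congr ?_
    filter_upwards [houter] with x hx
    simp only [Pi.sub_apply, hx]
    ring
  refine ⟨?_, (integrable_indicator_iff hgm).1 hband, ?_⟩
  · rw [intervalIntegrable_iff_integrableOn_Ioc_of_le hrq]
    exact hHi.integral_prod_left.congr (Eventually.of_forall fun ρ => hinner ρ)
  · have hswap : ∫ ρ in Ioc r q, (∫ x, H (ρ, x) ∂μ) = ∫ x, (∫ ρ in Ioc r q, H (ρ, x)) ∂μ :=
      integral_integral_swap (f := fun ρ x => H (ρ, x)) hHi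
    simp_rw [hinner] at hswap
    rw [integral_congr_ae houter] at hswap
    rw [intervalIntegral.integral_of_le hrq, hswap, integral_sub _ hband, integral_sub _ hlow,
      integral_const_mul, integral_indicator (hlm r), integral_indicator hgm, integral_const_mul]
    · ring
    · exact hu.const_mul _
    · exact (hu.const_mul _).sub hlow

end VolumeIdentity

end MobiusMonotonicity

namespace MobiusMonotonicity

open Filter Metric

/-! ### Minimal submanifolds tangent to the radial field -/

section Radial

variable {k n : ℕ} {M : Set (E n)} {p : E n}

/-- A continuous function on a relatively open subset of a submanifold which vanishes almost
everywhere vanishes identically. -/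
theorem IsSubmanifold.eq_zero_of_ae (hM : IsSubmanifold k M) {O : Set (E n)} (hO : IsOpen O)
    {g : E n → ℝ} (hg : ContinuousOn g (M ∩ O))
    (h0 : ∀ᵐ x ∂(μHE[k] : Measure (E n)).restrict (M ∩ O), g x = 0) {x : E n} (hx : x ∈ M ∩ O) :
    g x = 0 := by
  obtain ⟨Ω, F, h, hL, u, hu, rfl⟩ := hM.exists_lipschitz_param hx.1
  have hopen : IsOpen (Ω ∩ F ⁻¹' O) := h.contDiffOn.continuousOn.isOpen_inter_preimage h.isOpen hO
  have h' := h.mono hopen inter_subset_left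
  obtain ⟨C, hC⟩ := hL.lipschitz
  have hL' := h'.isLipschitzImmersion ⟨C, hC.mono inter_subset_left⟩
  have hsub : F '' (Ω ∩ F ⁻¹' O) ⊆ M ∩ O := by
    rintro _ ⟨v, hv, rfl⟩
    exact ⟨h.mem hv.1, hv.2⟩
  have hae := hL'.ae_comp_of_ae (ae_restrict_of_ae_restrict_of_subset hsub h0)
  have hcont : ContinuousOn (fun v => g (F v)) (Ω ∩ F ⁻¹' O) :=
    hg.comp h'.contDiffOn.continuousOn fun v hv => ⟨h.mem hv.1, hv.2⟩
  exact Measure.eqOn_open_of_ae_eq hae hopen hcont (continuousOn_const (c := (0 : ℝ)))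
    ⟨hu, hx.2⟩

/-- A submanifold tangent to the radial field is invariant under its flow for small times. -/
theorem IsSubmanifold.eventually_radial_mem (hM : IsSubmanifold k M)
    (hrad : ∀ y ∈ M, tanPart M y (y - p) = y - p) {y : E n} (hy : y ∈ M) :
    ∀ᶠ t in 𝓝 (0 : ℝ), p + Real.exp t • (y - p) ∈ M := by
  obtain ⟨Ω, F, h, u₀, hu₀, rfl⟩ := hM y hy
  have hs := h.isSmoothImmersion
  -- The radial field in chart coordinates. Along an integral curve `α` of `v`, `F(α s) - p` solves
  -- `y' = y`, so `exp(-s)(F(α s) - p)` is constant.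
  set v : E k → E k := fun u => ∑ i, (∑ j, (firstFundamentalForm F u)⁻¹ i j *
    ⟪velocity F j u, F u - p⟫) • (EuclideanSpace.single i 1 : E k) with hv
  have hvF : ∀ u ∈ Ω, fderiv ℝ F u (v u) = F u - p := by
    intro u hu
    rw [← hrad _ (h.mem hu), h.tanPart_eq hu, hv, map_sum]
    refine Finset.sum_congr rfl fun i _ => ?_
    rw [map_smul, Finset.sum_smul]
    rfl
  have hvC : ContDiffOn ℝ 1 v Ω := by
    refine ContDiffOn.sum fun i _ => ?_
    refine ContDiffOn.smul (f := fun u => ∑ j, (firstFundamentalForm F u)⁻¹ i j *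
      ⟪velocity F j u, F u - p⟫) (ContDiffOn.sum fun j _ => ?_) contDiffOn_const
    have := ((hs.contDiffOn_inv_firstFundamentalForm i j).mul
      ((hs.contDiffOn_velocity j).inner ℝ (h.contDiffOn.sub (contDiffOn_const (c := p)))))
    exact this.of_le (by exact_mod_cast le_top)
  obtain ⟨α, hα0, ε, hε, hα⟩ :=
    ContDiffAt.exists_forall_mem_closedBall_exists_eq_forall_mem_Ioo_hasDerivAt₀
      (hvC.contDiffAt (h.isOpen.mem_nhds hu₀)) 0
  have hcont : ContinuousAt α 0 := (hα 0 (by constructor <;> linarith)).continuousAt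
  have hmem : ∀ᶠ t in 𝓝 (0 : ℝ), α t ∈ Ω ∧ t ∈ Ioo (0 - ε) (0 + ε) :=
    (hcont.eventually_mem (by rw [hα0]; exact h.isOpen.mem_nhds hu₀)).and
      (Ioo_mem_nhds (by linarith) (by linarith))
  obtain ⟨δ, hδ, hball⟩ := Metric.eventually_nhds_iff_ball.1 hmem
  filter_upwards [ball_mem_nhds (0 : ℝ) hδ] with t ht
  have hd : ∀ s ∈ ball (0 : ℝ) δ,
      HasDerivAt (fun s => Real.exp (-s) • (F (α s) - p)) 0 s := by
    intro s hs
    obtain ⟨h1, h2⟩ := hball s hs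
    have h3 : HasDerivAt (fun s => F (α s) - p) (F (α s) - p) s := by
      have := (h.hasFDerivAt h1).comp_hasDerivAt s (hα s h2)
      rw [hvF _ h1] at this
      exact this.sub_const p
    have h4 : HasDerivAt (fun s => Real.exp (-s)) (-Real.exp (-s)) s := by
      simpa using (hasDerivAt_neg s).exp
    have h5 := h4.smul h3
    rwa [neg_smul, add_neg_cancel] at h5
  have hconst := isOpen_ball.is_const_of_deriv_eq_zero (convex_ball (0 : ℝ) δ).isPreconnected
    (fun s hs => (hd s hs).differentiableAt.differentiableWithinAt) (fun s hs => (hd s hs).deriv)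
    ht (mem_ball_self hδ)
  simp only [neg_zero, Real.exp_zero, one_smul, hα0] at hconst
  have : p + Real.exp t • (F u₀ - p) = F (α t) := by
    rw [← hconst, smul_smul, ← Real.exp_add]
    simp
  rw [this]
  exact h.mem (hball t ht).1

/-- A submanifold tangent to the radial field contains the segments towards the centre, as long
as these stay in a set where it is closed. -/
theorem IsSubmanifold.radial_mem (hM : IsSubmanifold k M)
    (hrad : ∀ y ∈ M, tanPart M y (y - p) = y - p) {U : Set (E n)} (hcl : closure M ∩ U ⊆ M)
    {y : E n} (hy : y ∈ M) (hU : ∀ s ∈ Ioc (0 : ℝ) 1, p + s • (y - p) ∈ U) {s : ℝ}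
    (hs : s ∈ Ioc (0 : ℝ) 1) : p + s • (y - p) ∈ M := by
  -- In exponential time scaling is the radial flow. `T` is open by local invariance and closed in
  -- `(-∞, 0]` by `hcl`, so it contains this half-line.
  set T := {t : ℝ | p + Real.exp t • (y - p) ∈ M} with hT
  have hopen : IsOpen T := by
    rw [isOpen_iff_mem_nhds]
    intro t ht
    have h1 := hM.eventually_radial_mem hrad ht
    have h2 : Tendsto (fun s : ℝ => s - t) (𝓝 t) (𝓝 0) := by
      have : Continuous fun s : ℝ => s - t := by fun_prop
      simpa using this.tendsto t
    filter_upwards [h2.eventually h1] with s hs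
    rw [add_sub_cancel_left, smul_smul, ← Real.exp_add, sub_add_cancel] at hs
    exact hs
  have hsub : Iic (0 : ℝ) ⊆ T := by
    refine isPreconnected_Iic.subset_of_closure_inter_subset hopen ⟨0, self_mem_Iic, ?_⟩ ?_
    · simpa [hT] using hy
    · rintro t ⟨ht, ht0⟩
      refine hcl ⟨?_, hU _ ⟨Real.exp_pos t, Real.exp_le_one_iff.2 ht0⟩⟩
      have hc : Continuous fun t : ℝ => p + Real.exp t • (y - p) := by fun_prop
      exact map_mem_closure (f := fun t : ℝ => p + Real.exp t • (y - p)) hc ht fun t ht => ht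
  have := hsub (show Real.log s ∈ Iic (0 : ℝ) from Real.log_nonpos hs.1.le hs.2)
  simpa [hT, Real.exp_log hs.1] using this

/-- A submanifold tangent to the radial field and orthogonal to `w` which is relatively closed in
an open set meeting the hyperplane through `p` orthogonal to `w` in a ball is a flat disk. -/
theorem IsSubmanifold.isFlatDisk (hM : IsSubmanifold k M) (hne : M.Nonempty)
    (hrad : ∀ y ∈ M, tanPart M y (y - p) = y - p) {w : E n}
    (hw : ∀ y ∈ M, y ≠ p → tanPart M y w = 0) {U : Set (E n)} (hMU : M ⊆ U)
    (hcl : closure M ∩ U ⊆ M) {ρ : ℝ} (hρ : 0 < ρ)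
    (hU : ∀ x, ⟪x - p, w⟫ = 0 → (x ∈ U ↔ ‖x - p‖ < ρ)) :
    p ∈ M ∧ ∃ V : Submodule ℝ (E n), IsFlatDisk k V M ∧ ∀ v ∈ V, ⟪v, w⟫ = 0 := by
  have horth : ∀ y ∈ M, ⟪y - p, w⟫ = 0 := by
    intro y hy
    by_cases hyp : y = p
    · simp [hyp]
    · rw [← hrad y hy, tanPart, Submodule.inner_starProjection_left_eq_right]
      have := hw y hy hyp
      rw [tanPart] at this
      rw [this, inner_zero_right]
  have hlt : ∀ y ∈ M, ‖y - p‖ < ρ := fun y hy => (hU y (horth y hy)).1 (hMU hy)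
  have hseg : ∀ y ∈ M, ∀ s ∈ Ioc (0 : ℝ) 1, p + s • (y - p) ∈ M := by
    intro y hy s hs
    refine hM.radial_mem hrad hcl hy (fun s hs => ?_) hs
    rw [hU, add_sub_cancel_left, norm_smul, Real.norm_eq_abs, abs_of_pos hs.1]
    · exact (mul_le_of_le_one_left (norm_nonneg _) hs.2).trans_lt (hlt y hy)
    · rw [add_sub_cancel_left, real_inner_smul_left, horth y hy, mul_zero]
  have hpM : p ∈ M := by
    obtain ⟨y, hy⟩ := hne
    refine hcl ⟨?_, (hU p (by simp)).2 (by simpa using hρ)⟩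
    have h1 : Tendsto (fun s : ℝ => p + s • (y - p)) (𝓝[>] 0) (𝓝 p) := by
      have : Continuous fun s : ℝ => p + s • (y - p) := by fun_prop
      simpa using (this.tendsto 0).mono_left nhdsWithin_le_nhds
    refine mem_closure_of_tendsto h1 ?_
    filter_upwards [Ioc_mem_nhdsGT (zero_lt_one' ℝ)] with s hs using hseg y hy s hs
  refine ⟨hpM, tangentSpace M p, ?_⟩
  obtain ⟨Ω₀, F₀, h₀, u₀, hu₀, hF₀⟩ := hM p hpM
  have hV : tangentSpace M p = (fderiv ℝ F₀ u₀).range := by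
    rw [← hF₀]
    exact h₀.tangentSpace_eq hu₀
  set V := tangentSpace M p with hVdef
  have hfin : Module.finrank ℝ V = k := by
    rw [hV]
    exact (LinearMap.finrank_range_of_inj (f := (fderiv ℝ F₀ u₀ : E k →ₗ[ℝ] E n))
      (h₀.injective_fderiv u₀ hu₀)).trans finrank_euclideanSpace_fin
  -- The segment from `p` to `x` is a curve in `M` with velocity `x - p` at `p`.
  have hMV : ∀ x ∈ M, x - p ∈ V := by
    intro x hx
    rw [hV]
    refine h₀.mem_range_of_hasDerivWithinAt hu₀ (γ := fun t => p + t • (x - p)) (by simp [hF₀]) ?_ ?_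
    · filter_upwards [Ioc_mem_nhdsGT (zero_lt_one' ℝ)] with s hs using hseg x hx s hs
    · have := ((hasDerivAt_id (0 : ℝ)).smul_const (x - p)).const_add p
      rw [one_smul] at this
      exact this.hasDerivWithinAt
  set T : Set V := {v | p + (v : E n) ∈ M} with hT
  -- Charts of `M` take values in `p + V`, and `V` has dimension `k`, so projecting a chart to `V`
  -- gives a map with bijective derivative, whose image is a neighbourhood.
  have hTopen : IsOpen T := by
    rw [isOpen_iff_mem_nhds]
    intro v hv
    obtain ⟨Ω, F, h, u, hu, hFu⟩ := hM _ hv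
    set Ψ : E k → V := fun u => V.orthogonalProjectionOnto (F u - p) with hΨ
    have hΨF : ∀ u ∈ Ω, (Ψ u : E n) = F u - p := fun u hu =>
      Submodule.starProjection_eq_self_iff.2 (hMV _ (h.mem hu))
    have hder : HasStrictFDerivAt Ψ (V.orthogonalProjectionOnto.comp (fderiv ℝ F u)) u :=
      V.orthogonalProjectionOnto.hasStrictFDerivAt.comp u ((h.hasStrictFDerivAt hu).sub_const p)
    have hrange : ∀ z, V.starProjection (fderiv ℝ F u z) = fderiv ℝ F u z := by
      have h1 : HasFDerivAt (fun u => V.starProjection (F u - p))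
          (V.starProjection.comp (fderiv ℝ F u)) u :=
        V.starProjection.hasFDerivAt.comp u ((h.hasFDerivAt hu).sub_const p)
      have h2 := h1.unique (((h.hasFDerivAt hu).sub_const p).congr_of_eventuallyEq (by
        filter_upwards [h.isOpen.mem_nhds hu] with u hu using hΨF u hu))
      exact fun z => congrArg (fun L : E k →L[ℝ] E n => L z) h2
    have hinj : Function.Injective (V.orthogonalProjectionOnto.comp (fderiv ℝ F u)) := by
      intro z z' hz
      apply h.injective_fderiv u hu
      rw [← hrange z, ← hrange z']
      exact congrArg Subtype.val hz
    have hsurj : Function.Surjective (V.orthogonalProjectionOnto.comp (fderiv ℝ F u)) :=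
      (LinearMap.injective_iff_surjective_of_finrank_eq_finrank
        (f := (V.orthogonalProjectionOnto.comp (fderiv ℝ F u) : E k →ₗ[ℝ] V))
        (by rw [hfin, finrank_euclideanSpace_fin])).1 hinj
    have hmap := hder.map_nhds_eq_of_surj (LinearMap.range_eq_top.2 hsurj)
    have hΨu : Ψ u = v := by
      apply Subtype.ext
      rw [hΨF u hu, hFu, add_sub_cancel_left]
    rw [hΨu] at hmap
    rw [← hmap, mem_map]
    filter_upwards [h.isOpen.mem_nhds hu] with u hu
    change p + (Ψ u : E n) ∈ M
    rw [hΨF u hu, add_sub_cancel]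
    exact h.mem hu
  have h0T : (0 : V) ∈ T := by simpa [hT] using hpM
  -- Since `0` is interior to `T`, a small positive multiple of `v` leads from `p` to a point of
  -- `M`, to which `horth` applies.
  have hVw : ∀ v ∈ V, ⟪v, w⟫ = 0 := by
    intro v hv
    have h1 : Tendsto (fun t : ℝ => t • (⟨v, hv⟩ : V)) (𝓝[>] 0) (𝓝 0) := by
      have : Continuous fun t : ℝ => t • (⟨v, hv⟩ : V) := by fun_prop
      simpa using (this.tendsto 0).mono_left nhdsWithin_le_nhds
    obtain ⟨t, ht, ht0⟩ := ((h1.eventually (hTopen.mem_nhds h0T)).and self_mem_nhdsWithin).exists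
    have h2 := horth _ ht
    simp only [Submodule.coe_smul, add_sub_cancel_left, real_inner_smul_left] at h2
    exact (mul_eq_zero.1 h2).resolve_left (ne_of_gt ht0)
  -- `T` is open, nonempty and relatively closed in the connected ball, the last by `hcl` because
  -- `hU` puts the ball in `U`.
  have hball : ball (0 : V) ρ ⊆ T := by
    refine (convex_ball (0 : V) ρ).isPreconnected.subset_of_closure_inter_subset hTopen
      ⟨0, mem_ball_self hρ, h0T⟩ ?_
    rintro v ⟨hv, hvρ⟩
    refine hcl ⟨?_, (hU _ ?_).2 ?_⟩
    · have hc : Continuous fun v : V => p + (v : E n) := by fun_prop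
      exact map_mem_closure (f := fun v : V => p + (v : E n)) hc hv fun v hv => hv
    · rw [add_sub_cancel_left]
      exact hVw v v.2
    · rw [add_sub_cancel_left]
      simpa using hvρ
  refine ⟨⟨hfin, p, ρ, hρ, ?_⟩, hVw⟩
  ext x
  refine ⟨fun hx => ⟨hMV x hx, hlt x hx⟩, fun hx => ?_⟩
  have := hball (show (⟨x - p, hx.1⟩ : V) ∈ ball (0 : V) ρ by simpa using hx.2)
  simpa [hT] using this

end Radial

end MobiusMonotonicity

namespace MobiusMonotonicity

open Filter

/-! ### The level function of a Möbius transformation -/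

section Level

variable {k n : ℕ} {M : Set (E n)} {φ : Equiv.Perm (OnePoint (E n))} {b p w : E n} {R : ℝ}

/-- The value of the level function on the image of the sphere of radius `ρ`. -/
def sphereLevel (R β ρ : ℝ) : ℝ := R ^ 2 * ρ ^ 2 / (β ^ 2 - ρ ^ 2)

theorem sphereLevel_lt_iff {β ρ r : ℝ} (hR : 0 < R) (hρ0 : 0 ≤ ρ) (hρ : ρ < β) (hr0 : 0 ≤ r)
    (hr : r < β) : sphereLevel R β ρ < sphereLevel R β r ↔ ρ < r := by
  have h1 : 0 < β ^ 2 - ρ ^ 2 := by nlinarith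
  have h2 : 0 < β ^ 2 - r ^ 2 := by nlinarith
  have h3 : 0 < R ^ 2 * β ^ 2 := by
    have : 0 < β := hρ0.trans_lt hρ
    positivity
  rw [sphereLevel, sphereLevel, div_lt_div_iff₀ h1 h2, ← sq_lt_sq₀ hρ0 hr0, ← sub_pos,
    show R ^ 2 * r ^ 2 * (β ^ 2 - ρ ^ 2) - R ^ 2 * ρ ^ 2 * (β ^ 2 - r ^ 2) =
      R ^ 2 * β ^ 2 * (r ^ 2 - ρ ^ 2) by ring, mul_pos_iff_of_pos_left h3, sub_pos]

theorem sphereLevel_pos {β ρ : ℝ} (hR : 0 < R) (hρ0 : 0 < ρ) (hρ : ρ < β) :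
    0 < sphereLevel R β ρ := by
  have h1 : 0 < β ^ 2 - ρ ^ 2 := by nlinarith
  unfold sphereLevel
  positivity

/-- `p` and `w` determine the level function and the images of balls about `0` under `φ`. -/
structure IsLevelModel (φ : Equiv.Perm (OnePoint (E n))) (b : E n) (R : ℝ) (p w : E n) :
    Prop where
  radius_pos : 0 < R
  norm_pos : 0 < ‖b‖
  norm_eq : ‖w‖ = ‖b‖
  radialLevel_lt : ∀ x, 0 < R ^ 2 - 2 * ⟪x - p, w⟫ → radialLevel φ x < ‖b‖
  affineLevel_eq : ∀ x, 0 < R ^ 2 - 2 * ⟪x - p, w⟫ →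
    affineLevel p w R x = sphereLevel R ‖b‖ (radialLevel φ x)
  mem_imageBall : ∀ r, 0 < r → r < ‖b‖ → ∀ x,
    x ∈ imageBall φ r ↔ 0 < R ^ 2 - 2 * ⟪x - p, w⟫ ∧ radialLevel φ x < r

theorem radialLevel_nonneg (φ : Equiv.Perm (OnePoint (E n))) (x : E n) : 0 ≤ radialLevel φ x :=
  norm_nonneg _

/-- Squaring `|φ⁻¹(x)| |x - c| = |b| |x - p|` and using `|x - c|² = |x - p|² + (R²/|b|²) D` gives
`hkey`. This identity is the formula for the level function, and it ties the sign of `D` to that of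
`|b| - |φ⁻¹(x)|`. -/
theorem IsIsometricSphere.isLevelModel (hb0 : b ≠ 0) (hR : 0 < R) (h : IsIsometricSphere φ b R)
    {a : OnePoint (E n)} (ha : a = sphereReflection b R hR ((0 : E n) : OnePoint (E n)))
    (hp : p = finitePart (φ ((0 : E n) : OnePoint (E n))))
    (hw : w = finitePart (φ ∞) - finitePart (φ a)) : IsLevelModel φ b R p w := by
  obtain ⟨hwb, c, hc, hdist, hball⟩ := h.geometry hb0 hR ha hp hw
  have hb : 0 < ‖b‖ := norm_pos_iff.2 hb0
  have hsq : ∀ x, dist x c ^ 2 =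
      ‖x - p‖ ^ 2 + R ^ 2 / ‖b‖ ^ 2 * (R ^ 2 - 2 * ⟪x - p, w⟫) := by
    intro x
    rw [dist_eq_norm, hc, ← sub_sub, norm_sub_sq_real, real_inner_smul_right, norm_smul, mul_pow,
      hwb, Real.norm_eq_abs, sq_abs]
    field_simp
    ring
  -- Hence the half-space `D > 0` avoids `c`, where `hkey` is unavailable.
  have hcD : R ^ 2 - 2 * ⟪c - p, w⟫ = -R ^ 2 := by
    rw [hc, add_sub_cancel_left, real_inner_smul_left, real_inner_self_eq_norm_sq, hwb]
    field_simp
    ring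
  have hkey : ∀ x, x ≠ c → radialLevel φ x ^ 2 * R ^ 2 * (R ^ 2 - 2 * ⟪x - p, w⟫) =
      ‖b‖ ^ 2 * ‖x - p‖ ^ 2 * (‖b‖ ^ 2 - radialLevel φ x ^ 2) := by
    intro x hx
    have h1 := congrArg (fun t => t ^ 2) (hdist x hx)
    simp only [mul_pow, hsq, dist_eq_norm x p] at h1
    field_simp at h1
    linear_combination h1
  have hne : ∀ x, 0 < R ^ 2 - 2 * ⟪x - p, w⟫ → x ≠ c := by
    rintro x hx rfl
    rw [hcD] at hx
    nlinarith [sq_nonneg R]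
  have hlt : ∀ x, 0 < R ^ 2 - 2 * ⟪x - p, w⟫ → radialLevel φ x < ‖b‖ := by
    intro x hx
    have h1 := hkey x (hne x hx)
    have h0 := radialLevel_nonneg φ x
    by_contra hle
    rw [not_lt] at hle
    have h2 : ‖b‖ ^ 2 - radialLevel φ x ^ 2 ≤ 0 := by nlinarith
    have h3 : ‖b‖ ^ 2 * ‖x - p‖ ^ 2 * (‖b‖ ^ 2 - radialLevel φ x ^ 2) ≤ 0 :=
      mul_nonpos_of_nonneg_of_nonpos (by positivity) h2
    have h4 : 0 < radialLevel φ x := hb.trans_le hle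
    have h5 : 0 < radialLevel φ x ^ 2 * R ^ 2 * (R ^ 2 - 2 * ⟪x - p, w⟫) := by positivity
    linarith
  refine ⟨hR, hb, hwb, hlt, fun x hx => ?_, fun r hr0 hr x => ?_⟩
  · have h1 := hlt x hx
    have h0 := radialLevel_nonneg φ x
    have h2 : ‖b‖ ^ 2 - radialLevel φ x ^ 2 ≠ 0 := by nlinarith
    rw [affineLevel, sphereLevel, hwb, div_eq_div_iff hx.ne' h2]
    linear_combination -hkey x (hne x hx)
  · rw [hball]
    refine ⟨fun hx => ⟨?_, hx.2⟩, fun hx => ⟨hne x hx.1, hx.2⟩⟩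
    have h1 := hkey x hx.1
    have h0 := radialLevel_nonneg φ x
    have hxr : radialLevel φ x < r := hx.2
    have h2 : 0 < ‖b‖ ^ 2 - radialLevel φ x ^ 2 := by nlinarith
    by_contra hD
    rw [not_lt] at hD
    have h3 : radialLevel φ x ^ 2 * R ^ 2 * (R ^ 2 - 2 * ⟪x - p, w⟫) ≤ 0 :=
      mul_nonpos_of_nonneg_of_nonpos (by positivity) hD
    by_cases hxp : x = p
    · rw [hxp] at hD
      simp only [sub_self, inner_zero_left, mul_zero, sub_zero] at hD
      nlinarith
    · have h4 : 0 < ‖x - p‖ := norm_pos_iff.2 (sub_ne_zero.2 hxp)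
      have h5 : 0 < ‖b‖ ^ 2 * ‖x - p‖ ^ 2 * (‖b‖ ^ 2 - radialLevel φ x ^ 2) := by positivity
      linarith

namespace IsLevelModel

theorem ne_zero (h : IsLevelModel φ b R p w) : w ≠ 0 := by
  have := h.norm_pos
  rw [← h.norm_eq] at this
  exact norm_pos_iff.1 this

theorem radialLevel_lt_iff (h : IsLevelModel φ b R p w) {r : ℝ} (hr0 : 0 < r) (hr : r < ‖b‖)
    {x : E n} (hx : 0 < R ^ 2 - 2 * ⟪x - p, w⟫) :
    radialLevel φ x < r ↔ affineLevel p w R x < sphereLevel R ‖b‖ r := by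
  rw [h.affineLevel_eq x hx, sphereLevel_lt_iff h.radius_pos (radialLevel_nonneg φ x)
    (h.radialLevel_lt x hx) hr0.le hr]

theorem inter_imageBall (h : IsLevelModel φ b R p w) (hM : ∀ x ∈ M, 0 < R ^ 2 - 2 * ⟪x - p, w⟫)
    {r : ℝ} (hr0 : 0 < r) (hr : r < ‖b‖) :
    M ∩ imageBall φ r = M ∩ {x | affineLevel p w R x < sphereLevel R ‖b‖ r} := by
  ext x
  refine and_congr_right fun hx => ?_
  rw [h.mem_imageBall r hr0 hr, h.radialLevel_lt_iff hr0 hr (hM x hx)]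
  exact ⟨fun hx => hx.2, fun hx' => ⟨hM x hx, hx'⟩⟩

theorem inter_imageBall_sdiff (h : IsLevelModel φ b R p w)
    (hM : ∀ x ∈ M, 0 < R ^ 2 - 2 * ⟪x - p, w⟫) {r q : ℝ} (hr0 : 0 < r) (hrq : r < q)
    (hq : q < ‖b‖) : (M ∩ imageBall φ q) \ imageBall φ r =
      M ∩ {x | sphereLevel R ‖b‖ r ≤ affineLevel p w R x ∧
        affineLevel p w R x < sphereLevel R ‖b‖ q} := by
  rw [h.inter_imageBall hM (hr0.trans hrq) hq]
  ext x
  constructor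
  · rintro ⟨⟨hxM, hxq⟩, hxr⟩
    refine ⟨hxM, not_lt.1 fun hlt => hxr ?_, hxq⟩
    rw [h.mem_imageBall r hr0 (hrq.trans hq)]
    exact ⟨hM x hxM, (h.radialLevel_lt_iff hr0 (hrq.trans hq) (hM x hxM)).2 hlt⟩
  · rintro ⟨hxM, hxr, hxq⟩
    refine ⟨⟨hxM, hxq⟩, fun hx => not_lt.2 hxr ?_⟩
    rw [h.mem_imageBall r hr0 (hrq.trans hq)] at hx
    exact (h.radialLevel_lt_iff hr0 (hrq.trans hq) (hM x hxM)).1 hx.2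

theorem isOpen_imageBall (h : IsLevelModel φ b R p w) {r : ℝ} (hr0 : 0 < r) (hr : r < ‖b‖) :
    IsOpen (imageBall φ r) := by
  have heq : imageBall φ r = {x | 0 < R ^ 2 - 2 * ⟪x - p, w⟫} ∩
      affineLevel p w R ⁻¹' Iio (sphereLevel R ‖b‖ r) := by
    ext x
    rw [h.mem_imageBall r hr0 hr]
    exact and_congr_right fun hx => h.radialLevel_lt_iff hr0 hr hx
  rw [heq]
  exact contDiffOn_affineLevel.continuousOn.isOpen_inter_preimage isOpen_denom_pos isOpen_Iio

/-- Cleared of its denominator, `f ≤ t` is a closed condition. It describes a compact part of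
`closure M`: `D = 0` would force `x = p`, where `D = R²`, and quadratic against linear growth bounds
`x`. For `t` below the level of `r` these points stay in the image ball, hence in `M`. -/
theorem isProperMinimal (h : IsLevelModel φ b R p w) {r : ℝ} (hr0 : 0 < r) (hr : r < ‖b‖)
    (hM : IsMinimalSubmanifold k M) (hsub : M ⊆ imageBall φ r)
    (hcl : closure M ∩ imageBall φ r ⊆ M) :
    IsProperMinimal k M p w R (sphereLevel R ‖b‖ r) := by
  have hD : ∀ x ∈ M, 0 < R ^ 2 - 2 * ⟪x - p, w⟫ := fun x hx =>
    ((h.mem_imageBall r hr0 hr x).1 (hsub hx)).1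
  have hMeq : M = closure M ∩ imageBall φ r := (subset_inter subset_closure hsub).antisymm hcl
  refine ⟨hM, ?_, h.ne_zero, hD, fun t ht => ?_⟩
  · rw [hMeq]
    exact isClosed_closure.measurableSet.inter (h.isOpen_imageBall hr0 hr).measurableSet
  rcases lt_or_ge t 0 with ht0 | ht0
  · have : M ∩ {x | affineLevel p w R x ≤ t} = ∅ := by
      refine eq_empty_of_forall_notMem ?_
      rintro x ⟨hx, hxt⟩
      exact absurd ((affineLevel_nonneg (hD x hx)).trans hxt) (not_le.2 ht0)
    rw [this]
    exact isCompact_empty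
  have hDcl : ∀ x ∈ closure M, 0 ≤ R ^ 2 - 2 * ⟪x - p, w⟫ := by
    have hclosed : IsClosed {x : E n | 0 ≤ R ^ 2 - 2 * ⟪x - p, w⟫} :=
      isClosed_le continuous_const (by fun_prop)
    exact closure_minimal (fun x hx => (hD x hx).le) hclosed
  have heq : M ∩ {x | affineLevel p w R x ≤ t} =
      closure M ∩ {x | ‖w‖ ^ 2 * ‖x - p‖ ^ 2 ≤ t * (R ^ 2 - 2 * ⟪x - p, w⟫)} := by
    ext x
    constructor
    · rintro ⟨hx, hxt⟩
      exact ⟨subset_closure hx, (div_le_iff₀ (hD x hx)).1 hxt⟩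
    · rintro ⟨hx, hxt⟩
      have hDx : 0 < R ^ 2 - 2 * ⟪x - p, w⟫ := by
        refine (hDcl x hx).lt_of_ne fun h0 => ?_
        rw [mem_ofPred_eq, ← h0, mul_zero] at hxt
        have hw := norm_pos_iff.2 h.ne_zero
        have h1 : ‖x - p‖ ^ 2 ≤ 0 := by
          by_contra hpos
          rw [not_le] at hpos
          nlinarith [mul_pos (pow_pos hw 2) hpos]
        have h2 : x - p = 0 := by
          rw [← norm_eq_zero]
          nlinarith [norm_nonneg (x - p)]
        rw [h2, inner_zero_left, mul_zero, sub_zero] at h0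
        exact (pow_pos h.radius_pos 2).ne h0
      have hle : affineLevel p w R x ≤ t := (div_le_iff₀ hDx).2 hxt
      refine ⟨hcl ⟨hx, (h.mem_imageBall r hr0 hr x).2 ⟨hDx, ?_⟩⟩, hle⟩
      exact (h.radialLevel_lt_iff hr0 hr hDx).2 (hle.trans_lt ht)
  rw [heq]
  refine Metric.isCompact_of_isClosed_isBounded
    (isClosed_closure.inter (isClosed_le (by fun_prop) (by fun_prop))) ?_
  -- With `X = |x - p||w|`, Cauchy–Schwarz gives `X² ≤ t(R² + 2X)`, that is `(X - t)² ≤ t R² + t²`.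
  refine (Metric.isBounded_closedBall (x := p)
    (r := (t + √(t * R ^ 2 + t ^ 2)) / ‖w‖)).subset ?_
  rintro x ⟨-, hx⟩
  have hw := norm_pos_iff.2 h.ne_zero
  rw [Metric.mem_closedBall, dist_eq_norm, le_div_iff₀ hw]
  have h1 : -(‖x - p‖ * ‖w‖) ≤ ⟪x - p, w⟫ := (abs_le.1 (abs_real_inner_le_norm _ _)).1
  have h2 : (‖x - p‖ * ‖w‖ - t) ^ 2 ≤ t * R ^ 2 + t ^ 2 := by
    rw [mem_ofPred_eq] at hx
    nlinarith [mul_le_mul_of_nonneg_left h1 ht0]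
  linarith [Real.le_sqrt_of_sq_le h2]

end IsLevelModel

end Level

end MobiusMonotonicity

namespace MobiusMonotonicity

open Filter

/-! ### The monotonicity formulas -/

section Weight

variable {k : ℕ} {R β ρ : ℝ}

/-- The source of the factor `R^k` in both monotonicity formulas. -/
theorem weight_eq (hR : 0 < R) (hρ0 : 0 < ρ) (hρ : ρ < β) :
    ((β ^ 2 - ρ ^ 2) / ρ ^ 2) ^ ((k : ℝ) / 2) = R ^ k * sphereLevel R β ρ ^ (-(k : ℝ) / 2) := by
  have h1 : 0 < β ^ 2 - ρ ^ 2 := by nlinarith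
  have h2 : sphereLevel R β ρ = R ^ 2 * ((β ^ 2 - ρ ^ 2) / ρ ^ 2)⁻¹ := by
    rw [sphereLevel, inv_div, mul_div_assoc]
  have h3 : (R ^ 2) ^ (-(k : ℝ) / 2) = (R ^ k)⁻¹ := by
    rw [← Real.rpow_natCast, ← Real.rpow_mul hR.le, ← Real.rpow_natCast, ← Real.rpow_neg hR.le]
    congr 1
    push_cast
    ring
  rw [h2, Real.mul_rpow (by positivity) (by positivity), h3, Real.inv_rpow (by positivity),
    neg_div, Real.rpow_neg (by positivity), inv_inv]
  have : R ^ k ≠ 0 := by positivity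
  field_simp

theorem hasDerivAt_weight (hρ0 : 0 < ρ) (hρ : ρ < β) :
    HasDerivAt (fun ρ : ℝ => ((β ^ 2 - ρ ^ 2) / ρ ^ 2) ^ ((k : ℝ) / 2))
      (-(k * β ^ 2) * ((β ^ 2 - ρ ^ 2) ^ (((k : ℝ) - 2) / 2) / ρ ^ (k + 1))) ρ := by
  have h1 : 0 < β ^ 2 - ρ ^ 2 := by nlinarith
  have h2 : 0 < (β ^ 2 - ρ ^ 2) / ρ ^ 2 := by positivity
  have h3 : HasDerivAt (fun ρ : ℝ => (β ^ 2 - ρ ^ 2) / ρ ^ 2) (-2 * β ^ 2 / ρ ^ 3) ρ := by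
    have h4 := ((hasDerivAt_pow 2 ρ).const_sub (β ^ 2)).div (hasDerivAt_pow 2 ρ)
      (pow_ne_zero 2 hρ0.ne')
    refine h4.congr_deriv ?_
    field_simp
    push_cast
    ring
  refine (h3.rpow_const (p := (k : ℝ) / 2) (Or.inl h2.ne')).congr_deriv ?_
  have h5 : (k : ℝ) / 2 - 1 = ((k : ℝ) - 2) / 2 := by ring
  have h6 : (ρ ^ 2) ^ (((k : ℝ) - 2) / 2) = ρ ^ k / ρ ^ 2 := by
    rw [← Real.rpow_natCast, ← Real.rpow_mul hρ0.le,
      show ((2 : ℕ) : ℝ) * (((k : ℝ) - 2) / 2) = (k : ℝ) - (2 : ℕ) by push_cast; ring,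
      Real.rpow_sub hρ0, Real.rpow_natCast, Real.rpow_natCast]
  rw [h5, Real.div_rpow h1.le (by positivity), h6]
  field_simp
  ring

/-- The inverse of `sphereLevel`. -/
def sphereRadius (R β t : ℝ) : ℝ := β * √(t / (R ^ 2 + t))

theorem measurable_sphereRadius : Measurable (sphereRadius R β) := by
  unfold sphereRadius
  fun_prop

theorem sphereRadius_sphereLevel (hR : 0 < R) (hρ0 : 0 ≤ ρ) (hρ : ρ < β) :
    sphereRadius R β (sphereLevel R β ρ) = ρ := by
  have hβ : 0 < β := hρ0.trans_lt hρ
  have h1 : 0 < β ^ 2 - ρ ^ 2 := by nlinarith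
  have h2 : sphereLevel R β ρ / (R ^ 2 + sphereLevel R β ρ) = (ρ / β) ^ 2 := by
    have : R ^ 2 + R ^ 2 * ρ ^ 2 / (β ^ 2 - ρ ^ 2) ≠ 0 := by positivity
    rw [sphereLevel, div_pow]
    field_simp
    ring
  rw [sphereRadius, h2, Real.sqrt_sq (by positivity)]
  field_simp

end Weight

/-! ### The formulas for minimal submanifolds of the image ball -/

section Monotonicity

variable {k n : ℕ} {M : Set (E n)} {φ : Equiv.Perm (OnePoint (E n))} {b p w : E n} {R rbar : ℝ}

theorem euclideanHausdorffMeasure_singleton (hk : 1 ≤ k) (x : E n) :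
    (μHE[k] : Measure (E n)) {x} = 0 := by
  have hk' : (0 : ℝ) < k := by exact_mod_cast hk
  have := Measure.nullSingletonClass_hausdorff (E n) hk'
  rw [Measure.euclideanHausdorffMeasure_def, Measure.smul_apply, measure_singleton, smul_zero]

/-- A minimal submanifold inside `φ(B_rbar)`, with compact intersections with the closed balls. -/
structure IsMobiusMinimal (k : ℕ) (φ : Equiv.Perm (OnePoint (E n))) (b : E n) (R : ℝ) (p w : E n)
    (rbar : ℝ) (M : Set (E n)) : Prop where
  model : IsLevelModel φ b R p w
  pos : 0 < rbar
  lt : rbar < ‖b‖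
  proper : IsProperMinimal k M p w R (sphereLevel R ‖b‖ rbar)
  subset : M ⊆ imageBall φ rbar
  closure_subset : closure M ∩ imageBall φ rbar ⊆ M

theorem affineVolumeIntegrand_nonneg {x : E n} (hx : 0 < R ^ 2 - 2 * ⟪x - p, w⟫) :
    0 ≤ affineVolumeIntegrand k M p w R x :=
  mul_nonneg (Real.rpow_nonneg (affineLevel_nonneg hx) _) (by positivity)

theorem affineWeightedIntegrand_nonneg {x : E n} (hx : 0 < R ^ 2 - 2 * ⟪x - p, w⟫) :
    0 ≤ affineWeightedIntegrand k M p w R x :=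
  mul_nonneg (Real.rpow_nonneg (affineLevel_nonneg hx) _) (by positivity)

namespace IsMobiusMinimal

theorem sphereLevel_lt (h : IsMobiusMinimal k φ b R p w rbar M) {r q : ℝ} (hr : 0 ≤ r)
    (hrq : r < q) (hq : q ≤ rbar) : sphereLevel R ‖b‖ r < sphereLevel R ‖b‖ q :=
  (sphereLevel_lt_iff h.model.radius_pos hr (hrq.trans_le (hq.trans h.lt.le)) (hr.trans hrq.le)
    (hq.trans_lt h.lt)).2 hrq

theorem levelFun_eq (h : IsMobiusMinimal k φ b R p w rbar M) {x : E n} (hx : x ∈ M) :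
    levelFun φ b R x = affineLevel p w R x :=
  (h.model.affineLevel_eq x (h.proper.denom_pos x hx)).symm

theorem volumeIntegrand_eq (h : IsMobiusMinimal k φ b R p w rbar M) {x : E n} (hx : x ∈ M) :
    volumeIntegrand k φ b R p w M x = affineVolumeIntegrand k M p w R x := by
  rw [volumeIntegrand, h.levelFun_eq hx, affineVolumeIntegrand, h.model.norm_eq]

theorem weightedIntegrand_eq (h : IsMobiusMinimal k φ b R p w rbar M) {x : E n} (hx : x ∈ M) :
    weightedIntegrand k φ b R p w M x = affineWeightedIntegrand k M p w R x := by
  rw [weightedIntegrand, h.levelFun_eq hx, affineWeightedIntegrand, h.model.norm_eq]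

theorem inter_imageBall (h : IsMobiusMinimal k φ b R p w rbar M) {r : ℝ} (hr0 : 0 < r)
    (hr : r < rbar) :
    M ∩ imageBall φ r = M ∩ {x | affineLevel p w R x < sphereLevel R ‖b‖ r} :=
  h.model.inter_imageBall h.proper.denom_pos hr0 (hr.trans h.lt)

theorem band_eq (h : IsMobiusMinimal k φ b R p w rbar M) {r q : ℝ} (hr0 : 0 < r)
    (hrq : r < q) (hq : q < rbar) : (M ∩ imageBall φ q) \ imageBall φ r =
      M ∩ {x | sphereLevel R ‖b‖ r ≤ affineLevel p w R x ∧
        affineLevel p w R x < sphereLevel R ‖b‖ q} :=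
  h.model.inter_imageBall_sdiff h.proper.denom_pos hr0 hrq (hq.trans h.lt)

theorem measurableSet_band (h : IsMobiusMinimal k φ b R p w rbar M) {r q : ℝ} (hr0 : 0 < r)
    (hrq : r < q) (hq : q < rbar) : MeasurableSet ((M ∩ imageBall φ q) \ imageBall φ r) := by
  rw [h.band_eq hr0 hrq hq]
  exact h.proper.measurableSet_between _ _

theorem finiteness (h : IsMobiusMinimal k φ b R p w rbar M) {r : ℝ} (hr0 : 0 < r)
    (hr : r < rbar) : μHE[k] (M ∩ imageBall φ r) < ⊤ ∧
      IntegrableOn (fun x => ‖tanPart M x (x - p)‖ ^ 2 / ‖x - p‖ ^ 2) (M ∩ imageBall φ r) μHE[k] ∧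
      IntegrableOn (fun x => ‖norPart M x (x - p)‖ ^ 2 / ‖x - p‖ ^ 2)
        (M ∩ imageBall φ r) μHE[k] := by
  have hlt := h.sphereLevel_lt hr0.le hr le_rfl
  rw [h.inter_imageBall hr0 hr]
  exact ⟨h.proper.measure_lt_top hlt, h.proper.integrableOn_tan hlt, h.proper.integrableOn_nor hlt⟩

theorem integrableOn_volumeIntegrand (h : IsMobiusMinimal k φ b R p w rbar M) {r q : ℝ}
    (hr0 : 0 < r) (hrq : r < q) (hq : q < rbar) :
    IntegrableOn (volumeIntegrand k φ b R p w M) ((M ∩ imageBall φ q) \ imageBall φ r) μHE[k] := by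
  have hi := h.proper.integrableOn_between
    (sphereLevel_pos h.model.radius_pos hr0 ((hrq.trans hq).trans h.lt))
    (h.sphereLevel_lt (hr0.trans hrq).le hq le_rfl) h.proper.continuousOn_affineVolumeIntegrand
  rw [← h.band_eq hr0 hrq hq] at hi
  exact hi.congr_fun (fun x hx => (h.volumeIntegrand_eq hx.1.1).symm)
    (h.measurableSet_band hr0 hrq hq)

theorem integrableOn_weightedIntegrand (h : IsMobiusMinimal k φ b R p w rbar M) {r q : ℝ}
    (hr0 : 0 < r) (hrq : r < q) (hq : q < rbar) :
    IntegrableOn (weightedIntegrand k φ b R p w M) ((M ∩ imageBall φ q) \ imageBall φ r) μHE[k] := by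
  have hi := h.proper.integrableOn_between
    (sphereLevel_pos h.model.radius_pos hr0 ((hrq.trans hq).trans h.lt))
    (h.sphereLevel_lt (hr0.trans hrq).le hq le_rfl) h.proper.continuousOn_affineWeightedIntegrand
  rw [← h.band_eq hr0 hrq hq] at hi
  exact hi.congr_fun (fun x hx => (h.weightedIntegrand_eq hx.1.1).symm)
    (h.measurableSet_band hr0 hrq hq)

theorem volumeJ_sub (h : IsMobiusMinimal k φ b R p w rbar M) (hk : 1 ≤ k) {r q : ℝ}
    (hr0 : 0 < r) (hrq : r < q) (hq : q < rbar) :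
    volumeJ k φ b M q - volumeJ k φ b M r = R ^ k * ∫ x in (M ∩ imageBall φ q) \ imageBall φ r,
      volumeIntegrand k φ b R p w M x ∂μHE[k] := by
  have hq0 := hr0.trans hrq
  have hr := hrq.trans hq
  rw [setIntegral_congr_fun (h.measurableSet_band hr0 hrq hq)
    fun x hx => h.volumeIntegrand_eq hx.1.1, h.band_eq hr0 hrq hq,
    ← h.proper.volume_identity hk (sphereLevel_pos h.model.radius_pos hr0 (hr.trans h.lt))
      (h.sphereLevel_lt hr0.le hrq hq.le) (h.sphereLevel_lt hq0.le hq le_rfl),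
    volumeJ, volumeJ, weight_eq h.model.radius_pos hq0 (hq.trans h.lt),
    weight_eq h.model.radius_pos hr0 (hr.trans h.lt), h.inter_imageBall hq0 hq,
    h.inter_imageBall hr0 hr]
  ring

/-- The weighted quantity is the volume quantity minus the weighted integral of the normal part. -/
theorem weightedI_eq (h : IsMobiusMinimal k φ b R p w rbar M) (hk : 1 ≤ k) {r : ℝ}
    (hr0 : 0 < r) (hr : r < rbar) :
    weightedI k φ b p M r = volumeJ k φ b M r - ((‖b‖ ^ 2 - r ^ 2) / r ^ 2) ^ ((k : ℝ) / 2) *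
      ∫ x in M ∩ imageBall φ r, ‖norPart M x (x - p)‖ ^ 2 / ‖x - p‖ ^ 2 ∂μHE[k] := by
  obtain ⟨hfin, -, hnor⟩ := h.finiteness hr0 hr
  have hint : ∫ x in M ∩ imageBall φ r, ‖tanPart M x (x - p)‖ ^ 2 / ‖x - p‖ ^ 2 ∂μHE[k] =
      ∫ x in M ∩ imageBall φ r, (1 - ‖norPart M x (x - p)‖ ^ 2 / ‖x - p‖ ^ 2) ∂μHE[k] := by
    refine integral_congr_ae ?_
    -- At `x = p` both quotients are `0/0 = 0` and do not add up to `1`; a point is a null set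
    -- because `k ≥ 1`.
    have hne : ∀ᵐ x ∂(μHE[k] : Measure (E n)).restrict (M ∩ imageBall φ r), x ≠ p := by
      refine ae_restrict_of_ae ?_
      rw [ae_iff]
      simpa using euclideanHausdorffMeasure_singleton hk p
    filter_upwards [hne] with x hx
    have hX : ‖x - p‖ ^ 2 ≠ 0 := pow_ne_zero 2 (norm_ne_zero_iff.2 (sub_ne_zero.2 hx))
    have hsq := norm_sq_eq_tanPart_add_norPart M x (x - p)
    rw [eq_sub_iff_add_eq, ← add_div, ← hsq, div_self hX]
  have hone : IntegrableOn (fun _ => (1 : ℝ)) (M ∩ imageBall φ r) μHE[k] :=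
    integrableOn_const hfin.ne
  rw [weightedI, volumeJ, hint, integral_sub hone hnor, setIntegral_const, smul_eq_mul]
  ring

/-- By `weightedI_eq`, `I` is `J` minus a weight `G` times a sublevel integral. Integrating that
product by parts, the decreasing `G` yields the radial term, and its pointwise part removes the
normal component from the volume integrand. -/
theorem weightedI_sub (h : IsMobiusMinimal k φ b R p w rbar M) (hk : 1 ≤ k) {r q : ℝ}
    (hr0 : 0 < r) (hrq : r < q) (hq : q < rbar) :
    IntervalIntegrable (radialIntegrand k φ b p M) volume r q ∧
    weightedI k φ b p M q - weightedI k φ b p M r =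
      R ^ k * (∫ x in (M ∩ imageBall φ q) \ imageBall φ r,
        weightedIntegrand k φ b R p w M x ∂μHE[k]) +
      k * ‖b‖ ^ 2 * ∫ ρ in r..q, radialIntegrand k φ b p M ρ := by
  have hq0 := hr0.trans hrq
  have hr := hrq.trans hq
  have hR := h.model.radius_pos
  have hk' : (k : ℝ) * ‖b‖ ^ 2 ≠ 0 := by
    have : (0 : ℝ) < k := by exact_mod_cast hk
    have := h.model.norm_pos
    positivity
  obtain ⟨hfin, -, hnor⟩ := h.finiteness hq0 hq
  set S := M ∩ imageBall φ q with hS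
  have hSm : MeasurableSet S := by
    rw [hS, h.inter_imageBall hq0 hq]
    exact h.proper.measurableSet_lt _
  set μ := (μHE[k] : Measure (E n)).restrict S with hμ
  have hμfin : IsFiniteMeasure μ := ⟨by simpa [hμ] using hfin⟩
  set u : E n → ℝ := fun x => ‖norPart M x (x - p)‖ ^ 2 / ‖x - p‖ ^ 2 with hu
  -- A function that is visibly measurable on the whole space and agrees with `|φ⁻¹|` on `M`.
  set ℓ : E n → ℝ := fun x => sphereRadius R ‖b‖ (affineLevel p w R x) with hℓ
  have hℓm : Measurable ℓ := measurable_sphereRadius.comp measurable_affineLevel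
  have hℓM : ∀ x ∈ M, ℓ x = radialLevel φ x := fun x hx => by
    have hD := h.proper.denom_pos x hx
    simp only [hℓ]
    rw [h.model.affineLevel_eq x hD, sphereRadius_sphereLevel hR (radialLevel_nonneg φ x)
      (h.model.radialLevel_lt x hD)]
  have hmem : ∀ ρ, 0 < ρ → ρ < rbar → ∀ x ∈ M, (x ∈ imageBall φ ρ ↔ ℓ x < ρ) := by
    intro ρ hρ0 hρ x hx
    rw [h.model.mem_imageBall ρ hρ0 (hρ.trans h.lt), hℓM x hx]
    exact and_iff_right (h.proper.denom_pos x hx)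
  have hset : ∀ ρ, 0 < ρ → ρ ≤ q → {x | ℓ x < ρ} ∩ S = M ∩ imageBall φ ρ := by
    intro ρ hρ0 hρ
    ext x
    refine ⟨fun hx => ⟨hx.2.1, (hmem ρ hρ0 (hρ.trans_lt hq) x hx.2.1).2 hx.1⟩, fun hx => ?_⟩
    have h1 := (hmem ρ hρ0 (hρ.trans_lt hq) x hx.1).1 hx.2
    exact ⟨h1, hx.1, (hmem q hq0 hq x hx.1).2 (h1.trans_le hρ)⟩
  have hband : {x | r ≤ ℓ x} ∩ S = S \ imageBall φ r := by
    ext x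
    refine ⟨fun hx => ⟨hx.2, fun hxr => ?_⟩, fun hx => ⟨?_, hx.1⟩⟩
    · exact not_lt.2 (show r ≤ ℓ x from hx.1) ((hmem r hr0 hr x hx.2.1).1 hxr)
    · exact not_lt.1 fun hlt => hx.2 ((hmem r hr0 hr x hx.1.1).2 hlt)
  have hN : ∀ ρ, 0 < ρ → ρ ≤ q → ∫ x in {x | ℓ x < ρ}, u x ∂μ =
      ∫ x in M ∩ imageBall φ ρ, u x ∂μHE[k] := by
    intro ρ hρ0 hρ
    rw [hμ, Measure.restrict_restrict (measurableSet_lt hℓm measurable_const), hset ρ hρ0 hρ]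
  set G : ℝ → ℝ := fun ρ => ((‖b‖ ^ 2 - ρ ^ 2) / ρ ^ 2) ^ ((k : ℝ) / 2) with hG
  set G' : ℝ → ℝ := fun ρ =>
    -(k * ‖b‖ ^ 2) * ((‖b‖ ^ 2 - ρ ^ 2) ^ (((k : ℝ) - 2) / 2) / ρ ^ (k + 1)) with hG'
  have hGd : ∀ ρ ∈ Icc r q, HasDerivAt G (G' ρ) ρ := fun ρ hρ =>
    hasDerivAt_weight (hr0.trans_le hρ.1) ((hρ.2.trans_lt hq).trans h.lt)
  have hG'c : ContinuousOn G' (Icc r q) := by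
    refine continuousOn_const.mul (ContinuousOn.div ?_ (by fun_prop) fun ρ hρ =>
      pow_ne_zero _ (hr0.trans_le hρ.1).ne')
    refine ContinuousOn.rpow_const (by fun_prop) fun ρ hρ => Or.inl ?_
    have h1 := hr0.trans_le hρ.1
    have h2 := (hρ.2.trans_lt hq).trans h.lt
    nlinarith
  have hSq : ∀ᵐ x ∂μ, ℓ x < q := (ae_restrict_iff' hSm).2 (Eventually.of_forall fun x hx =>
    (hmem q hq0 hq x hx.1).1 hx.2)
  obtain ⟨hI1, hI2, hI3⟩ := weight_mul_integral_sublevel hℓm (μ := μ) hnor hrq.le hSq hGd hG'c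
  have hrad : ∀ ρ ∈ Icc r q, G' ρ * ∫ x in {x | ℓ x < ρ}, u x ∂μ =
      -(k * ‖b‖ ^ 2) * radialIntegrand k φ b p M ρ := by
    intro ρ hρ
    rw [hN ρ (hr0.trans_le hρ.1) hρ.2, radialIntegrand]
    simp only [hG', hu]
    ring
  have hgm : MeasurableSet {x : E n | r ≤ ℓ x} := measurableSet_le measurable_const hℓm
  rw [IntegrableOn, hμ, Measure.restrict_restrict hgm, hband] at hI2
  rw [hN r hr0 hrq.le,
    intervalIntegral.integral_congr (g := fun ρ => -(k * ‖b‖ ^ 2) * radialIntegrand k φ b p M ρ)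
      (fun ρ hρ => hrad ρ (by rwa [uIcc_of_le hrq.le] at hρ)),
    intervalIntegral.integral_const_mul, hμ, Measure.restrict_restrict hgm, hband] at hI3
  -- Here `G (ℓ x) = R^k f^(-k/2)`, so subtracting cancels the normal term; `f^(-k/2) f² =
  -- f^(-(k-4)/2)` remains.
  have hpt : ∀ x ∈ S \ imageBall φ r, R ^ k * weightedIntegrand k φ b R p w M x =
      R ^ k * volumeIntegrand k φ b R p w M x - G (ℓ x) * u x := by
    rintro x ⟨hxS, hxr⟩
    have hD := h.proper.denom_pos x hxS.1
    have hlr : r ≤ ℓ x := not_lt.1 fun hlt => hxr ((hmem r hr0 hr x hxS.1).2 hlt)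
    have hlq : ℓ x < q := (hmem q hq0 hq x hxS.1).1 hxS.2
    have hf : affineLevel p w R x = sphereLevel R ‖b‖ (ℓ x) := by
      rw [hℓM x hxS.1, h.model.affineLevel_eq x hD]
    have hf0 : 0 < affineLevel p w R x := by
      rw [hf]
      exact sphereLevel_pos hR (hr0.trans_le hlr) ((hlq.trans hq).trans h.lt)
    have hX : ‖x - p‖ ≠ 0 := norm_ne_zero_iff.2 (sub_ne_zero.2 (IsProperMinimal.ne_of_level_pos hf0))
    have hw := norm_ne_zero_iff.2 h.model.ne_zero
    have hpow : affineLevel p w R x ^ (-((k : ℝ) - 4) / 2) =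
        affineLevel p w R x ^ (-(k : ℝ) / 2) * affineLevel p w R x ^ 2 := by
      rw [← Real.rpow_natCast, ← Real.rpow_add hf0]
      congr 1
      push_cast
      ring
    rw [h.weightedIntegrand_eq hxS.1, h.volumeIntegrand_eq hxS.1]
    simp only [hG, hu]
    rw [weight_eq hR (hr0.trans_le hlr) ((hlq.trans hq).trans h.lt), ← hf, affineWeightedIntegrand,
      affineVolumeIntegrand, hpow]
    field_simp
    ring
  have hvol := h.integrableOn_volumeIntegrand hr0 hrq hq
  have hJ := h.volumeJ_sub hk hr0 hrq hq
  have hbm := h.measurableSet_band hr0 hrq hq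
  refine ⟨?_, ?_⟩
  · have h1 := (hI1.congr (fun ρ hρ => hrad ρ (by
      rw [uIoc_of_le hrq.le] at hρ
      exact Ioc_subset_Icc_self hρ))).const_mul (-(k * ‖b‖ ^ 2))⁻¹
    refine h1.congr fun ρ _ => ?_
    simp only [← mul_assoc]
    rw [inv_mul_cancel₀ (neg_ne_zero.2 hk'), one_mul]
  · have hw : R ^ k * (∫ x in S \ imageBall φ r, weightedIntegrand k φ b R p w M x ∂μHE[k]) =
        R ^ k * (∫ x in S \ imageBall φ r, volumeIntegrand k φ b R p w M x ∂μHE[k]) -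
          ∫ x in S \ imageBall φ r, G (ℓ x) * u x ∂μHE[k] := by
      rw [← integral_const_mul, setIntegral_congr_fun hbm hpt,
        integral_sub (hvol.const_mul _) hI2, integral_const_mul]
    rw [h.weightedI_eq hk hq0 hq, h.weightedI_eq hk hr0 hr, hw]
    linarith

theorem radialIntegrand_nonneg {ρ : ℝ} (hρ0 : 0 ≤ ρ) (hρ : ρ ≤ ‖b‖) :
    0 ≤ radialIntegrand k φ b p M ρ := by
  have h1 : 0 ≤ ‖b‖ ^ 2 - ρ ^ 2 := by nlinarith
  exact mul_nonneg (div_nonneg (Real.rpow_nonneg h1 _) (pow_nonneg hρ0 _))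
    (integral_nonneg fun x => by positivity)

theorem volumeIntegrand_nonneg (h : IsMobiusMinimal k φ b R p w rbar M) {x : E n} (hx : x ∈ M) :
    0 ≤ volumeIntegrand k φ b R p w M x := by
  rw [h.volumeIntegrand_eq hx]
  exact affineVolumeIntegrand_nonneg (h.proper.denom_pos x hx)

theorem weightedIntegrand_nonneg (h : IsMobiusMinimal k φ b R p w rbar M) {x : E n}
    (hx : x ∈ M) : 0 ≤ weightedIntegrand k φ b R p w M x := by
  rw [h.weightedIntegrand_eq hx]
  exact affineWeightedIntegrand_nonneg (h.proper.denom_pos x hx)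

theorem integral_volumeIntegrand_nonneg (h : IsMobiusMinimal k φ b R p w rbar M) {r q : ℝ}
    (hr0 : 0 < r) (hrq : r < q) (hq : q < rbar) :
    0 ≤ ∫ x in (M ∩ imageBall φ q) \ imageBall φ r, volumeIntegrand k φ b R p w M x ∂μHE[k] :=
  setIntegral_nonneg (h.measurableSet_band hr0 hrq hq) fun _ hx => h.volumeIntegrand_nonneg hx.1.1

theorem integral_weightedIntegrand_nonneg (h : IsMobiusMinimal k φ b R p w rbar M) {r q : ℝ}
    (hr0 : 0 < r) (hrq : r < q) (hq : q < rbar) :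
    0 ≤ ∫ x in (M ∩ imageBall φ q) \ imageBall φ r, weightedIntegrand k φ b R p w M x ∂μHE[k] :=
  setIntegral_nonneg (h.measurableSet_band hr0 hrq hq)
    fun _ hx => h.weightedIntegrand_nonneg hx.1.1

theorem integral_radialIntegrand_nonneg (h : IsMobiusMinimal k φ b R p w rbar M) {r q : ℝ}
    (hr0 : 0 < r) (hrq : r < q) (hq : q < rbar) :
    0 ≤ ∫ ρ in r..q, radialIntegrand k φ b p M ρ :=
  intervalIntegral.integral_nonneg hrq.le fun _ hρ => radialIntegrand_nonneg (hr0.le.trans hρ.1)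
    ((hρ.2.trans hq.le).trans h.lt.le)

theorem monotoneOn_volumeJ (h : IsMobiusMinimal k φ b R p w rbar M) (hk : 1 ≤ k) :
    MonotoneOn (volumeJ k φ b M) (Ioo 0 rbar) := by
  intro r hr q hq hrq
  rcases hrq.eq_or_lt with rfl | hrq
  · exact le_rfl
  rw [← sub_nonneg, h.volumeJ_sub hk hr.1 hrq hq.2]
  exact mul_nonneg (pow_nonneg h.model.radius_pos.le _)
    (h.integral_volumeIntegrand_nonneg hr.1 hrq hq.2)

theorem monotoneOn_weightedI (h : IsMobiusMinimal k φ b R p w rbar M) (hk : 1 ≤ k) :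
    MonotoneOn (weightedI k φ b p M) (Ioo 0 rbar) := by
  intro r hr q hq hrq
  rcases hrq.eq_or_lt with rfl | hrq
  · exact le_rfl
  rw [← sub_nonneg, (h.weightedI_sub hk hr.1 hrq hq.2).2]
  exact add_nonneg (mul_nonneg (pow_nonneg h.model.radius_pos.le _)
    (h.integral_weightedIntegrand_nonneg hr.1 hrq hq.2))
    (mul_nonneg (by positivity) (h.integral_radialIntegrand_nonneg hr.1 hrq hq.2))

end IsMobiusMinimal

end Monotonicity

end MobiusMonotonicity

namespace MobiusMonotonicity

open Filter

/-! ### Rigidity -/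

section Rigidity

variable {k n : ℕ} {M : Set (E n)} {φ : Equiv.Perm (OnePoint (E n))} {b p w : E n} {R rbar : ℝ}

namespace IsMobiusMinimal

theorem radialLevel_mem (h : IsMobiusMinimal k φ b R p w rbar M) {x : E n} (hx : x ∈ M)
    (hxp : x ≠ p) : radialLevel φ x ∈ Ioo 0 rbar := by
  have hD := h.proper.denom_pos x hx
  refine ⟨(radialLevel_nonneg φ x).lt_of_ne fun h0 => ?_,
    ((h.model.mem_imageBall rbar h.pos h.lt x).1 (h.subset hx)).2⟩
  have h1 := affineLevel_pos h.model.ne_zero hD hxp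
  rw [h.model.affineLevel_eq x hD, ← h0] at h1
  simp [sphereLevel] at h1

/-- The points with `r < |φ⁻¹| < q` form a relatively open subset of `M` on which `g` is continuous,
so vanishing almost everywhere is vanishing everywhere. -/
theorem eq_zero_of_ae_band (h : IsMobiusMinimal k φ b R p w rbar M) {g : E n → ℝ}
    (hg : ContinuousOn g (M \ {p})) {r q : ℝ} (hr0 : 0 < r) (hq : q < rbar)
    (h0 : ∀ᵐ x ∂(μHE[k] : Measure (E n)).restrict ((M ∩ imageBall φ q) \ imageBall φ r), g x = 0)
    {x : E n} (hx : x ∈ M) (hrx : r < radialLevel φ x) (hxq : radialLevel φ x < q) : g x = 0 := by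
  have hrq := hrx.trans hxq
  have hD := h.proper.denom_pos x hx
  set O := {x : E n | 0 < R ^ 2 - 2 * ⟪x - p, w⟫} ∩
    affineLevel p w R ⁻¹' Ioo (sphereLevel R ‖b‖ r) (sphereLevel R ‖b‖ q) with hO
  have hOo : IsOpen O :=
    contDiffOn_affineLevel.continuousOn.isOpen_inter_preimage isOpen_denom_pos isOpen_Ioo
  have hpos := sphereLevel_pos h.model.radius_pos hr0 ((hrq.trans hq).trans h.lt)
  have hsub : M ∩ O ⊆ (M ∩ imageBall φ q) \ imageBall φ r := by
    rintro y ⟨hyM, -, hy⟩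
    rw [h.band_eq hr0 hrq hq]
    exact ⟨hyM, hy.1.le, hy.2⟩
  refine h.proper.minimal.isSubmanifold.eq_zero_of_ae hOo (hg.mono ?_)
    (ae_restrict_of_ae_restrict_of_subset hsub h0) ⟨hx, hD, ?_⟩
  · rintro y ⟨hyM, -, hy⟩
    exact ⟨hyM, IsProperMinimal.ne_of_level_pos (hpos.trans hy.1)⟩
  · have h1 := h.model.radialLevel_lt x hD
    rw [mem_preimage, h.model.affineLevel_eq x hD]
    exact ⟨(sphereLevel_lt_iff h.model.radius_pos hr0.le (hrx.trans h1)
        (radialLevel_nonneg φ x) h1).2 hrx,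
      (sphereLevel_lt_iff h.model.radius_pos (radialLevel_nonneg φ x) h1
        (hr0.trans hrq).le (hq.trans h.lt)).2 hxq⟩

theorem continuousOn_norPart_div (h : IsMobiusMinimal k φ b R p w rbar M) :
    ContinuousOn (fun x => ‖norPart M x (x - p)‖ ^ 2 / ‖x - p‖ ^ 2) (M \ {p}) := by
  refine ContinuousOn.div ((h.proper.continuousOn_norPart_sub.mono sdiff_subset).norm.pow 2)
    (by fun_prop) fun x hx => ?_
  exact pow_ne_zero 2 (norm_ne_zero_iff.2 (sub_ne_zero.2 hx.2))

/-- Choose radii `r < |φ⁻¹(x)| < q`. The integral of the nonnegative integrand over the band is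
zero, so the integrand vanishes at `x`, and with it both of its squares. -/
theorem eq_zero_of_volumeJ_const (h : IsMobiusMinimal k φ b R p w rbar M) (hk : 1 ≤ k) {c : ℝ}
    (hc : ∀ r ∈ Ioo 0 rbar, volumeJ k φ b M r = c) {x : E n} (hx : x ∈ M) (hxp : x ≠ p) :
    norPart M x (x - p) = 0 ∧ tanPart M x w = 0 := by
  obtain ⟨hℓ0, hℓ⟩ := h.radialLevel_mem hx hxp
  obtain ⟨r, hr0, hr⟩ := exists_between hℓ0
  obtain ⟨q, hq', hq⟩ := exists_between hℓ
  have hrq := hr.trans hq'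
  have h1 := h.volumeJ_sub hk hr0 hrq hq
  rw [hc q ⟨hr0.trans hrq, hq⟩, hc r ⟨hr0, hrq.trans hq⟩, sub_self] at h1
  have h2 := (mul_eq_zero.1 h1.symm).resolve_left (pow_pos h.model.radius_pos k).ne'
  rw [setIntegral_eq_zero_iff_of_nonneg_ae _ (h.integrableOn_volumeIntegrand hr0 hrq hq)] at h2
  · have h3 : affineVolumeIntegrand k M p w R x = 0 := by
      refine h.eq_zero_of_ae_band h.proper.continuousOn_affineVolumeIntegrand hr0 hq ?_ hx hr hq'
      filter_upwards [h2, ae_restrict_mem (h.measurableSet_band hr0 hrq hq)] with y hy hyM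
      rw [← h.volumeIntegrand_eq hyM.1.1]
      exact hy
    have hf := affineLevel_pos h.model.ne_zero (h.proper.denom_pos x hx) hxp
    have hw := norm_pos_iff.2 h.model.ne_zero
    have hX : 0 < ‖x - p‖ := norm_pos_iff.2 (sub_ne_zero.2 hxp)
    have h4 := (mul_eq_zero.1 h3).resolve_left (Real.rpow_pos_of_pos hf _).ne'
    have h5 := (div_eq_zero_iff.1 h4).resolve_right (by positivity)
    rw [add_eq_zero_iff_of_nonneg (by positivity) (by positivity)] at h5
    simpa [hw.ne', hf.ne'] using h5
  · filter_upwards [ae_restrict_mem (h.measurableSet_band hr0 hrq hq)] with y hy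
    exact h.volumeIntegrand_nonneg hy.1.1

theorem eq_zero_of_weightedI_const (h : IsMobiusMinimal k φ b R p w rbar M) (hk : 1 ≤ k) {c : ℝ}
    (hc : ∀ r ∈ Ioo 0 rbar, weightedI k φ b p M r = c) {x : E n} (hx : x ∈ M) (hxp : x ≠ p) :
    norPart M x (x - p) = 0 ∧ tanPart M x w = 0 := by
  have hf := affineLevel_pos h.model.ne_zero (h.proper.denom_pos x hx) hxp
  have hw := norm_pos_iff.2 h.model.ne_zero
  have hX : 0 < ‖x - p‖ := norm_pos_iff.2 (sub_ne_zero.2 hxp)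
  obtain ⟨hℓ0, hℓ⟩ := h.radialLevel_mem hx hxp
  have hk' : (0 : ℝ) < k * ‖b‖ ^ 2 := by
    have h1 : (0 : ℝ) < k := by exact_mod_cast hk
    have h2 := h.model.norm_pos
    positivity
  have hzero : ∀ r q, 0 < r → r < q → q < rbar →
      (∫ x in (M ∩ imageBall φ q) \ imageBall φ r,
        weightedIntegrand k φ b R p w M x ∂μHE[k]) = 0 ∧
      ∫ ρ in r..q, radialIntegrand k φ b p M ρ = 0 := by
    intro r q hr0 hrq hq
    have h1 := (h.weightedI_sub hk hr0 hrq hq).2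
    rw [hc q ⟨hr0.trans hrq, hq⟩, hc r ⟨hr0, hrq.trans hq⟩, sub_self, eq_comm,
      add_eq_zero_iff_of_nonneg
        (mul_nonneg (pow_nonneg h.model.radius_pos.le _)
          (h.integral_weightedIntegrand_nonneg hr0 hrq hq))
        (mul_nonneg hk'.le (h.integral_radialIntegrand_nonneg hr0 hrq hq))] at h1
    exact ⟨(mul_eq_zero.1 h1.1).resolve_left (pow_pos h.model.radius_pos k).ne',
      (mul_eq_zero.1 h1.2).resolve_left hk'.ne'⟩
  constructor
  · obtain ⟨q, hq', hq⟩ := exists_between hℓ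
    have hI := (h.weightedI_sub hk hℓ0 hq' hq).1
    have h1 := (hzero _ q hℓ0 hq' hq).2
    rw [intervalIntegral.integral_of_le hq'.le] at h1
    rw [intervalIntegrable_iff_integrableOn_Ioc_of_le hq'.le] at hI
    rw [setIntegral_eq_zero_iff_of_nonneg_ae _ hI] at h1
    · have hne : (volume.restrict (Ioc (radialLevel φ x) q) : Measure ℝ) ≠ 0 := by
        rw [Ne, Measure.restrict_eq_zero, Real.volume_Ioc]
        simpa using hq'
      have := ae_neBot.2 hne
      obtain ⟨ρ, hρ0, hρ⟩ := (h1.and (ae_restrict_mem measurableSet_Ioc)).exists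
      have hρpos := hℓ0.trans hρ.1
      have hρb := hρ.2.trans_lt hq
      have hsq : 0 < ‖b‖ ^ 2 - ρ ^ 2 := by nlinarith [hρb.trans h.lt]
      have h2 : ∫ y in M ∩ imageBall φ ρ, ‖norPart M y (y - p)‖ ^ 2 / ‖y - p‖ ^ 2 ∂μHE[k] = 0 :=
        (mul_eq_zero.1 hρ0).resolve_left (by positivity)
      rw [setIntegral_eq_zero_iff_of_nonneg_ae (Eventually.of_forall fun y => by positivity)
        (h.finiteness hρpos hρb).2.2] at h2
      obtain ⟨r, hr0, hr⟩ := exists_between hℓ0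
      have h3 := h.eq_zero_of_ae_band h.continuousOn_norPart_div hr0 hρb
        (ae_restrict_of_ae_restrict_of_subset sdiff_subset h2) hx hr hρ.1
      have h4 := (div_eq_zero_iff.1 h3).resolve_right (by positivity)
      simpa using h4
    · filter_upwards [ae_restrict_mem measurableSet_Ioc] with ρ hρ
      exact radialIntegrand_nonneg (hℓ0.trans hρ.1).le ((hρ.2.trans hq.le).trans h.lt.le)
  · obtain ⟨r, hr0, hr⟩ := exists_between hℓ0
    obtain ⟨q, hq', hq⟩ := exists_between hℓ
    have hrq := hr.trans hq'
    have h2 := (hzero r q hr0 hrq hq).1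
    rw [setIntegral_eq_zero_iff_of_nonneg_ae _ (h.integrableOn_weightedIntegrand hr0 hrq hq)] at h2
    · have h3 : affineWeightedIntegrand k M p w R x = 0 := by
        refine h.eq_zero_of_ae_band h.proper.continuousOn_affineWeightedIntegrand hr0 hq ?_ hx hr
          hq'
        filter_upwards [h2, ae_restrict_mem (h.measurableSet_band hr0 hrq hq)] with y hy hyM
        rw [← h.weightedIntegrand_eq hyM.1.1]
        exact hy
      have h4 := (mul_eq_zero.1 h3).resolve_left (Real.rpow_pos_of_pos hf _).ne'
      have h5 := (div_eq_zero_iff.1 h4).resolve_right (by positivity)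
      simpa using h5
    · filter_upwards [ae_restrict_mem (h.measurableSet_band hr0 hrq hq)] with y hy
      exact h.weightedIntegrand_nonneg hy.1.1

theorem isFlatDisk (h : IsMobiusMinimal k φ b R p w rbar M) (hne : M.Nonempty)
    (h0 : ∀ x ∈ M, x ≠ p → norPart M x (x - p) = 0 ∧ tanPart M x w = 0) :
    p ∈ M ∧ ∃ V : Submodule ℝ (E n), IsFlatDisk k V M ∧ ∀ v ∈ V, ⟪v, w⟫ = 0 := by
  have hτ := sphereLevel_pos h.model.radius_pos h.pos h.lt
  have hR := h.model.radius_pos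
  have hw := norm_pos_iff.2 h.model.ne_zero
  refine h.proper.minimal.isSubmanifold.isFlatDisk hne (fun y hy => ?_)
    (fun y hy hyp => (h0 y hy hyp).2) h.subset h.closure_subset
    -- On the hyperplane `⟪x - p, w⟫ = 0` the denominator is `R²`, so the image ball is cut out by
    -- `|w|²|x - p|² < R²` times the level of `rbar`.
    (ρ := √(sphereLevel R ‖b‖ rbar) * R / ‖w‖) (by positivity) fun x hx => ?_
  · by_cases hyp : y = p
    · simp [hyp, tanPart]
    · exact (sub_eq_zero.1 (h0 y hy hyp).1).symm
  · have hD : R ^ 2 - 2 * ⟪x - p, w⟫ = R ^ 2 := by rw [hx, mul_zero, sub_zero]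
    have hD0 : 0 < R ^ 2 - 2 * ⟪x - p, w⟫ := by
      rw [hD]
      positivity
    rw [h.model.mem_imageBall rbar h.pos h.lt, and_iff_right hD0,
      h.model.radialLevel_lt_iff h.pos h.lt hD0, affineLevel, hD, div_lt_iff₀ (by positivity),
      lt_div_iff₀ hw, ← sq_lt_sq₀ (a := ‖x - p‖ * ‖w‖) (by positivity) (by positivity), mul_pow,
      mul_pow, Real.sq_sqrt hτ.le, mul_comm]

end IsMobiusMinimal

/-- The image ball is open, hence disjoint from its frontier; a submanifold whose remaining limit
points lie on the frontier is therefore relatively closed in it. -/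
theorem IsLevelModel.isMobiusMinimal (h : IsLevelModel φ b R p w) (hr0 : 0 < rbar)
    (hr : rbar < ‖b‖) (hM : IsMinimalSubmanifold k M) (hsub : M ⊆ imageBall φ rbar)
    (hfr : closure M \ M ⊆ frontier (imageBall φ rbar)) : IsMobiusMinimal k φ b R p w rbar M := by
  have hcl : closure M ∩ imageBall φ rbar ⊆ M := by
    rintro x ⟨hx, hxU⟩
    by_contra hxM
    have h1 := hfr ⟨hx, hxM⟩
    rw [(h.isOpen_imageBall hr0 hr).frontier_eq] at h1
    exact h1.2 hxU
  exact ⟨h, hr0, hr, h.isProperMinimal hr0 hr hM hsub hcl, hsub, hcl⟩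

end Rigidity

end MobiusMonotonicity

end

/-! ### The main theorem -/

theorem theorem1p2 {n : ℕ} (φ : Equiv.Perm (OnePoint (E n))) (hφ : IsMobius φ)
    (b : E n) (hb : φ.symm ∞ = (b : OnePoint (E n))) (hb0 : b ≠ 0) :
    -- the isometric sphere exists, is centred at `b`, and is unique
    (∃! R : ℝ, IsIsometricSphere φ b R) ∧
    ∀ (R : ℝ) (hR : 0 < R), IsIsometricSphere φ b R →
    -- `a = σ(0)`, `p = φ(0)`, `w = φ(∞) - φ(a)`
    ∀ (a : OnePoint (E n)) (p w : E n),
      a = sphereReflection b R hR ((0 : E n) : OnePoint (E n)) →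
      p = finitePart (φ ((0 : E n) : OnePoint (E n))) →
      w = finitePart (φ ∞) - finitePart (φ a) →
    ∀ (rbar : ℝ), 0 < rbar → rbar < ‖b‖ →
    ∀ (k : ℕ), 1 ≤ k →
    ∀ (M : Set (E n)), IsMinimalSubmanifold k M → M ⊆ imageBall φ rbar →
      closure M \ M ⊆ frontier (imageBall φ rbar) →
    -- volumes and integrals defining `J` and `I` are finite
    (∀ r ∈ Ioo 0 rbar, μHE[k] (M ∩ imageBall φ r) < ⊤ ∧
      IntegrableOn (fun x => ‖tanPart M x (x - p)‖ ^ 2 / ‖x - p‖ ^ 2)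
        (M ∩ imageBall φ r) μHE[k] ∧
      IntegrableOn (fun x => ‖norPart M x (x - p)‖ ^ 2 / ‖x - p‖ ^ 2)
        (M ∩ imageBall φ r) μHE[k]) ∧
    -- volume monotonicity
    (∀ r q : ℝ, 0 < r → r < q → q < rbar →
      IntegrableOn (volumeIntegrand k φ b R p w M)
        ((M ∩ imageBall φ q) \ imageBall φ r) μHE[k] ∧
      volumeJ k φ b M q - volumeJ k φ b M r =
        R ^ k * ∫ x in (M ∩ imageBall φ q) \ imageBall φ r,
          volumeIntegrand k φ b R p w M x ∂μHE[k]) ∧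
    -- weighted monotonicity
    (∀ r q : ℝ, 0 < r → r < q → q < rbar →
      IntegrableOn (weightedIntegrand k φ b R p w M)
        ((M ∩ imageBall φ q) \ imageBall φ r) μHE[k] ∧
      IntervalIntegrable (radialIntegrand k φ b p M) volume r q ∧
      weightedI k φ b p M q - weightedI k φ b p M r =
        R ^ k * (∫ x in (M ∩ imageBall φ q) \ imageBall φ r,
          weightedIntegrand k φ b R p w M x ∂μHE[k]) +
        k * ‖b‖ ^ 2 * ∫ ρ in r..q, radialIntegrand k φ b p M ρ) ∧
    -- monotonicity
    MonotoneOn (weightedI k φ b p M) (Ioo 0 rbar) ∧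
    MonotoneOn (volumeJ k φ b M) (Ioo 0 rbar) ∧
    -- rigidity
    (M.Nonempty →
      ((∃ c : ℝ, ∀ r ∈ Ioo 0 rbar, weightedI k φ b p M r = c) ∨
        (∃ c : ℝ, ∀ r ∈ Ioo 0 rbar, volumeJ k φ b M r = c)) →
      p ∈ M ∧ ∃ V : Submodule ℝ (E n), IsFlatDisk k V M ∧ ∀ v ∈ V, inner ℝ v w = 0) := by
  refine ⟨?_, ?_⟩
  · obtain ⟨R, hR⟩ := exists_isIsometricSphere hφ hb
    exact ⟨R, hR, fun R' hR' => hR'.radius_unique hb0 hR⟩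
  intro R hR hiso a p w ha hp hw rbar hr0 hr k hk M hM hsub hfr
  have h := (hiso.isLevelModel hb0 hR ha hp hw).isMobiusMinimal hr0 hr hM hsub hfr
  refine ⟨fun r hr => h.finiteness hr.1 hr.2, fun r q hr0 hrq hq =>
    ⟨h.integrableOn_volumeIntegrand hr0 hrq hq, h.volumeJ_sub hk hr0 hrq hq⟩,
    fun r q hr0 hrq hq => ⟨h.integrableOn_weightedIntegrand hr0 hrq hq,
      h.weightedI_sub hk hr0 hrq hq⟩,
    h.monotoneOn_weightedI hk, h.monotoneOn_volumeJ hk, fun hne hconst => ?_⟩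
  refine h.isFlatDisk hne fun x hx hxp => ?_
  rcases hconst with ⟨c, hc⟩ | ⟨c, hc⟩
  · exact h.eq_zero_of_weightedI_const hk hc hx hxp
  · exact h.eq_zero_of_volumeJ_const hk hc hx hxp
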